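/- Let $k$ be an algebraically closed field of characteristic $p>0$, let $W=W(k)$ with Frobenius $\sigma$, and let $\mathbb E=W_\sigma[F,V]$ be the Dieudonné ring: $FV=VF=p$, $F\lambda=\sigma(\lambda)F$, $V\lambda=\sigma^{-1}(\lambda)V$ for $\lambda\in W$. A Dieudonné module is an $\mathbb E$-module which is free and finitely generated over $W$; its dual is $M^\vee=\mathrm{Hom}_W(M,W)$ with $(Ff)(x)=\sigma(f(Vx))$ and $(Vf)(x)=\sigma^{-1}(f(Fx))$. For an F-crystal $L$ (a finitely generated free $W$-module with an injective $\sigma$-linear endomorphism $F$) let $\mathbf L$ be the pro-algebraic $k$-group with $\mathbf L(k)=L$ (isomorphic to $\mathbf W^{\mathrm{rk}\,L}$, where $\mathbf W$ is the perfect group of Witt vectors), let $\mathrm F^1_N(L)=\{x\in L: p\mid F(x)\}$ with $\mathrm F^1_N(\mathbf L)\subset\mathbf L$ the corresponding closed subgroup, and let $$\mathbf U_L=\mathrm{Coker}\big[F/p-1\colon \mathrm F^1_N(\mathbf L)\to\mathbf L\big].$$ The $W$-modules $M\otimes N=M\otimes_WN$ and $\wedge^2N=\wedge^2_WN$ are F-crystals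 with $F(x\otimes y)=Fx\otimes Fy$ and $F(x\wedge y)=Fx\wedge Fy$. The group $\mathrm{Hom}_W(M/p^n,N/p^n)$ is a quasi-algebraic group as a quotient of the pro-algebraic group $\mathrm{Hom}_W(M,N)$, and $\mathrm{Hom}_{\mathbb E}(M/p^n,N/p^n)$ is its subgroup of maps commuting with $F$ and $V$. Let $n\ge 1$. (1) For all Dieudonné modules $M$ and $N$ there is an isomorphism of quasi-algebraic groups $$\mathbf U_{M^\vee\otimes N}[p^n]\;\cong\;\mathrm{Hom}_{\mathbb E}(M/p^n,N/p^n)\big/\big(\mathrm{Hom}_{\mathbb E}(M,N)/p^n\big),$$ natural in $M$ (contravariantly) and in $N$ (covariantly) for homomorphisms of $\mathbb E$-modules. (2) If $p\ne 2$, then for every Dieudonné module $N$ there is an isomorphism of quasi-algebraic groups $$\mathbf U_{\wedge^2N}[p^n]\;\cong\;\mathrm{Hom}_{\mathbb E}(N^\vee/p^n,N/p^n)^{\mathrm{skew}}\big/\big(\mathrm{Hom}_{\mathbb E}(N^\vee,N)^{\mathrm{skew}}/p^n\big),$$ natural in $N$ for homomorphisms of $\mathbb E$-modules. Here $\mathrm{skew}$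 denotes the subgroup of anti-self-dual elements: those $f$ with $f^\vee=-f$, where $N^{\vee\vee}$ is identified with $N$, and likewise modulo $p^n$. -/

import Mathlib

open scoped TensorProduct

universe u v w v' w'

noncomputable section

namespace QuasiAlg

/-! ### Groups with regular functions

A commutative affine quasi-algebraic or pro-algebraic group over an algebraically closed field `k`
is given, following Serre, by its abstract group of `k`-points together with its `k`-algebra of
regular functions, closed under extraction of `p`-th roots.  A closed subgroup carries the
restrictions of the regular functions, and a quotient group carries the functions whose pull-back
is regular. -/

/-- Pull-back of `k`-valued functions. -/
def pullback (k : Type u) [Field k] {X : Type v} {Y : Type w} (φ : X → Y) :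
    (Y → k) →ₐ[k] (X → k) where
  toFun f := fun x => f (φ x)
  map_one' := rfl
  map_mul' _ _ := rfl
  map_zero' := rfl
  map_add' _ _ := rfl
  commutes' _ := rfl

/-- A commutative group together with a `k`-algebra of `k`-valued functions on it, called
regular. -/
structure RegGroup (k : Type u) [Field k] where
  carrier : Type v
  [addCommGroup : AddCommGroup carrier]
  regular : Subalgebra k (carrier → k)

attribute [instance] RegGroup.addCommGroup

namespace RegGroup

variable {k : Type u} [Field k]

/-- A subgroup, with the restrictions of the regular functions. -/
def sub (G : RegGroup.{u, v} k) (H : AddSubgroup G.carrier) : RegGroup.{u, v} k where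
  carrier := H
  regular := G.regular.map (pullback k (fun h : H => (h : G.carrier)))

/-- The quotient by a subgroup, with the functions whose pull-back is regular. -/
def quot (G : RegGroup.{u, v} k) (H : AddSubgroup G.carrier) : RegGroup.{u, v} k where
  carrier := G.carrier ⧸ H
  regular := G.regular.comap (pullback k (fun g : G.carrier => (QuotientAddGroup.mk g : _ ⧸ H)))

/-- The kernel of multiplication by `m`. -/
def torsion (G : RegGroup.{u, v} k) (m : ℕ) : RegGroup.{u, v} k :=
  G.sub (nsmulAddMonoidHom (α := G.carrier) m).ker

/-- The subquotient `K / H` for subgroups `H ≤ K` of `G`. -/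
def subquot (G : RegGroup.{u, v} k) (K H : AddSubgroup G.carrier) : RegGroup.{u, v} k :=
  (G.sub K).quot (H.addSubgroupOf K)

/-- The homomorphism induced on kernels of multiplication by `m`. -/
def torsionMap {G : RegGroup.{u, v} k} {G' : RegGroup.{u, w} k}
    (φ : G.carrier →+ G'.carrier) (m : ℕ) :
    (G.torsion m).carrier →+ (G'.torsion m).carrier :=
  (φ.comp (nsmulAddMonoidHom (α := G.carrier) m).ker.subtype).codRestrict
    (nsmulAddMonoidHom (α := G'.carrier) m).ker (fun x => by
      have hx : m • (x : G.carrier) = 0 := x.2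
      change m • φ (x : G.carrier) = 0
      rw [← map_nsmul, hx, map_zero])

/-- The homomorphism induced on subquotients. -/
def subquotMap {G : RegGroup.{u, v} k} {G' : RegGroup.{u, w} k}
    {K H : AddSubgroup G.carrier} {K' H' : AddSubgroup G'.carrier}
    (φ : G.carrier →+ G'.carrier) (hK : ∀ g ∈ K, φ g ∈ K') (hH : ∀ g ∈ H, φ g ∈ H') :
    (G.subquot K H).carrier →+ (G'.subquot K' H').carrier :=
  QuotientAddGroup.map (H.addSubgroupOf K) (H'.addSubgroupOf K')
    ((φ.comp K.subtype).codRestrict K' (fun g => hK g g.2))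
    (fun g hg => hH g hg)

/-- `G` is a (commutative, affine) quasi-algebraic group over the algebraically closed field `k` of
characteristic `p`: the algebra of regular functions is closed under `p`-th roots, is finitely
generated up to `p`-power roots, its `k`-algebra homomorphisms to `k` are exactly the evaluations
at the points of `G`, and the group operations are given by regular functions. -/
structure IsQuasiAlgebraic (p : ℕ) (G : RegGroup.{u, v} k) : Prop where
  perfect : ∀ f : G.carrier → k, f ^ p ∈ G.regular → f ∈ G.regular
  finite_type : ∃ S : Finset (G.carrier → k), (↑S : Set (G.carrier → k)) ⊆ G.regular ∧
    ∀ f ∈ G.regular, ∃ m : ℕ, f ^ p ^ m ∈ Algebra.adjoin k (↑S : Set (G.carrier → k))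
  points : ∀ χ : G.regular →ₐ[k] k, ∃! g : G.carrier, ∀ f : G.regular, χ f = f.1 g
  add_regular : ∀ f ∈ G.regular,
    (fun z : G.carrier × G.carrier => f (z.1 + z.2)) ∈
      G.regular.map (pullback k Prod.fst) ⊔ G.regular.map (pullback k Prod.snd)
  neg_regular : ∀ f ∈ G.regular, (fun g => f (-g)) ∈ G.regular

/-- An isomorphism: a group isomorphism which identifies the regular functions. -/
structure Iso (G : RegGroup.{u, v} k) (G' : RegGroup.{u, w} k)
    extends G.carrier ≃+ G'.carrier where
  regular_iff : ∀ f : G'.carrier → k,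
    f ∈ G'.regular ↔ (fun g => f (toAddEquiv g)) ∈ G.regular

end RegGroup

variable {p : ℕ} [Fact p.Prime] {k : Type u} [Field k] [CharP k p]

/-- The functions some `p`-power of which lies in a given algebra of functions. -/
def rootClosure (p : ℕ) [Fact p.Prime] {k : Type u} [Field k] [CharP k p] {X : Type v}
    (A : Subalgebra k (X → k)) : Subalgebra k (X → k) where
  carrier := {f | ∃ m : ℕ, f ^ p ^ m ∈ A}
  mul_mem' := by
    rintro f g ⟨m, hm⟩ ⟨l, hl⟩
    refine ⟨m + l, ?_⟩
    rw [mul_pow]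
    refine A.mul_mem ?_ ?_
    · rw [pow_add, pow_mul]; exact A.pow_mem hm _
    · rw [add_comm, pow_add, pow_mul]; exact A.pow_mem hl _
  add_mem' := by
    rintro f g ⟨m, hm⟩ ⟨l, hl⟩
    refine ⟨m + l, ?_⟩
    have h : (f + g) ^ p ^ (m + l) = f ^ p ^ (m + l) + g ^ p ^ (m + l) := by
      funext x
      simp only [Pi.pow_apply, Pi.add_apply]
      exact add_pow_char_pow ..
    rw [h]
    refine A.add_mem ?_ ?_
    · rw [pow_add, pow_mul]; exact A.pow_mem hm _
    · rw [add_comm, pow_add, pow_mul]; exact A.pow_mem hl _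
  algebraMap_mem' c := ⟨0, by simp⟩

/-- The pro-algebraic group `𝐋` with `𝐋(k) = L` attached to a (free, finitely generated) module `L`
over the Witt vectors: its regular functions are the `p`-power roots of polynomials in the Witt
components of the values of linear forms. A basis of `L` of length `r` identifies it with the
perfect pro-algebraic group `𝐖 ^ r`. -/
def ofModule (p : ℕ) [Fact p.Prime] (k : Type u) [Field k] [CharP k p]
    (L : Type v) [AddCommGroup L] [Module (WittVector p k) L] : RegGroup.{u, v} k where
  carrier := L
  regular := rootClosure p (Algebra.adjoin k
    {f : L → k | ∃ (l : Module.Dual (WittVector p k) L) (i : ℕ), f = fun x => (l x).coeff i})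

theorem p_smul_injective {L : Type v} [AddCommGroup L] [Module (WittVector p k) L]
    [Module.Free (WittVector p k) L] :
    Function.Injective (fun x : L => (p : WittVector p k) • x) :=
  smul_right_injective L (WittVector.p_nonzero p k)

/-- The Frobenius `σ` of `W(k)`. -/
abbrev sigma (p : ℕ) [Fact p.Prime] (k : Type u) [Field k] [CharP k p] :
    WittVector p k →+* WittVector p k := WittVector.frobenius

/-! ### F-crystals and the groups `U_L` -/

/-- An F-crystal over `k`. -/
structure FCrystal (p : ℕ) [Fact p.Prime] (k : Type u) [Field k] [CharP k p] where
  carrier : Type v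
  [addCommGroup : AddCommGroup carrier]
  [module : Module (WittVector p k) carrier]
  [free : Module.Free (WittVector p k) carrier]
  [finite : Module.Finite (WittVector p k) carrier]
  F : carrier →ₛₗ[sigma p k] carrier
  F_injective : Function.Injective F

attribute [instance] FCrystal.addCommGroup FCrystal.module FCrystal.free FCrystal.finite

namespace FCrystal

/-- `F¹_N(L)`: the elements `x` such that `p` divides `F x`. -/
def nygaard (L : FCrystal.{u, v} p k) : AddSubgroup L.carrier where
  carrier := {x | ∃ y : L.carrier, L.F x = (p : WittVector p k) • y}
  zero_mem' := ⟨0, by simp⟩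
  add_mem' := by
    rintro a b ⟨y, hy⟩ ⟨z, hz⟩
    exact ⟨y + z, by rw [map_add, hy, hz, smul_add]⟩
  neg_mem' := by
    rintro a ⟨y, hy⟩
    exact ⟨-y, by rw [map_neg, hy, smul_neg]⟩

/-- `F / p : F¹_N(L) → L`. -/
def divF (L : FCrystal.{u, v} p k) : L.nygaard →+ L.carrier :=
  AddMonoidHom.mk' (fun x => x.2.choose) (fun a b => p_smul_injective (p := p) (k := k) (by
    have h := (a + b).2.choose_spec
    have ha := a.2.choose_spec
    have hb := b.2.choose_spec
    simp only [smul_add]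
    rw [← h, ← ha, ← hb]
    simp))

theorem p_smul_divF (L : FCrystal.{u, v} p k) (x : L.nygaard) :
    (p : WittVector p k) • L.divF x = L.F x := x.2.choose_spec.symm

/-- `U_L`, the cokernel of `F / p - 1 : F¹_N(L) → L`. -/
def U (L : FCrystal.{u, v} p k) : RegGroup.{u, v} k :=
  (ofModule p k L.carrier).quot (L.divF - L.nygaard.subtype).range

/-- Morphisms of F-crystals. -/
structure Hom (L : FCrystal.{u, v} p k) (L' : FCrystal.{u, w} p k) where
  toLinearMap : L.carrier →ₗ[WittVector p k] L'.carrier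
  map_F : ∀ x, toLinearMap (L.F x) = L'.F (toLinearMap x)

/-- The homomorphism `U_L → U_L'` induced by a morphism of F-crystals. -/
def Hom.mapU {L : FCrystal.{u, v} p k} {L' : FCrystal.{u, w} p k} (φ : Hom L L') :
    L.U.carrier →+ L'.U.carrier :=
  QuotientAddGroup.map (L.divF - L.nygaard.subtype).range (L'.divF - L'.nygaard.subtype).range
    φ.toLinearMap.toAddMonoidHom (by
      rintro _ ⟨x, rfl⟩
      have hx : φ.toLinearMap x ∈ L'.nygaard :=
        ⟨φ.toLinearMap (L.divF x), by rw [← φ.map_F, ← map_smul, p_smul_divF]⟩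
      refine ⟨⟨φ.toLinearMap x, hx⟩, ?_⟩
      have h : L'.divF ⟨φ.toLinearMap x, hx⟩ = φ.toLinearMap (L.divF x) :=
        p_smul_injective (p := p) (k := k) (by
          change (p : WittVector p k) • _ = (p : WittVector p k) • _
          rw [p_smul_divF, ← map_smul, p_smul_divF, φ.map_F])
      simp [h])

end FCrystal

/-! ### Dieudonné modules -/

variable [IsAlgClosed k]

/-- The inverse `σ⁻¹` of the Frobenius of `W(k)`. -/
abbrev sigmaInv (p : ℕ) [Fact p.Prime] (k : Type u) [Field k] [CharP k p] [IsAlgClosed k] :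
    WittVector p k →+* WittVector p k := ((WittVector.frobeniusEquiv p k).symm : _ →+* _)

theorem sigma_sigmaInv (a : WittVector p k) : sigma p k (sigmaInv p k a) = a :=
  (WittVector.frobeniusEquiv p k).apply_symm_apply a

theorem sigmaInv_sigma (a : WittVector p k) : sigmaInv p k (sigma p k a) = a :=
  (WittVector.frobeniusEquiv p k).symm_apply_apply a


/-- A Dieudonné module: a module over the Dieudonné ring `W_σ[F, V]` which is free and finitely
generated over `W = W(k)`. -/
structure DieudonneModule (p : ℕ) [Fact p.Prime] (k : Type u) [Field k] [CharP k p]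
    [IsAlgClosed k] where
  carrier : Type v
  [addCommGroup : AddCommGroup carrier]
  [module : Module (WittVector p k) carrier]
  [free : Module.Free (WittVector p k) carrier]
  [finite : Module.Finite (WittVector p k) carrier]
  F : carrier →ₛₗ[sigma p k] carrier
  V : carrier →ₛₗ[sigmaInv p k] carrier
  F_V : ∀ x, F (V x) = (p : WittVector p k) • x
  V_F : ∀ x, V (F x) = (p : WittVector p k) • x

attribute [instance] DieudonneModule.addCommGroup DieudonneModule.module DieudonneModule.free
  DieudonneModule.finite

namespace DieudonneModule

/-- The dual `M^∨ = Hom_W(M, W)` with `(F f)(x) = σ (f (V x))` and `(V f)(x) = σ⁻¹ (f (F x))`. -/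
abbrev dual (M : DieudonneModule.{u, v} p k) : DieudonneModule.{u, max u v} p k where
  carrier := Module.Dual (WittVector p k) M.carrier
  F :=
    { toFun := fun f =>
        { toFun := fun x => sigma p k (f (M.V x))
          map_add' := by intro x y; simp only [map_add]
          map_smul' := by
            intro a x
            simp only [map_smulₛₗ, smul_eq_mul, map_mul, sigma_sigmaInv, RingHom.id_apply] }
      map_add' := by intro f g; ext1 x; exact map_add (sigma p k) _ _
      map_smul' := by intro a f; ext1 x; exact map_mul (sigma p k) _ _ }
  V :=
    { toFun := fun f =>
        { toFun := fun x => sigmaInv p k (f (M.F x))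
          map_add' := by intro x y; simp only [map_add]
          map_smul' := by
            intro a x
            simp only [map_smulₛₗ, smul_eq_mul, map_mul, sigmaInv_sigma, RingHom.id_apply] }
      map_add' := by intro f g; ext1 x; exact map_add (sigmaInv p k) _ _
      map_smul' := by intro a f; ext1 x; exact map_mul (sigmaInv p k) _ _ }
  F_V f := by
    ext1 x
    change sigma p k (sigmaInv p k (f (M.F (M.V x)))) = (p : WittVector p k) • f x
    rw [sigma_sigmaInv, M.F_V, map_smul]
  V_F f := by
    ext1 x
    change sigmaInv p k (sigma p k (f (M.V (M.F x)))) = (p : WittVector p k) • f x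
    rw [sigmaInv_sigma, M.V_F, map_smul]

theorem dual_F_apply (M : DieudonneModule.{u, v} p k) (f : Module.Dual (WittVector p k) M.carrier)
    (x : M.carrier) :
    (show Module.Dual (WittVector p k) M.carrier from M.dual.F f) x = sigma p k (f (M.V x)) := rfl

theorem dual_V_apply (M : DieudonneModule.{u, v} p k) (f : Module.Dual (WittVector p k) M.carrier)
    (x : M.carrier) :
    (show Module.Dual (WittVector p k) M.carrier from M.dual.V f) x =
      sigmaInv p k (f (M.F x)) := rfl

/-- The F-crystal `M ⊗ N` with `F (x ⊗ y) = F x ⊗ F y`. -/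
abbrev tensor (M : DieudonneModule.{u, v} p k) (N : DieudonneModule.{u, w} p k) :
    FCrystal.{u, max v w} p k where
  carrier := M.carrier ⊗[WittVector p k] N.carrier
  F := TensorProduct.map M.F N.F
  F_injective := by
    have key : ∀ z, TensorProduct.map M.V N.V (TensorProduct.map M.F N.F z) =
        (p : WittVector p k) • (p : WittVector p k) • z := by
      intro z
      induction z with
      | zero => simp
      | tmul x y =>
        simp only [TensorProduct.map_tmul, M.V_F, N.V_F]
        rw [TensorProduct.tmul_smul, ← TensorProduct.smul_tmul']
      | add a b ha hb => rw [map_add, map_add, ha, hb, smul_add, smul_add]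
    intro a b h
    have h2 := congrArg (TensorProduct.map M.V N.V) h
    rw [key, key] at h2
    exact p_smul_injective (p := p) (k := k) (p_smul_injective (p := p) (k := k) h2)


/-- A module regarded as a module through a ring homomorphism `τ`. -/
def Twist {R : Type u} [CommRing R] (_τ : R →+* R) (P : Type v) : Type v := P

instance {R : Type u} [CommRing R] (τ : R →+* R) (P : Type v) [AddCommGroup P] :
    AddCommGroup (Twist τ P) := inferInstanceAs (AddCommGroup P)

instance {R : Type u} [CommRing R] (τ : R →+* R) (P : Type v) [AddCommGroup P] [Module R P] :
    Module R (Twist τ P) := Module.compHom P τ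

theorem update_comp {X Y : Type v} {ι : Type w} [DecidableEq ι] (f : X → Y) (v : ι → X) (i : ι)
    (z : X) : (fun j => f (Function.update v i z j)) = Function.update (fun j => f (v j)) i (f z) :=
  Function.comp_update f v i z

/-- The map `(x, y) ↦ f x ∧ f y` for a semilinear map `f`, as an alternating map to a twist. -/
def wedgeAlt {R : Type u} [CommRing R] {τ : R →+* R} {X : Type v} [AddCommGroup X]
    [Module R X] (f : X →ₛₗ[τ] X) : X [⋀^Fin 2]→ₗ[R] Twist τ (⋀[R]^2 X) where
  toFun v := (exteriorPower.ιMulti R 2 (fun i => f (v i)) : ⋀[R]^2 X)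
  map_update_add' := by
    intro _ v i x y
    change (exteriorPower.ιMulti R 2 _ : ⋀[R]^2 X) =
      (exteriorPower.ιMulti R 2 _ : ⋀[R]^2 X) + (exteriorPower.ιMulti R 2 _ : ⋀[R]^2 X)
    rw [update_comp, update_comp, update_comp, map_add, AlternatingMap.map_update_add]
  map_update_smul' := by
    intro _ v i c x
    change (exteriorPower.ιMulti R 2 _ : ⋀[R]^2 X) =
      τ c • (exteriorPower.ιMulti R 2 _ : ⋀[R]^2 X)
    rw [update_comp, update_comp, map_smulₛₗ, AlternatingMap.map_update_smul]
  map_eq_zero_of_eq' := by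
    intro v i j hij hne
    exact (exteriorPower.ιMulti R 2 (M := X)).map_eq_zero_of_eq _ (by simp [hij]) hne

/-- The exterior square `x ∧ y ↦ f x ∧ f y` of a semilinear map. -/
def wedgeMap {R : Type u} [CommRing R] {τ : R →+* R} {X : Type v} [AddCommGroup X]
    [Module R X] (f : X →ₛₗ[τ] X) : (⋀[R]^2 X) →ₛₗ[τ] (⋀[R]^2 X) where
  toFun z := (exteriorPower.alternatingMapLinearEquiv (wedgeAlt f) z : Twist τ (⋀[R]^2 X))
  map_add' a b := map_add (exteriorPower.alternatingMapLinearEquiv (wedgeAlt f)) a b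
  map_smul' c a := map_smul (exteriorPower.alternatingMapLinearEquiv (wedgeAlt f)) c a

theorem wedgeMap_apply_ιMulti {R : Type u} [CommRing R] {τ : R →+* R} {X : Type v}
    [AddCommGroup X] [Module R X] (f : X →ₛₗ[τ] X) (v : Fin 2 → X) :
    wedgeMap f (exteriorPower.ιMulti R 2 v) = exteriorPower.ιMulti R 2 (fun i => f (v i)) := by
  have h := exteriorPower.alternatingMapLinearEquiv_apply_ιMulti (wedgeAlt f) v
  exact h

/-- The F-crystal `⋀² N` with `F (x ∧ y) = F x ∧ F y`. -/
abbrev wedge (N : DieudonneModule.{u, v} p k) : FCrystal.{u, max u v} p k where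
  carrier := ⋀[WittVector p k]^2 N.carrier
  F := wedgeMap N.F
  F_injective := by
    have key : ∀ z, wedgeMap N.V (wedgeMap N.F z) =
        (p : WittVector p k) • (p : WittVector p k) • z := by
      intro z
      have hz : z ∈ Submodule.span (WittVector p k)
          (Set.range (exteriorPower.ιMulti (WittVector p k) 2 (M := N.carrier))) := by
        rw [exteriorPower.ιMulti_span]; trivial
      induction hz using Submodule.span_induction with
      | mem x hx =>
        obtain ⟨v, rfl⟩ := hx
        rw [wedgeMap_apply_ιMulti, wedgeMap_apply_ιMulti]
        simp only [N.V_F]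
        rw [(exteriorPower.ιMulti (WittVector p k) 2 (M := N.carrier)).map_smul_univ
          (fun _ => (p : WittVector p k)) v]
        simp [pow_two, smul_smul]
      | zero => simp
      | add a b _ _ ha hb => rw [map_add, map_add, ha, hb, smul_add, smul_add]
      | smul c a _ ha =>
        rw [map_smulₛₗ, map_smulₛₗ, ha, sigmaInv_sigma, smul_comm c, smul_comm c]
    intro a b h
    have h2 := congrArg (wedgeMap N.V) h
    rw [key, key] at h2
    exact p_smul_injective (p := p) (k := k) (p_smul_injective (p := p) (k := k) h2)

/-- `Hom_𝔼(M, N)`, as a subgroup of `Hom_W(M, N)`. -/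
def homE (M : DieudonneModule.{u, v} p k) (N : DieudonneModule.{u, w} p k) :
    AddSubgroup (M.carrier →ₗ[WittVector p k] N.carrier) where
  carrier := {f | (∀ x, f (M.F x) = N.F (f x)) ∧ ∀ x, f (M.V x) = N.V (f x)}
  zero_mem' := by simp
  add_mem' := by
    rintro f g ⟨hf, hf'⟩ ⟨hg, hg'⟩
    exact ⟨fun x => by simp [hf, hg], fun x => by simp [hf', hg']⟩
  neg_mem' := by
    rintro f ⟨hf, hf'⟩
    exact ⟨fun x => by simp [hf], fun x => by simp [hf']⟩

/-- The morphism of F-crystals `M^∨ ⊗ N → M'^∨ ⊗ N'` induced by `α : M' → M` and `β : N → N'`. -/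
def tensorHom {M : DieudonneModule.{u, v} p k} {M' : DieudonneModule.{u, v'} p k}
    {N : DieudonneModule.{u, w} p k} {N' : DieudonneModule.{u, w'} p k}
    (α : homE M' M) (β : homE N N') :
    FCrystal.Hom (M.dual.tensor N) (M'.dual.tensor N') where
  toLinearMap := TensorProduct.map (LinearMap.dualMap α.1) β.1
  map_F z := by
    change TensorProduct.map (LinearMap.dualMap α.1) β.1 (TensorProduct.map M.dual.F N.F z) =
      TensorProduct.map M'.dual.F N'.F (TensorProduct.map (LinearMap.dualMap α.1) β.1 z)
    induction z using TensorProduct.induction_on with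
    | zero => simp
    | tmul f y =>
      rw [TensorProduct.map_tmul, TensorProduct.map_tmul, TensorProduct.map_tmul,
        TensorProduct.map_tmul, β.2.1]
      congr 1
      refine LinearMap.ext fun x => ?_
      change sigma p k (f (M.V (α.1 x))) = sigma p k (f (α.1 (M'.V x)))
      rw [α.2.2]
    | add a b ha hb => simp only [map_add, ha, hb]

/-- The morphism of F-crystals `⋀² N → ⋀² N'` induced by `φ : N → N'`. -/
def wedgeHom {N : DieudonneModule.{u, v} p k} {N' : DieudonneModule.{u, w} p k}
    (φ : homE N N') : FCrystal.Hom N.wedge N'.wedge where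
  toLinearMap := exteriorPower.map 2 φ.1
  map_F z := by
    change exteriorPower.map 2 φ.1 (wedgeMap N.F z) = wedgeMap N'.F (exteriorPower.map 2 φ.1 z)
    have hz : z ∈ Submodule.span (WittVector p k)
        (Set.range (exteriorPower.ιMulti (WittVector p k) 2 (M := N.carrier))) := by
      rw [exteriorPower.ιMulti_span]; trivial
    induction hz using Submodule.span_induction with
    | mem x hx =>
      obtain ⟨v, rfl⟩ := hx
      rw [wedgeMap_apply_ιMulti, exteriorPower.map_apply_ιMulti, exteriorPower.map_apply_ιMulti,
        wedgeMap_apply_ιMulti]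
      congr 1
      funext i
      exact φ.2.1 (v i)
    | zero => simp
    | add a b _ _ ha hb => simp only [map_add, ha, hb]
    | smul c a _ ha => rw [map_smulₛₗ, map_smul, ha, map_smul, map_smulₛₗ]

/-- The transpose `φ^∨ : N'^∨ → N^∨` of `φ : N → N'`. -/
def dualHom {N : DieudonneModule.{u, v} p k} {N' : DieudonneModule.{u, w} p k}
    (φ : homE N N') : homE N'.dual N.dual :=
  ⟨LinearMap.dualMap φ.1, by
    constructor
    · intro f
      refine LinearMap.ext fun x => ?_
      change sigma p k (f (N'.V (φ.1 x))) = sigma p k (f (φ.1 (N.V x)))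
      rw [φ.2.2]
    · intro f
      refine LinearMap.ext fun x => ?_
      change sigmaInv p k (f (N'.F (φ.1 x))) = sigmaInv p k (f (φ.1 (N.F x)))
      rw [φ.2.1]⟩

end DieudonneModule

/-! ### Reduction modulo `p ^ n` -/

/-- `X / p ^ n`. -/
abbrev Mod (p : ℕ) [Fact p.Prime] (k : Type u) [Field k] [CharP k p] (n : ℕ)
    (X : Type v) [AddCommGroup X] [Module (WittVector p k) X] : Type v :=
  X ⧸ LinearMap.range (LinearMap.lsmul (WittVector p k) X ((p : WittVector p k) ^ n))

/-- The map `X / p ^ n → Y / p ^ n` induced by a semilinear map `X → Y`. -/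
def modMap {τ : WittVector p k →+* WittVector p k} {X : Type v} {Y : Type w}
    [AddCommGroup X] [Module (WittVector p k) X] [AddCommGroup Y] [Module (WittVector p k) Y]
    (n : ℕ) (f : X →ₛₗ[τ] Y) : Mod p k n X →ₛₗ[τ] Mod p k n Y :=
  Submodule.mapQ _ _ f (by
    rintro _ ⟨y, rfl⟩
    refine ⟨f y, ?_⟩
    rw [LinearMap.lsmul_apply, LinearMap.lsmul_apply, map_smulₛₗ, map_pow, map_natCast])

/-- Reduction modulo `p ^ n` as a homomorphism `Hom_W(X, Y) → Hom_W(X / p ^ n, Y / p ^ n)`. -/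
def redHom {X : Type v} {Y : Type w}
    [AddCommGroup X] [Module (WittVector p k) X] [AddCommGroup Y] [Module (WittVector p k) Y]
    (n : ℕ) : (X →ₗ[WittVector p k] Y) →+ (Mod p k n X →ₗ[WittVector p k] Mod p k n Y) where
  toFun f := modMap n f
  map_zero' := by
    refine LinearMap.ext fun x => ?_
    obtain ⟨x, rfl⟩ := Submodule.Quotient.mk_surjective _ x
    rfl
  map_add' f g := by
    refine LinearMap.ext fun x => ?_
    obtain ⟨x, rfl⟩ := Submodule.Quotient.mk_surjective _ x
    rfl

namespace DieudonneModule

/-- `Hom_W(M / p ^ n, N / p ^ n)` with the quasi-algebraic structure coming from the pro-algebraic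
group `Hom_W(M, N)`: a function is regular when its pull-back along reduction is. -/
abbrev homMod (M : DieudonneModule.{u, v} p k) (N : DieudonneModule.{u, w} p k) (n : ℕ) :
    RegGroup.{u, max v w} k where
  carrier := Mod p k n M.carrier →ₗ[WittVector p k] Mod p k n N.carrier
  regular := (ofModule p k (M.carrier →ₗ[WittVector p k] N.carrier)).regular.comap
    (pullback k (redHom n))

/-- `Hom_𝔼(M / p ^ n, N / p ^ n)`. -/
def homEMod (M : DieudonneModule.{u, v} p k) (N : DieudonneModule.{u, w} p k) (n : ℕ) :
    AddSubgroup (Mod p k n M.carrier →ₗ[WittVector p k] Mod p k n N.carrier) where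
  carrier := {f | (∀ x, f (modMap n M.F x) = modMap n N.F (f x)) ∧
    ∀ x, f (modMap n M.V x) = modMap n N.V (f x)}
  zero_mem' := by simp
  add_mem' := by
    rintro f g ⟨hf, hf'⟩ ⟨hg, hg'⟩
    exact ⟨fun x => by simp [hf, hg], fun x => by simp [hf', hg']⟩
  neg_mem' := by
    rintro f ⟨hf, hf'⟩
    exact ⟨fun x => by simp [hf], fun x => by simp [hf']⟩

/-- The image of `Hom_𝔼(M, N)`, i.e. of `Hom_𝔼(M, N) / p ^ n`, in `Hom_W(M / p ^ n, N / p ^ n)`. -/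
def homERed (M : DieudonneModule.{u, v} p k) (N : DieudonneModule.{u, w} p k) (n : ℕ) :
    AddSubgroup (Mod p k n M.carrier →ₗ[WittVector p k] Mod p k n N.carrier) :=
  (homE M N).map (redHom n)

/-- Anti-self-dual `W`-linear maps `f : N^∨ → N`: those with `f^∨ = -f` as maps `N^∨ → N^∨∨ = N`,
i.e. `b (f a) = - a (f b)` for all `a`, `b` in `N^∨`. -/
def skew (N : DieudonneModule.{u, v} p k) :
    AddSubgroup (N.dual.carrier →ₗ[WittVector p k] N.carrier) where
  carrier := {f | ∀ a b : Module.Dual (WittVector p k) N.carrier, b (f a) = - a (f b)}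
  zero_mem' := by intro a b; simp
  add_mem' := by
    intro f g hf hg a b
    rw [LinearMap.add_apply, LinearMap.add_apply, map_add, map_add, hf a b, hg a b, neg_add]
  neg_mem' := by
    intro f hf a b
    rw [LinearMap.neg_apply, LinearMap.neg_apply, map_neg, map_neg, hf a b]

/-- Anti-self-dual maps `f : N^∨ / p ^ n → N / p ^ n`. Here `N^∨ / p ^ n` is the `W / p ^ n`-dual
of `N / p ^ n` and vice versa, through the reductions `N / p ^ n → W / p ^ n` of the elements of
`N^∨`. -/
def skewMod (N : DieudonneModule.{u, v} p k) (n : ℕ) :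
    AddSubgroup (Mod p k n N.dual.carrier →ₗ[WittVector p k] Mod p k n N.carrier) where
  carrier := {f | ∀ a b : Module.Dual (WittVector p k) N.carrier,
    modMap n b (f (Submodule.Quotient.mk a)) = - modMap n a (f (Submodule.Quotient.mk b))}
  zero_mem' := by intro a b; simp
  add_mem' := by
    intro f g hf hg a b
    rw [LinearMap.add_apply, LinearMap.add_apply, map_add, map_add, hf a b, hg a b, neg_add]
  neg_mem' := by
    intro f hf a b
    rw [LinearMap.neg_apply, LinearMap.neg_apply, map_neg, map_neg, hf a b]

/-- The image of `Hom_𝔼(N^∨, N)^skew`, i.e. of `Hom_𝔼(N^∨, N)^skew / p ^ n`, in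
`Hom_W(N^∨ / p ^ n, N / p ^ n)`. -/
def skewERed (N : DieudonneModule.{u, v} p k) (n : ℕ) :
    AddSubgroup (Mod p k n N.dual.carrier →ₗ[WittVector p k] Mod p k n N.carrier) :=
  (homE N.dual N ⊓ N.skew).map (redHom n)

theorem homERed_le (M : DieudonneModule.{u, v} p k) (N : DieudonneModule.{u, w} p k) (n : ℕ) :
    homERed M N n ≤ homEMod M N n := by
  rintro _ ⟨f, ⟨hF, hV⟩, rfl⟩
  constructor
  · intro x
    obtain ⟨x, rfl⟩ := Submodule.Quotient.mk_surjective _ x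
    exact congrArg Submodule.Quotient.mk (hF x)
  · intro x
    obtain ⟨x, rfl⟩ := Submodule.Quotient.mk_surjective _ x
    exact congrArg Submodule.Quotient.mk (hV x)

theorem skewERed_le (N : DieudonneModule.{u, v} p k) (n : ℕ) :
    skewERed N n ≤ homEMod N.dual N n ⊓ N.skewMod n := by
  rintro _ ⟨f, ⟨hf, hs⟩, rfl⟩
  exact ⟨homERed_le _ _ n ⟨f, hf, rfl⟩, fun a b => congrArg Submodule.Quotient.mk (hs a b)⟩

/-- The quasi-algebraic group `Hom_𝔼(M / p ^ n, N / p ^ n) / (Hom_𝔼(M, N) / p ^ n)`. -/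
def homQuot (M : DieudonneModule.{u, v} p k) (N : DieudonneModule.{u, w} p k) (n : ℕ) :
    RegGroup.{u, max v w} k :=
  (homMod M N n).subquot (homEMod M N n) (homERed M N n)

/-- The quasi-algebraic group
`Hom_𝔼(N^∨ / p ^ n, N / p ^ n)^skew / (Hom_𝔼(N^∨, N)^skew / p ^ n)`. -/
def skewQuot (N : DieudonneModule.{u, v} p k) (n : ℕ) : RegGroup.{u, max u v} k :=
  (homMod N.dual N n).subquot (homEMod N.dual N n ⊓ N.skewMod n) (skewERed N n)

/-- The homomorphism `f ↦ β ∘ f ∘ α` from `Hom_W(M / p ^ n, N / p ^ n)` to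
`Hom_W(M' / p ^ n, N' / p ^ n)` given by `α : M' → M` and `β : N → N'`. -/
def conj {M : DieudonneModule.{u, v} p k} {M' : DieudonneModule.{u, v'} p k}
    {N : DieudonneModule.{u, w} p k} {N' : DieudonneModule.{u, w'} p k}
    (n : ℕ) (α : homE M' M) (β : homE N N') :
    (homMod M N n).carrier →+ (homMod M' N' n).carrier where
  toFun f := (modMap n β.1).comp (LinearMap.comp f (modMap n α.1))
  map_zero' := by
    refine LinearMap.ext fun x => ?_
    exact map_zero (modMap n β.1)
  map_add' f g := by
    refine LinearMap.ext fun x => ?_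
    exact map_add (modMap n β.1) _ _

theorem conj_mem_homEMod {M : DieudonneModule.{u, v} p k} {M' : DieudonneModule.{u, v'} p k}
    {N : DieudonneModule.{u, w} p k} {N' : DieudonneModule.{u, w'} p k}
    (n : ℕ) (α : homE M' M) (β : homE N N') (f : (homMod M N n).carrier)
    (hf : f ∈ homEMod M N n) : conj n α β f ∈ homEMod M' N' n := by
  have hα := homERed_le M' M n ⟨α.1, α.2, rfl⟩
  have hβ := homERed_le N N' n ⟨β.1, β.2, rfl⟩
  refine ⟨fun x => ?_, fun x => ?_⟩
  · exact (congrArg (fun t => modMap n β.1 (f t)) (hα.1 x)).trans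
      ((congrArg (modMap n β.1) (hf.1 _)).trans (hβ.1 _))
  · exact (congrArg (fun t => modMap n β.1 (f t)) (hα.2 x)).trans
      ((congrArg (modMap n β.1) (hf.2 _)).trans (hβ.2 _))

theorem conj_redHom {M : DieudonneModule.{u, v} p k} {M' : DieudonneModule.{u, v'} p k}
    {N : DieudonneModule.{u, w} p k} {N' : DieudonneModule.{u, w'} p k}
    (n : ℕ) (α : homE M' M) (β : homE N N')
    (f : M.carrier →ₗ[WittVector p k] N.carrier) :
    conj n α β (redHom n f) = redHom n (β.1.comp (f.comp α.1)) := by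
  refine LinearMap.ext fun x => ?_
  obtain ⟨x, rfl⟩ := Submodule.Quotient.mk_surjective _ x
  rfl

theorem comp_mem_homE {M : DieudonneModule.{u, v} p k} {M' : DieudonneModule.{u, v'} p k}
    {N : DieudonneModule.{u, w} p k} {N' : DieudonneModule.{u, w'} p k}
    (α : homE M' M) (β : homE N N')
    {f : M.carrier →ₗ[WittVector p k] N.carrier} (hf : f ∈ homE M N) :
    β.1.comp (f.comp α.1) ∈ homE M' N' := by
  refine ⟨fun x => ?_, fun x => ?_⟩
  · simp only [LinearMap.comp_apply, α.2.1, hf.1, β.2.1]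
  · simp only [LinearMap.comp_apply, α.2.2, hf.2, β.2.2]

/-- The homomorphism between the groups `homQuot` induced by `f ↦ β ∘ f ∘ α`. -/
def homQuotMap {M : DieudonneModule.{u, v} p k} {M' : DieudonneModule.{u, v'} p k}
    {N : DieudonneModule.{u, w} p k} {N' : DieudonneModule.{u, w'} p k}
    (n : ℕ) (α : homE M' M) (β : homE N N') :
    (homQuot M N n).carrier →+ (homQuot M' N' n).carrier :=
  RegGroup.subquotMap (conj n α β) (conj_mem_homEMod n α β) (by
    rintro _ ⟨f, hf, rfl⟩
    exact ⟨_, comp_mem_homE α β hf, (conj_redHom n α β f).symm⟩)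

/-- The homomorphism between the groups `skewQuot` induced by `f ↦ φ ∘ f ∘ φ^∨`. -/
def skewQuotMap {N : DieudonneModule.{u, v} p k} {N' : DieudonneModule.{u, w} p k}
    (n : ℕ) (φ : homE N N') : (skewQuot N n).carrier →+ (skewQuot N' n).carrier :=
  RegGroup.subquotMap (conj n (dualHom φ) φ)
    (fun f hf => ⟨conj_mem_homEMod n (dualHom φ) φ f hf.1, fun a b => by
      have hc : ∀ (c : Module.Dual (WittVector p k) N'.carrier) (y : Mod p k n N.carrier),
          modMap n c (modMap n φ.1 y) = modMap n (LinearMap.dualMap φ.1 c) y := by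
        intro c y
        obtain ⟨y, rfl⟩ := Submodule.Quotient.mk_surjective _ y
        rfl
      exact (hc b _).trans ((hf.2 (LinearMap.dualMap φ.1 a) (LinearMap.dualMap φ.1 b)).trans
        (congrArg Neg.neg (hc a _).symm))⟩)
    (by
      rintro _ ⟨f, ⟨hf, hs⟩, rfl⟩
      exact ⟨_, ⟨comp_mem_homE (dualHom φ) φ hf,
        fun a b => hs (LinearMap.dualMap φ.1 a) (LinearMap.dualMap φ.1 b)⟩,
        (conj_redHom n (dualHom φ) φ f).symm⟩)

end DieudonneModule

end QuasiAlg

end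

noncomputable section
namespace QuasiAlg

/-! ### Points of finitely generated algebras -/

section Points

variable {k : Type*} [Field k] [IsAlgClosed k]

/-! The isomorphism comes from a snake argument. If `z` in an F-crystal `L` has a class in `U_L`
killed by `p ^ n`, then `p ^ n z = (F/p - 1) x` for some `x`, that is, `(F - p) x = p ^ (n+1) z`.
The pairs `(x, z)` satisfying this relation map onto `U_L[p^n]` by the class of `z`, and into `L /
p^n` by the class of `x`. The two maps have the same kernel modulo the image of the solutions of `F
x = p x`: if `z = (F/p - 1) y`, then `x - p^n y` is such a solution, and conversely. Hence
`U_L[p^n]` is `{x mod p^n : (F - p) x ∈ p^(n+1) L}` modulo the reductions of `ker (F - p)`; this is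
`FCrystal.exists_snake_iso`.

For `L = M^∨ ⊗ N = Hom_W(M, N)` the Frobenius is `f ↦ F f V`. Since `FV = VF = p` and the modules
are torsion free, `F f V = p f` means exactly that `f` commutes with `F` and `V`. Modulo `p^n` the
analogue needs a correction of the lift of `f` (`exists_subP_of_redHom_mem_homEMod`). If `p ≠ 2`,
then `⋀² N` is an F-stable direct summand of `Hom_W(N^∨, N)`, namely its skew part, and statement
(2) is cut out of the same computation by the projector with factor `1/2`.

The harder half is that the abstract isomorphism identifies regular functions. A function on `U_L`
restricts to one of `x mod p^n` because a lift of `x` for which `z` exists can be chosen by regular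
operations (`exists_regular_of_isSubPInvariant`); this rests on a section of `F` modulo `p`. In the
other direction a power `p^d` kills the cokernel of `F - p`, so after multiplication by `p^d` every
`z` acquires an `x`. The given function is first extended to level `n + d`, invariantly under the
finitely many solutions of `F x = p x` (`exists_invariant_extension`, by interpolation and a norm),
and is then descended along the surjection `F - p` (`regular_of_comp_subP`). That descent is
algebraic geometry: a function on an irreducible group whose pull-back along a surjective
homomorphism is regular becomes regular after raising it to some power `p^q`
(`exists_pow_mem_of_comp_mem`). As all algebras here are closed under `p`-th roots, this suffices.

Both the bound on the cokernel and the finiteness of the solutions modulo `p^n` reduce, through a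
linear dependence among iterates, to operators `∑ a_i σ^(-i)` on `W`, which modulo `p` are additive
polynomials over `k`. Finiteness also makes the right-hand side quasi-algebraic, as a quotient of a
closed subgroup of `L / p^n` by a finite group. The left-hand side inherits this through the
isomorphism. -/

theorem nonempty_algHom_of_finiteType (R : Type*) [CommRing R] [Nontrivial R] [Algebra k R]
    [Algebra.FiniteType k R] : Nonempty (R →ₐ[k] k) := by
  obtain ⟨m, hm⟩ := Ideal.exists_maximal R
  let := Ideal.Quotient.field m
  have : Module.Finite k (R ⧸ m) := finite_of_finite_type_of_isJacobsonRing k (R ⧸ m)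
  exact ⟨(IsAlgClosed.lift : (R ⧸ m) →ₐ[k] k).comp (Ideal.Quotient.mkₐ k m)⟩

/-- Rabinowitsch's argument: if `a` is not nilpotent, the localization at `a` is a nonzero finitely
generated algebra, so it has a `k`-point, and `a` is a unit there. -/
theorem isNilpotent_of_forall_algHom {R : Type*} [CommRing R] [Algebra k R]
    [Algebra.FiniteType k R] (a : R) (h : ∀ χ : R →ₐ[k] k, χ a = 0) : IsNilpotent a := by
  by_contra hn
  have : Nontrivial (Localization.Away a) := by
    rw [← not_subsingleton_iff_nontrivial]
    intro hs
    have h1 : (algebraMap R (Localization.Away a)) 1 = algebraMap R _ 0 := Subsingleton.elim _ _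
    obtain ⟨c, hc⟩ := (IsLocalization.eq_iff_exists (Submonoid.powers a) _).1 h1
    obtain ⟨m, hm⟩ := c.2
    exact hn ⟨m, by simpa [← hm] using hc⟩
  have : Algebra.FiniteType R (Localization.Away a) :=
    IsLocalization.finiteType_of_monoid_fg (Submonoid.powers a) _
  have : Algebra.FiniteType k (Localization.Away a) := Algebra.FiniteType.trans ‹_› this
  obtain ⟨χ⟩ := nonempty_algHom_of_finiteType (k := k) (Localization.Away a)
  have h0 := h (χ.comp (IsScalarTower.toAlgHom k R _))
  have hu : IsUnit (χ (algebraMap R (Localization.Away a) a)) :=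
    (IsLocalization.Away.algebraMap_isUnit a).map χ
  exact hu.ne_zero h0

theorem exists_algHom_of_ne_top {R : Type*} [CommRing R] [Algebra k R]
    [Algebra.FiniteType k R] (J : Ideal R) (hJ : J ≠ ⊤) : ∃ χ : R →ₐ[k] k, ∀ a ∈ J, χ a = 0 := by
  have : Nontrivial (R ⧸ J) := Ideal.Quotient.nontrivial_iff.2 hJ
  obtain ⟨χ⟩ := nonempty_algHom_of_finiteType (k := k) (R ⧸ J)
  refine ⟨χ.comp (Ideal.Quotient.mkₐ k J), fun a ha => ?_⟩
  have : Ideal.Quotient.mkₐ k J a = 0 := Ideal.Quotient.eq_zero_iff_mem.2 ha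
  rw [AlgHom.comp_apply, this, map_zero]

end Points

/-- An element `a` of an algebra over a domain with `a ⊗ 1 = 1 ⊗ a` is a fraction. -/
theorem exists_smul_eq_algebraMap_of_tmul_comm {A S : Type*} [CommRing A] [IsDomain A] [CommRing S]
    [Algebra A S] (hinj : Function.Injective (algebraMap A S)) (a : S)
    (h : a ⊗ₜ[A] (1 : S) = (1 : S) ⊗ₜ[A] a) :
    ∃ s : A, s ≠ 0 ∧ ∃ b : A, s • a = algebraMap A S b := by
  classical
  let K := FractionRing A
  let M := LocalizedModule (nonZeroDivisors A) S
  let mk : S →ₗ[A] M := LocalizedModule.mkLinearMap (nonZeroDivisors A) S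
  have hmk : ∀ x, mk x = 0 → ∃ c : A, c ≠ 0 ∧ c • x = 0 := by
    intro x hx
    obtain ⟨c, hc⟩ := (IsLocalizedModule.eq_zero_iff (nonZeroDivisors A) mk).1 hx
    exact ⟨c, nonZeroDivisors.coe_ne_zero c, hc⟩
  have h1 : mk 1 ≠ 0 := by
    intro h0
    obtain ⟨c, hc, hc'⟩ := hmk _ h0
    rw [Algebra.smul_def, mul_one] at hc'
    exact hc (hinj (by rw [hc', map_zero]))
  -- Over the fraction field a linear form with `lam 1 ≠ 0` exists. Applying `lam ⊗ id` to `a ⊗ 1 =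
  -- 1 ⊗ a` gives `lam a • 1 = lam 1 • a`, so that `a = lam a / lam 1`.
  obtain ⟨lam, hlam⟩ : ∃ lam : Module.Dual K M, lam (mk 1) ≠ 0 := by
    by_contra hcon
    push Not at hcon
    exact h1 ((Module.forall_dual_apply_eq_zero_iff K _).1 hcon)
  let B : S →ₗ[A] S →ₗ[A] M := LinearMap.mk₂ A (fun s t => lam (mk s) • mk t)
    (fun s s' t => by rw [map_add, map_add, add_smul])
    (fun c s t => by
      rw [map_smul, ← algebraMap_smul K c (mk s), map_smul, smul_assoc, algebraMap_smul])
    (fun s t t' => by rw [map_add, smul_add])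
    (fun c s t => by rw [map_smul, smul_comm])
  have hB := congrArg (TensorProduct.lift B) h
  rw [TensorProduct.lift.tmul, TensorProduct.lift.tmul] at hB
  change lam (mk a) • mk 1 = lam (mk 1) • mk a at hB
  obtain ⟨d, hd⟩ := IsLocalization.exist_integer_multiples_of_finset (nonZeroDivisors A)
    ({lam (mk a), lam (mk 1)} : Finset K)
  obtain ⟨a', ha'⟩ := hd (lam (mk a)) (by simp)
  obtain ⟨b', hb'⟩ := hd (lam (mk 1)) (by simp)
  have h2 : mk (b' • a - a' • 1) = 0 := by
    rw [map_sub, map_smul, map_smul, ← algebraMap_smul K b', ← algebraMap_smul K a', ha', hb',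
      smul_assoc, smul_assoc, hB, sub_self]
  obtain ⟨c, hc, hc'⟩ := hmk _ h2
  refine ⟨c * b', mul_ne_zero hc ?_, c * a', ?_⟩
  · rintro rfl
    rw [map_zero] at hb'
    have hd0 : algebraMap A K (d : A) ≠ 0 := by
      intro h0
      exact nonZeroDivisors.coe_ne_zero d
        (IsFractionRing.injective A K (by rw [h0, map_zero]))
    have hb'' : (d : A) • lam (mk 1) = 0 := hb'.symm
    rw [← algebraMap_smul K, smul_eq_mul] at hb''
    rcases mul_eq_zero.1 hb'' with h0 | h0
    · exact hd0 h0
    · exact hlam h0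
  · rw [smul_sub, sub_eq_zero] at hc'
    rw [mul_smul, hc', ← mul_smul, Algebra.smul_def, mul_one]

/-- A `k`-point of `S ⊗[A] S` is a pair of points of `S` in one fibre over `A`, so `g ⊗ 1 - 1 ⊗ g`
vanishes at all of them and is nilpotent. Raising to a power `p ^ q` turns nilpotence into an
equality. The exponent allows for purely inseparable extensions. -/
theorem exists_smul_pow_eq_algebraMap {k : Type*} [Field k] [IsAlgClosed k] (p : ℕ)
    [Fact p.Prime] [CharP k p] {A S : Type*} [CommRing A] [IsDomain A] [CommRing S] [Algebra k A]
    [Algebra k S] [Algebra A S] [IsScalarTower k A S] [Algebra.FiniteType k S]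
    (hinj : Function.Injective (algebraMap A S)) (g : S)
    (hg : ∀ χ χ' : S →ₐ[k] k, (∀ a : A, χ (algebraMap A S a) = χ' (algebraMap A S a)) →
      χ g = χ' g) :
    ∃ (q : ℕ) (s : A), s ≠ 0 ∧ ∃ b : A, s • g ^ p ^ q = algebraMap A S b := by
  have : Algebra.FiniteType A S := Algebra.FiniteType.of_restrictScalars_finiteType k A S
  have : Algebra.FiniteType k (S ⊗[A] S) := Algebra.FiniteType.trans (S := S) ‹_› inferInstance
  have hnil : IsNilpotent (g ⊗ₜ[A] (1 : S) - (1 : S) ⊗ₜ[A] g) := by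
    refine isNilpotent_of_forall_algHom (k := k) _ (fun χ => ?_)
    let χ₁ : S →ₐ[k] k := χ.comp (Algebra.TensorProduct.includeLeft : S →ₐ[k] S ⊗[A] S)
    let χ₂ : S →ₐ[k] k := χ.comp
      ((Algebra.TensorProduct.includeRight : S →ₐ[A] S ⊗[A] S).restrictScalars k)
    have h := hg χ₁ χ₂ (fun a => by
      change χ (algebraMap A S a ⊗ₜ[A] (1 : S)) = χ ((1 : S) ⊗ₜ[A] algebraMap A S a)
      rw [Algebra.algebraMap_eq_smul_one, TensorProduct.smul_tmul])
    rw [map_sub, sub_eq_zero]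
    exact h
  have hpow : ∃ q : ℕ, (g ^ p ^ q) ⊗ₜ[A] (1 : S) = (1 : S) ⊗ₜ[A] (g ^ p ^ q) := by
    rcases subsingleton_or_nontrivial (S ⊗[A] S) with _ | _
    · exact ⟨0, Subsingleton.elim _ _⟩
    have : CharP (S ⊗[A] S) p :=
      charP_of_injective_algebraMap (algebraMap k (S ⊗[A] S)).injective p
    obtain ⟨q, hq⟩ := hnil
    refine ⟨q, ?_⟩
    have hq' : (g ⊗ₜ[A] (1 : S) - (1 : S) ⊗ₜ[A] g) ^ p ^ q = 0 :=
      pow_eq_zero_of_le (Nat.lt_pow_self (Fact.out : p.Prime).one_lt).le hq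
    rwa [sub_pow_char_pow, Algebra.TensorProduct.tmul_pow, Algebra.TensorProduct.tmul_pow,
      one_pow, sub_eq_zero] at hq'
  obtain ⟨q, hq⟩ := hpow
  exact ⟨q, exists_smul_eq_algebraMap_of_tmul_comm hinj _ hq⟩

/-! ### Descent of regular functions along surjective homomorphisms -/

section Descent

variable {k : Type u} [Field k]

/-- Every `k`-point of an algebra of functions is given by evaluation at a point. -/
def HasPoints {X : Type v} (S : Subalgebra k (X → k)) : Prop :=
  ∀ χ : S →ₐ[k] k, ∃ x : X, ∀ s : S, χ s = s.1 x

/-- A `p`-power of a function descending along a surjection is a rational function. The last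
hypothesis is there because `A` need not separate the points of `Y`. -/
theorem exists_mul_pow_mem_of_comp_mem [IsAlgClosed k] (p : ℕ) [Fact p.Prime] [CharP k p]
    {X : Type v} {Y : Type w} (S : Subalgebra k (X → k))
    (A : Subalgebra k (Y → k)) (hS : S.FG) (pS : HasPoints S) [IsDomain A]
    (f : X → Y) (hf : Function.Surjective f) (hA : ∀ a ∈ A, (fun x => a (f x)) ∈ S)
    (φ : Y → k) (hφ : (fun x => φ (f x)) ∈ S)
    (hφA : ∀ y y', (∀ a ∈ A, a y = a y') → φ y = φ y') :
    ∃ s ∈ A, s ≠ 0 ∧ ∃ q : ℕ, s * φ ^ p ^ q ∈ A := by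
  let F : A →ₐ[k] S := ((pullback k f).comp A.val).codRestrict S (fun a => hA a.1 a.2)
  have hFapp : ∀ (a : A) x, (F a).1 x = a.1 (f x) := fun _ _ => rfl
  let _ : Algebra A S := F.toRingHom.toAlgebra
  have : IsScalarTower k A S := IsScalarTower.of_algebraMap_eq (fun c => (F.commutes c).symm)
  have hinj : Function.Injective (algebraMap A S) := by
    intro a b hab
    apply Subtype.ext
    funext y
    obtain ⟨x, rfl⟩ := hf y
    exact congrFun (congrArg Subtype.val hab) x
  have : Algebra.FiniteType k S := (Subalgebra.fg_iff_finiteType S).1 hS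
  obtain ⟨q, s, hs, b, hb⟩ := exists_smul_pow_eq_algebraMap (k := k) p hinj
    (⟨fun x => φ (f x), hφ⟩ : S) (fun χ χ' h => by
      obtain ⟨x, hx⟩ := pS χ
      obtain ⟨x', hx'⟩ := pS χ'
      rw [hx, hx']
      refine hφA _ _ fun a ha => ?_
      have h1 := h ⟨a, ha⟩
      rw [hx, hx'] at h1
      exact h1)
  refine ⟨s.1, s.2, fun h0 => hs (Subtype.ext h0), q, ?_⟩
  have : s.1 * φ ^ p ^ q = b.1 := by
    funext y
    obtain ⟨x, rfl⟩ := hf y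
    rw [Algebra.smul_def] at hb
    exact congrFun (congrArg Subtype.val hb) x
  rw [this]
  exact b.2

/-- The group structure upgrades "rational" to "regular". The translates of `φ` span a
finite-dimensional space, so one denominator and one exponent serve all of them; translating back,
the denominator can be made nonzero at any given point. -/
theorem exists_pow_mem_of_comp_mem [IsAlgClosed k] (p : ℕ) [Fact p.Prime] [CharP k p]
    {X : Type v} {Y : Type w} [AddCommGroup X] [AddCommGroup Y] (S : Subalgebra k (X → k))
    (A : Subalgebra k (Y → k)) (hS : S.FG) (pS : HasPoints S) [IsDomain A]
    (hAfg : A.FG) (pA : HasPoints A)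
    (tA : ∀ a ∈ A, ∀ h : Y, (fun y => a (y + h)) ∈ A)
    (tS : ∀ s ∈ S, ∃ E : Submodule k (X → k), FiniteDimensional k E ∧ E ≤ S.toSubmodule ∧
      ∀ h : X, (fun x => s (x + h)) ∈ E)
    (f : X →+ Y) (hf : Function.Surjective f) (hA : ∀ a ∈ A, (fun x => a (f x)) ∈ S)
    (φ : Y → k) (hφ : (fun x => φ (f x)) ∈ S)
    (hφA : ∀ y y', (∀ a ∈ A, a y = a y') → φ y = φ y') :
    ∃ q : ℕ, φ ^ p ^ q ∈ A := by
  obtain ⟨E, hEfin, hES, hE⟩ := tS _ hφ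
  -- the span of the translates of `φ`
  let tr : Y → (Y → k) := fun h y => φ (y + h)
  let V : Submodule k (Y → k) := Submodule.span k (Set.range tr)
  let Pf : (Y → k) →ₗ[k] (X → k) := (pullback k f).toLinearMap
  have hPinj : Function.Injective Pf := by
    intro a b hab
    funext y
    obtain ⟨x, rfl⟩ := hf y
    exact congrFun hab x
  have hVE : V.map Pf ≤ E := by
    rw [Submodule.map_le_iff_le_comap, Submodule.span_le]
    rintro _ ⟨h, rfl⟩
    obtain ⟨h, rfl⟩ := hf h
    have := hE h
    simp only [map_add] at this
    exact this
  have hVfin : FiniteDimensional k V := by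
    have h1 : FiniteDimensional k (V.map Pf) := Submodule.finiteDimensional_of_le hVE
    exact Module.Finite.equiv (Submodule.equivMapOfInjective Pf hPinj V).symm
  have hVsep : ∀ ψ ∈ V, ∀ y y', (∀ a ∈ A, a y = a y') → ψ y = ψ y' := by
    intro ψ hψ y y' hy
    induction hψ using Submodule.span_induction with
    | mem ψ hψ =>
      obtain ⟨h, rfl⟩ := hψ
      exact hφA _ _ fun a ha => hy _ (tA a ha h)
    | zero => rfl
    | add a b _ _ ha hb => simp only [Pi.add_apply, ha, hb]
    | smul c a _ ha => simp only [Pi.smul_apply, ha]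
  have key : ∀ V' : Submodule k (Y → k), V'.FG → V' ≤ V →
      ∃ s ∈ A, s ≠ 0 ∧ ∃ q : ℕ, ∀ ψ ∈ V', s * ψ ^ p ^ q ∈ A := by
    intro V' hV'
    induction V', hV' using Submodule.fg_induction with
    | singleton ψ =>
      intro hle
      have hψV : ψ ∈ V := hle (Submodule.mem_span_singleton_self ψ)
      obtain ⟨s, hsA, hs0, q, hq⟩ := exists_mul_pow_mem_of_comp_mem p S A hS pS f hf hA ψ
        (hES (hVE (Submodule.mem_map_of_mem hψV))) (hVsep ψ hψV)
      refine ⟨s, hsA, hs0, q, fun ψ' hψ' => ?_⟩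
      obtain ⟨c, rfl⟩ := Submodule.mem_span_singleton.1 hψ'
      rw [smul_pow, mul_smul_comm]
      exact A.smul_mem hq _
    | sup V1 V2 _ _ h1 h2 =>
      intro hle
      obtain ⟨s1, hs1, h10, q1, hq1⟩ := h1 (le_sup_left.trans hle)
      obtain ⟨s2, hs2, h20, q2, hq2⟩ := h2 (le_sup_right.trans hle)
      refine ⟨s1 ^ p ^ q2 * s2 ^ p ^ q1, A.mul_mem (A.pow_mem hs1 _) (A.pow_mem hs2 _), ?_,
        q1 + q2, ?_⟩
      · intro h0
        have h0' : (⟨s1, hs1⟩ : A) ^ p ^ q2 * (⟨s2, hs2⟩ : A) ^ p ^ q1 = 0 := Subtype.ext h0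
        rcases mul_eq_zero.1 h0' with h | h
        · exact h10 (congrArg Subtype.val (pow_eq_zero_iff (pow_pos (Fact.out : p.Prime).pos _).ne' |>.1 h))
        · exact h20 (congrArg Subtype.val (pow_eq_zero_iff (pow_pos (Fact.out : p.Prime).pos _).ne' |>.1 h))
      · intro ψ hψ
        obtain ⟨ψ1, hψ1, ψ2, hψ2, rfl⟩ := Submodule.mem_sup.1 hψ
        have e1 : (ψ1 + ψ2) ^ p ^ (q1 + q2) = ψ1 ^ p ^ (q1 + q2) + ψ2 ^ p ^ (q1 + q2) := by
          funext y
          simp only [Pi.pow_apply, Pi.add_apply]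
          exact add_pow_char_pow ..
        have e2 : s1 ^ p ^ q2 * s2 ^ p ^ q1 * (ψ1 + ψ2) ^ p ^ (q1 + q2) =
            s2 ^ p ^ q1 * (s1 * ψ1 ^ p ^ q1) ^ p ^ q2 +
            s1 ^ p ^ q2 * (s2 * ψ2 ^ p ^ q2) ^ p ^ q1 := by
          rw [e1, pow_add]
          ring
        rw [e2]
        exact A.add_mem (A.mul_mem (A.pow_mem hs2 _) (A.pow_mem (hq1 _ hψ1) _))
          (A.mul_mem (A.pow_mem hs1 _) (A.pow_mem (hq2 _ hψ2) _))
  obtain ⟨s, hsA, hs0, q, hq⟩ := key V (Module.Finite.iff_fg.1 hVfin) le_rfl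
  refine ⟨q, ?_⟩
  -- The ideal of denominators of `φ ^ p ^ q`. If it is proper, the Nullstellensatz gives it a
  -- common zero `y0`.
  let J : Ideal A :=
    { carrier := {a | a.1 * φ ^ p ^ q ∈ A}
      add_mem' := fun {a b} ha hb => by
        change (a.1 + b.1) * _ ∈ A
        rw [add_mul]; exact A.add_mem ha hb
      zero_mem' := by
        change (0 : Y → k) * _ ∈ A
        rw [zero_mul]; exact A.zero_mem
      smul_mem' := fun c a ha => by
        change c.1 * a.1 * _ ∈ A
        rw [mul_assoc]; exact A.mul_mem c.2 ha }
  have hJ : J = ⊤ := by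
    by_contra hJ
    have : Algebra.FiniteType k A := (Subalgebra.fg_iff_finiteType A).1 hAfg
    obtain ⟨χ, hχ⟩ := exists_algHom_of_ne_top (k := k) J hJ
    obtain ⟨y0, hy0⟩ := pA χ
    obtain ⟨y1, hy1⟩ : ∃ y1, s y1 ≠ 0 := by
      by_contra hcon
      push Not at hcon
      exact hs0 (funext hcon)
    -- Clear the denominator of the translate of `φ` by `-(y1 - y0)`, then translate the product by
    -- `y1 - y0`. The result exhibits a denominator of `φ ^ p ^ q` itself, with value `s y1 ≠ 0` at
    -- `y0`.
    have hmem : (⟨fun y => s (y + (y1 - y0)), tA s hsA _⟩ : A) ∈ J := by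
      change (fun y => s (y + (y1 - y0))) * φ ^ p ^ q ∈ A
      have h1 := tA _ (hq _ (Submodule.subset_span ⟨-(y1 - y0), rfl⟩)) (y1 - y0)
      convert h1 using 1
      funext y
      change _ = s (y + (y1 - y0)) * φ (y + (y1 - y0) + -(y1 - y0)) ^ p ^ q
      rw [add_neg_cancel_right]
      rfl
    have h2 := hχ _ hmem
    rw [hy0] at h2
    apply hy1
    simpa using h2
  have h1 : (1 : A) ∈ J := by rw [hJ]; trivial
  have h2 : (1 : Y → k) * φ ^ p ^ q ∈ A := h1
  rwa [one_mul] at h2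

end Descent

end QuasiAlg
end

noncomputable section
namespace QuasiAlg

variable {p : ℕ} [Fact p.Prime] {k : Type u} [Field k] [CharP k p]

/-! ### Functions with values in Witt vectors -/

section WittReg

variable {X : Type v}

/-- Sums and products of Witt vectors are polynomial in the components. Lifting `h` to a Witt vector
over `S`, up to truncation, lets the functoriality of `WittVector` do this computation and makes
`wittReg` a ring. -/
theorem forall_coeff_mem_iff (S : Subalgebra k (X → k)) (m : ℕ) (h : X → WittVector p k) :
    (∀ j < m, (fun x => (h x).coeff j) ∈ S) ↔ ∃ w : WittVector p S, ∀ x,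
      WittVector.truncate m (h x) =
        WittVector.truncate m (WittVector.map ((Pi.evalRingHom _ x).comp S.val.toRingHom) w) := by
  constructor
  · intro hj
    refine ⟨WittVector.mk p (fun j => if hjm : j < m then ⟨_, hj j hjm⟩ else 0), fun x => ?_⟩
    refine TruncatedWittVector.ext fun i => ?_
    rw [WittVector.coeff_truncate, WittVector.coeff_truncate, WittVector.map_coeff]
    simp
  · rintro ⟨w, hw⟩ j hj
    have : (fun x => (h x).coeff j) = (w.coeff j).1 := by
      funext x
      have := congrArg (fun t => TruncatedWittVector.coeff ⟨j, hj⟩ t) (hw x)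
      simpa [WittVector.coeff_truncate, WittVector.map_coeff] using this
    rw [this]
    exact (w.coeff j).2

/-- The ring of functions with values in Witt vectors whose first `m` components lie in `S`. -/
def wittReg (p : ℕ) [Fact p.Prime] {k : Type u} [Field k] [CharP k p] {X : Type v}
    (S : Subalgebra k (X → k)) (m : ℕ) : Subring (X → WittVector p k) where
  carrier := {h | ∀ j < m, (fun x => (h x).coeff j) ∈ S}
  mul_mem' {a b} ha hb := by
    obtain ⟨w, hw⟩ := (forall_coeff_mem_iff S m a).1 ha
    obtain ⟨w', hw'⟩ := (forall_coeff_mem_iff S m b).1 hb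
    exact (forall_coeff_mem_iff S m _).2 ⟨w * w', fun x => by
      rw [Pi.mul_apply, map_mul, hw, hw', map_mul, map_mul]⟩
  add_mem' {a b} ha hb := by
    obtain ⟨w, hw⟩ := (forall_coeff_mem_iff S m a).1 ha
    obtain ⟨w', hw'⟩ := (forall_coeff_mem_iff S m b).1 hb
    exact (forall_coeff_mem_iff S m _).2 ⟨w + w', fun x => by
      rw [Pi.add_apply, map_add, hw, hw', map_add, map_add]⟩
  one_mem' := (forall_coeff_mem_iff S m (1 : X → WittVector p k)).2 ⟨1, fun x => by simp⟩
  zero_mem' := (forall_coeff_mem_iff S m (0 : X → WittVector p k)).2 ⟨0, fun x => by simp⟩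
  neg_mem' {a} ha := by
    obtain ⟨w, hw⟩ := (forall_coeff_mem_iff S m a).1 ha
    exact (forall_coeff_mem_iff S m _).2 ⟨-w, fun x => by
      rw [Pi.neg_apply, map_neg, hw, map_neg, map_neg]⟩

theorem wittReg_const (S : Subalgebra k (X → k)) (m : ℕ) (c : WittVector p k) :
    (fun _ => c) ∈ wittReg p S m := fun j _ => S.algebraMap_mem (c.coeff j)

theorem wittReg_frobenius (S : Subalgebra k (X → k)) (m : ℕ) {h : X → WittVector p k}
    (hh : h ∈ wittReg p S m) : (fun x => sigma p k (h x)) ∈ wittReg p S m := by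
  intro j hj
  simp only [WittVector.coeff_frobenius_charP]
  exact S.pow_mem (hh j hj) p

/-- Closed under `p`-th roots. -/
def IsPerfectAlg (p : ℕ) (S : Subalgebra k (X → k)) : Prop := ∀ f : X → k, f ^ p ∈ S → f ∈ S

theorem rootClosure_isPerfectAlg (S : Subalgebra k (X → k)) :
    IsPerfectAlg p (rootClosure p S) := by
  rintro f ⟨m, hm⟩
  exact ⟨m + 1, by rwa [pow_succ', pow_mul]⟩

theorem IsPerfectAlg.mem_of_pow {S : Subalgebra k (X → k)} (hS : IsPerfectAlg p S) {f : X → k}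
    {m : ℕ} (hf : f ^ p ^ m ∈ S) : f ∈ S := by
  induction m with
  | zero => simpa using hf
  | succ m ih => exact ih (hS _ (by rwa [← pow_mul, ← pow_succ]))

theorem IsPerfectAlg.comap {Y : Type w} {S : Subalgebra k (X → k)} (hS : IsPerfectAlg p S)
    (φ : X → Y) : IsPerfectAlg p (S.comap (pullback k φ)) := by
  intro f hf
  refine hS _ ?_
  have : (pullback k φ) (f ^ p) ∈ S := hf
  rwa [map_pow] at this

theorem wittReg_sigmaInv [IsAlgClosed k] {S : Subalgebra k (X → k)} (hS : IsPerfectAlg p S) (m : ℕ)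
    {h : X → WittVector p k} (hh : h ∈ wittReg p S m) :
    (fun x => sigmaInv p k (h x)) ∈ wittReg p S m := by
  intro j hj
  refine hS _ ?_
  convert hh j hj using 1
  funext x
  rw [Pi.pow_apply, ← WittVector.coeff_frobenius_charP]
  exact congrArg (fun t : WittVector p k => t.coeff j) (sigma_sigmaInv (h x))

end WittReg

/-! ### Functions with values in a free module over the Witt vectors -/

section LReg

variable {X : Type v} {L : Type w} [AddCommGroup L] [Module (WittVector p k) L]
  {L' : Type w'} [AddCommGroup L'] [Module (WittVector p k) L']

/-- The values of linear forms on `h` have their first `m` Witt components in `S`. -/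
def LReg (p : ℕ) [Fact p.Prime] {k : Type u} [Field k] [CharP k p] {X : Type v} {L : Type w}
    [AddCommGroup L] [Module (WittVector p k) L]
    (S : Subalgebra k (X → k)) (m : ℕ) (h : X → L) : Prop :=
  ∀ l : Module.Dual (WittVector p k) L, (fun x => l (h x)) ∈ wittReg p S m

variable {S : Subalgebra k (X → k)} {m : ℕ}

theorem LReg.add {h h' : X → L} (H : LReg p S m h) (H' : LReg p S m h') :
    LReg p S m (fun x => h x + h' x) := fun l => by
  simp only [map_add]; exact (wittReg p S m).add_mem (H l) (H' l)

theorem LReg.neg {h : X → L} (H : LReg p S m h) : LReg p S m (fun x => -h x) := fun l => by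
  simp only [map_neg]; exact (wittReg p S m).neg_mem (H l)

theorem LReg.sub {h h' : X → L} (H : LReg p S m h) (H' : LReg p S m h') :
    LReg p S m (fun x => h x - h' x) := fun l => by
  simp only [map_sub]; exact (wittReg p S m).sub_mem (H l) (H' l)

theorem LReg.const (v : L) : LReg p S m (fun _ : X => v) := fun l => wittReg_const S m (l v)

theorem LReg.sum {ι : Type*} (s : Finset ι) {h : ι → X → L} (H : ∀ i ∈ s, LReg p S m (h i)) :
    LReg p S m (fun x => ∑ i ∈ s, h i x) := fun l => by
  simp only [map_sum]
  have := (wittReg p S m).sum_mem (fun i hi => H i hi l)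
  convert this using 1
  funext x
  simp

theorem LReg.smul_const {c : X → WittVector p k} (hc : c ∈ wittReg p S m) (v : L) :
    LReg p S m (fun x => c x • v) := fun l => by
  simp only [map_smul, smul_eq_mul]
  exact (wittReg p S m).mul_mem hc (wittReg_const S m (l v))

theorem LReg.linear {h : X → L} (H : LReg p S m h) (f : L →ₗ[WittVector p k] L') :
    LReg p S m (fun x => f (h x)) := fun l => H (l.comp f)

theorem LReg.smul {h : X → L} (H : LReg p S m h) (c : WittVector p k) :
    LReg p S m (fun x => c • h x) := H.linear (LinearMap.lsmul _ _ c)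

/-- A basis of a finitely generated free module. -/
abbrev bas (p : ℕ) [Fact p.Prime] (k : Type u) [Field k] [CharP k p] (L : Type w) [AddCommGroup L]
    [Module (WittVector p k) L] [Module.Free (WittVector p k) L] :
    Module.Basis (Module.Free.ChooseBasisIndex (WittVector p k) L) (WittVector p k) L :=
  Module.Free.chooseBasis (WittVector p k) L

variable [Module.Free (WittVector p k) L] [Module.Finite (WittVector p k) L]

theorem map_eq_sum {τ : WittVector p k →+* WittVector p k} (F : L →ₛₗ[τ] L') (x : L) :
    F x = ∑ i, τ ((bas p k L).coord i x) • F (bas p k L i) := by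
  conv_lhs => rw [← (bas p k L).sum_repr x]
  simp only [map_sum, map_smulₛₗ, Module.Basis.coord_apply]

theorem LReg.semilinear {h : X → L} (H : LReg p S m h) (F : L →ₛₗ[sigma p k] L') :
    LReg p S m (fun x => F (h x)) := by
  rw [show (fun x => F (h x)) = _ from funext fun x => map_eq_sum F (h x)]
  exact LReg.sum _ fun i _ => LReg.smul_const (wittReg_frobenius S m (H _)) _

theorem LReg.semilinearInv [IsAlgClosed k] (hS : IsPerfectAlg p S) {h : X → L} (H : LReg p S m h)
    (F : L →ₛₗ[sigmaInv p k] L') : LReg p S m (fun x => F (h x)) := by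
  rw [show (fun x => F (h x)) = _ from funext fun x => map_eq_sum F (h x)]
  exact LReg.sum _ fun i _ => LReg.smul_const (wittReg_sigmaInv hS m (H _)) _

theorem LReg.of_coord {h : X → L} (H : ∀ i, (fun x => (bas p k L).coord i (h x)) ∈ wittReg p S m) :
    LReg p S m h := by
  have : h = fun x => ∑ i, (bas p k L).coord i (h x) • (bas p k L i) := by
    funext x
    exact ((bas p k L).sum_repr (h x)).symm
  rw [this]
  exact LReg.sum _ fun i _ => LReg.smul_const (H i) _

end LReg

/-! ### Polynomial functions of bounded level -/

section PolyFun

variable (p k) in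
/-- The algebra generated by the first `m` Witt components of linear forms. -/
def polyFun (L : Type v) [AddCommGroup L] [Module (WittVector p k) L] (m : ℕ) :
    Subalgebra k (L → k) :=
  Algebra.adjoin k {f | ∃ (l : Module.Dual (WittVector p k) L) (i : ℕ), i < m ∧
    f = fun x => (l x).coeff i}

variable {L : Type v} [AddCommGroup L] [Module (WittVector p k) L]
variable {X : Type w}

theorem lreg_id (m : ℕ) : LReg p (polyFun p k L m) m (fun x : L => x) :=
  fun l i hi => Algebra.subset_adjoin ⟨l, i, hi, rfl⟩

theorem polyFun_mono {m m' : ℕ} (h : m ≤ m') : polyFun p k L m ≤ polyFun p k L m' :=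
  Algebra.adjoin_mono fun _ ⟨l, i, hi, hf⟩ => ⟨l, i, hi.trans_le h, hf⟩

theorem comp_mem_of_mem_polyFun {S : Subalgebra k (X → k)} {m : ℕ} {h : X → L} (H : LReg p S m h)
    {f : L → k} (hf : f ∈ polyFun p k L m) : (fun x => f (h x)) ∈ S := by
  have : polyFun p k L m ≤ S.comap (pullback k h) := by
    refine Algebra.adjoin_le ?_
    rintro _ ⟨l, i, hi, rfl⟩
    exact H l i hi
  exact this hf

variable (p k L) in
/-- The regular functions on `L`. -/
def regFun : Subalgebra k (L → k) := (ofModule p k L).regular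

theorem mem_regular_iff {f : L → k} :
    f ∈ regFun p k L ↔ ∃ e m : ℕ, f ^ p ^ e ∈ polyFun p k L m := by
  constructor
  · rintro ⟨e, he⟩
    refine ⟨e, ?_⟩
    generalize f ^ p ^ e = g at he
    induction he using Algebra.adjoin_induction with
    | mem x hx =>
      obtain ⟨l, i, rfl⟩ := hx
      exact ⟨i + 1, Algebra.subset_adjoin ⟨l, i, Nat.lt_succ_self i, rfl⟩⟩
    | algebraMap r => exact ⟨0, Subalgebra.algebraMap_mem _ r⟩
    | add x y _ _ hx hy =>
      obtain ⟨m, hm⟩ := hx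
      obtain ⟨m', hm'⟩ := hy
      exact ⟨max m m', add_mem (polyFun_mono (le_max_left _ _) hm)
        (polyFun_mono (le_max_right _ _) hm')⟩
    | mul x y _ _ hx hy =>
      obtain ⟨m, hm⟩ := hx
      obtain ⟨m', hm'⟩ := hy
      exact ⟨max m m', mul_mem (polyFun_mono (le_max_left _ _) hm)
        (polyFun_mono (le_max_right _ _) hm')⟩
  · rintro ⟨e, m, hm⟩
    refine ⟨e, Algebra.adjoin_mono ?_ hm⟩
    rintro _ ⟨l, i, _, hf⟩
    exact ⟨l, i, hf⟩

theorem regular_isPerfectAlg : IsPerfectAlg p (regFun p k L) :=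
  rootClosure_isPerfectAlg _

theorem polyFun_le_regular (m : ℕ) : polyFun p k L m ≤ regFun p k L :=
  fun _ hf => mem_regular_iff.2 ⟨0, m, by simpa using hf⟩

theorem lreg_id_regular (m : ℕ) : LReg p (regFun p k L) m (fun x : L => x) :=
  fun l i hi => polyFun_le_regular m (lreg_id m l i hi)

theorem comp_mem_of_mem_regular {S : Subalgebra k (X → k)} (hS : IsPerfectAlg p S)
    {h : X → L} (H : ∀ m, LReg p S m h)
    {f : L → k} (hf : f ∈ regFun p k L) : (fun x => f (h x)) ∈ S := by
  obtain ⟨e, m, hm⟩ := mem_regular_iff.1 hf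
  exact hS.mem_of_pow (m := e) (comp_mem_of_mem_polyFun (H m) hm)

variable [Module.Free (WittVector p k) L] [Module.Finite (WittVector p k) L]

theorem polyFun_eq_adjoin (m : ℕ) : polyFun p k L m = Algebra.adjoin k
    (Set.range fun q : Module.Free.ChooseBasisIndex (WittVector p k) L × Fin m =>
      fun x : L => ((bas p k L).coord q.1 x).coeff q.2) := by
  apply le_antisymm
  · refine Algebra.adjoin_le ?_
    rintro _ ⟨l, i, hi, rfl⟩
    have : LReg p (Algebra.adjoin k
      (Set.range fun q : Module.Free.ChooseBasisIndex (WittVector p k) L × Fin m =>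
      fun x : L => ((bas p k L).coord q.1 x).coeff q.2)) m (fun x : L => x) :=
      LReg.of_coord fun i j hj => Algebra.subset_adjoin ⟨(i, ⟨j, hj⟩), rfl⟩
    exact this l i hi
  · refine Algebra.adjoin_mono ?_
    rintro _ ⟨q, rfl⟩
    exact ⟨(bas p k L).coord q.1, q.2, q.2.2, rfl⟩

theorem polyFun_fg (m : ℕ) : (polyFun p k L m).FG := by
  rw [polyFun_eq_adjoin]
  exact Subalgebra.fg_def.2 ⟨_, Set.finite_range _, rfl⟩

variable (p k) in
/-- A point with prescribed Witt coordinates. -/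
def ofCoords (c : Module.Free.ChooseBasisIndex (WittVector p k) L → ℕ → k) : L :=
  ∑ i, WittVector.mk p (c i) • bas p k L i

theorem coord_ofCoords (c : Module.Free.ChooseBasisIndex (WittVector p k) L → ℕ → k)
    (i : Module.Free.ChooseBasisIndex (WittVector p k) L) :
    (bas p k L).coord i (ofCoords p k c) = WittVector.mk p (c i) := by
  classical
  simp [ofCoords, Module.Basis.coord_apply, Finsupp.single_apply]

theorem polyFun_hasPoints (m : ℕ) : HasPoints (polyFun p k L m) := by
  intro χ
  have hmem : ∀ i j, j < m → (fun x : L => ((bas p k L).coord i x).coeff j) ∈ polyFun p k L m :=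
    fun i j hj => Algebra.subset_adjoin ⟨_, j, hj, rfl⟩
  -- Witt components from `m` on are invisible to the algebra, so they are set to `0`.
  let x : L := ofCoords p k (fun i j => if hj : j < m then χ ⟨_, hmem i j hj⟩ else 0)
  refine ⟨x, ?_⟩
  rintro ⟨f, hf⟩
  have key : ∀ f (hf' : f ∈ Algebra.adjoin k
    (Set.range fun q : Module.Free.ChooseBasisIndex (WittVector p k) L × Fin m =>
      fun x : L => ((bas p k L).coord q.1 x).coeff q.2)),
      χ ⟨f, by rwa [polyFun_eq_adjoin]⟩ = f x := by
    intro f hf'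
    induction hf' using Algebra.adjoin_induction with
    | mem f hf =>
      obtain ⟨q, rfl⟩ := hf
      simp only [x, coord_ofCoords, WittVector.coeff_mk, q.2.2, dif_pos]
    | algebraMap r => exact χ.commutes r
    | add a b ha hb h1 h2 =>
      rw [Pi.add_apply, ← h1, ← h2, ← map_add]; rfl
    | mul a b ha hb h1 h2 =>
      rw [Pi.mul_apply, ← h1, ← h2, ← map_mul]; rfl
  exact key f (by rwa [← polyFun_eq_adjoin])

/-- The first `m` Witt components of the coordinates take arbitrary independent values, so over an
infinite field they are algebraically independent and the algebra is a polynomial ring. -/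
instance polyFun_isDomain [Infinite k] (m : ℕ) : IsDomain (polyFun p k L m) := by
  let c := fun q : Module.Free.ChooseBasisIndex (WittVector p k) L × Fin m =>
      fun x : L => ((bas p k L).coord q.1 x).coeff q.2
  have hinj : Function.Injective (MvPolynomial.aeval (R := k) c) := by
    rw [injective_iff_map_eq_zero]
    intro P hP
    refine MvPolynomial.funext fun y => ?_
    have h1 := congrFun hP (ofCoords p k (fun i j => if hj : j < m then y (i, ⟨j, hj⟩) else 0))
    have h2 : ∀ z : L, (MvPolynomial.aeval (R := k) c P) z =
        MvPolynomial.eval (fun q => c q z) P := by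
      intro z
      have h3 := MvPolynomial.map_aeval (R := k) c (Pi.evalRingHom (fun _ : L => k) z) P
      exact h3
    rw [h2] at h1
    rw [map_zero]
    rw [← show (fun q => c q (ofCoords p k fun i j => if hj : j < m then y (i, ⟨j, hj⟩) else 0)) = y
      from ?_]
    · exact h1
    funext q
    simp only [c, coord_ofCoords, WittVector.coeff_mk, q.2.2, dif_pos]
  have hr : polyFun p k L m = (MvPolynomial.aeval (R := k) c).range := by
    rw [polyFun_eq_adjoin, Algebra.adjoin_range_eq_range_aeval]
  rw [hr]
  exact (AlgEquiv.ofInjective _ hinj).symm.toMulEquiv.isDomain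

end PolyFun

/-! ### Algebras of functions on products and subsets -/

section Product

variable {k : Type u} [Field k] {X : Type v} {Y : Type w}

/-- An element of the join is a finite sum of products `a(x) b(y)`; the factors `a` span `E`.
Applied to `f (x + y)`, this gives local finiteness of translation. -/
theorem exists_finiteDimensional_of_mem_sup {S : Subalgebra k (X → k)} {T : Subalgebra k (Y → k)}
    {Φ : X × Y → k} (h : Φ ∈ S.map (pullback k Prod.fst) ⊔ T.map (pullback k Prod.snd)) :
    ∃ E : Submodule k (X → k), FiniteDimensional k E ∧ E ≤ S.toSubmodule ∧
      ∀ y, (fun x => Φ (x, y)) ∈ E := by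
  have h' : Φ ∈ Subalgebra.toSubmodule (S.map (pullback k Prod.fst)) *
      Subalgebra.toSubmodule (T.map (pullback k Prod.snd)) := by
    rw [Subalgebra.mul_toSubmodule]; exact h
  clear h
  induction h' using Submodule.mul_induction_on' with
  | mem_mul_mem a ha b hb =>
    obtain ⟨a, ha, rfl⟩ := ha
    obtain ⟨b, hb, rfl⟩ := hb
    refine ⟨Submodule.span k {a}, inferInstance, ?_, fun y => ?_⟩
    · rw [Submodule.span_singleton_le_iff_mem]; exact ha
    · refine Submodule.mem_span_singleton.2 ⟨b y, ?_⟩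
      funext x
      exact mul_comm _ _
  | add a _ b _ ha hb =>
    obtain ⟨E, h1, h2, h3⟩ := ha
    obtain ⟨E', h1', h2', h3'⟩ := hb
    exact ⟨E ⊔ E', inferInstance, sup_le h2 h2', fun y => add_mem
      (Submodule.mem_sup_left (h3 y)) (Submodule.mem_sup_right (h3' y))⟩

/-- Evaluations at points span the dual of `E`, so the coordinates of `Φ (·, y)` in a basis of `E`
are linear combinations of the functions `Φ (x, ·)`, and thus lie in `T`. -/
theorem mem_sup_of_finiteDimensional {S : Subalgebra k (X → k)} {T : Subalgebra k (Y → k)}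
    {Φ : X × Y → k} (E : Submodule k (X → k)) [FiniteDimensional k E] (hE : E ≤ S.toSubmodule)
    (h1 : ∀ y, (fun x => Φ (x, y)) ∈ E) (h2 : ∀ x, (fun y => Φ (x, y)) ∈ T) :
    Φ ∈ S.map (pullback k Prod.fst) ⊔ T.map (pullback k Prod.snd) := by
  let ev : X → Module.Dual k E := fun x => (LinearMap.proj x).comp E.subtype
  have hspan : Submodule.span k (Set.range ev) = ⊤ := by
    rw [← Subspace.dualCoannihilator_dualAnnihilator_eq (W := Submodule.span k (Set.range ev))]
    have : (Submodule.span k (Set.range ev)).dualCoannihilator = ⊥ := by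
      rw [eq_bot_iff]
      intro e he
      rw [Submodule.mem_dualCoannihilator] at he
      refine (Submodule.mem_bot k).2 (Subtype.ext (funext fun x => ?_))
      exact he (ev x) (Submodule.subset_span ⟨x, rfl⟩)
    rw [this, Submodule.dualAnnihilator_bot]
  have hlam : ∀ lam : Module.Dual k E, (fun y => lam ⟨_, h1 y⟩) ∈ T := by
    intro lam
    have hl : lam ∈ Submodule.span k (Set.range ev) := by rw [hspan]; trivial
    induction hl using Submodule.span_induction with
    | mem l hl =>
      obtain ⟨x, rfl⟩ := hl
      exact h2 x
    | zero => exact T.zero_mem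
    | add a b _ _ ha hb => exact T.add_mem ha hb
    | smul c a _ ha => exact T.smul_mem ha c
  let b := Module.finBasis k E
  have hΦ : Φ = ∑ i, pullback k Prod.fst (b i : X → k) *
      pullback k Prod.snd (fun y => b.coord i ⟨_, h1 y⟩) := by
    funext ⟨x, y⟩
    have h3 := congrArg (fun e : E => (e : X → k) x) (b.sum_repr ⟨_, h1 y⟩)
    simp only [Submodule.coe_sum, Finset.sum_apply] at h3
    rw [Finset.sum_apply]
    exact h3.symm.trans (Finset.sum_congr rfl fun i _ => mul_comm _ _)
  rw [hΦ]
  exact sum_mem fun i _ => mul_mem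
    ((le_sup_left : S.map (pullback k Prod.fst) ≤ _) ⟨_, hE (b i).2, rfl⟩)
    ((le_sup_right : T.map (pullback k Prod.snd) ≤ _) ⟨_, hlam _, rfl⟩)

end Product

/-- A point of the restricted algebra is a point of `S` at which the equations `I` of `Z` vanish. -/
theorem HasPoints.restrict {k : Type u} [Field k] {X : Type v} {S : Subalgebra k (X → k)}
    (hS : HasPoints S) (Z : Set X) (I : Set (X → k)) (hI : I ⊆ S)
    (hZ : ∀ x, (∀ f ∈ I, f x = 0) → x ∈ Z) (hIZ : ∀ x ∈ Z, ∀ f ∈ I, f x = 0) :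
    HasPoints (S.map (pullback k (Subtype.val : Z → X))) := by
  intro χ
  let r : S →ₐ[k] S.map (pullback k (Subtype.val : Z → X)) :=
    ((pullback k (Subtype.val : Z → X)).comp S.val).codRestrict _ fun s => ⟨s.1, s.2, rfl⟩
  obtain ⟨x, hx⟩ := hS (χ.comp r)
  have hxZ : x ∈ Z := by
    refine hZ x fun f hf => ?_
    have h1 := hx ⟨f, hI hf⟩
    have h2 : r ⟨f, hI hf⟩ = 0 := Subtype.ext (funext fun z => hIZ z.1 z.2 f hf)
    rw [AlgHom.comp_apply, h2, map_zero] at h1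
    exact h1.symm
  refine ⟨⟨x, hxZ⟩, ?_⟩
  rintro ⟨_, ⟨s, hs, rfl⟩⟩
  exact hx ⟨s, hs⟩

/-! ### Translates of functions of bounded level -/

section Translate

variable {L : Type v} [AddCommGroup L] [Module (WittVector p k) L]

theorem polyFun_add_mem {f : L → k} {m : ℕ} (hf : f ∈ polyFun p k L m) :
    (fun z : L × L => f (z.1 + z.2)) ∈ (polyFun p k L m).map (pullback k Prod.fst) ⊔
      (polyFun p k L m).map (pullback k Prod.snd) := by
  refine comp_mem_of_mem_polyFun (m := m) (h := fun z : L × L => z.1 + z.2)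
    (LReg.add (fun l i hi => ?_) (fun l i hi => ?_)) hf
  · exact (le_sup_left : (polyFun p k L m).map (pullback k Prod.fst) ≤ _)
      ⟨_, lreg_id m l i hi, rfl⟩
  · exact (le_sup_right : (polyFun p k L m).map (pullback k Prod.snd) ≤ _)
      ⟨_, lreg_id m l i hi, rfl⟩

theorem polyFun_translate {f : L → k} {m : ℕ} (hf : f ∈ polyFun p k L m) (h : L) :
    (fun x => f (x + h)) ∈ polyFun p k L m :=
  comp_mem_of_mem_polyFun (LReg.add (lreg_id m) (LReg.const h)) hf

theorem regular_translate {f : L → k} (hf : f ∈ regFun p k L) (h : L) :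
    (fun x => f (x + h)) ∈ regFun p k L :=
  comp_mem_of_mem_regular regular_isPerfectAlg
    (fun m => LReg.add (lreg_id_regular m) (LReg.const h)) hf

end Translate

/-! ### Congruences modulo powers of `p` -/

section Trunc

variable {L : Type v} [AddCommGroup L] [Module (WittVector p k) L]

variable (p k L) in
/-- The submodule `p ^ n L`. -/
abbrev pPow (n : ℕ) : Submodule (WittVector p k) L :=
  LinearMap.range (LinearMap.lsmul (WittVector p k) L ((p : WittVector p k) ^ n))

theorem mem_pPow {n : ℕ} {x : L} : x ∈ pPow p k L n ↔ ∃ y, x = (p : WittVector p k) ^ n • y :=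
  ⟨fun ⟨y, hy⟩ => ⟨y, hy.symm⟩, fun ⟨y, hy⟩ => ⟨y, hy.symm⟩⟩

theorem pPow_anti {m n : ℕ} (h : m ≤ n) : pPow p k L n ≤ pPow p k L m := by
  rintro _ ⟨y, rfl⟩
  refine ⟨(p : WittVector p k) ^ (n - m) • y, ?_⟩
  rw [LinearMap.lsmul_apply, LinearMap.lsmul_apply, ← mul_smul, ← pow_add, Nat.add_sub_cancel' h]

theorem coeff_eq_iff_sub_mem [PerfectRing k p] {n : ℕ} {a b : WittVector p k} :
    (∀ j < n, a.coeff j = b.coeff j) ↔ ∃ c, a - b = (p : WittVector p k) ^ n * c := by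
  rw [WittVector.le_coeff_eq_iff_le_sub_coeff_eq_zero,
    ← WittVector.mem_span_p_pow_iff_le_coeff_eq_zero, Ideal.mem_span_singleton]
  rfl

theorem polyFun_congr [PerfectRing k p] {n : ℕ} {f : L → k} (hf : f ∈ polyFun p k L n) {x y : L}
    (h : x - y ∈ pPow p k L n) : f x = f y := by
  obtain ⟨c, hc⟩ := mem_pPow.1 h
  induction hf using Algebra.adjoin_induction with
  | mem f hf =>
    obtain ⟨l, i, hi, rfl⟩ := hf
    refine coeff_eq_iff_sub_mem.2 ⟨l c, ?_⟩ i hi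
    rw [← map_sub, hc, map_smul, smul_eq_mul]
  | algebraMap r => rfl
  | add a b _ _ ha hb => rw [Pi.add_apply, Pi.add_apply, ha, hb]
  | mul a b _ _ ha hb => rw [Pi.mul_apply, Pi.mul_apply, ha, hb]

variable [Module.Free (WittVector p k) L] [Module.Finite (WittVector p k) L]

theorem sub_mem_pPow_iff [PerfectRing k p] {n : ℕ} {x y : L} : x - y ∈ pPow p k L n ↔
    ∀ i, ∀ j < n, ((bas p k L).coord i x).coeff j = ((bas p k L).coord i y).coeff j := by
  constructor
  · intro h i j hj
    exact polyFun_congr (f := fun z : L => ((bas p k L).coord i z).coeff j)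
      (Algebra.subset_adjoin ⟨_, j, hj, rfl⟩) h
  · intro h
    have h' := fun i => coeff_eq_iff_sub_mem.1 (h i)
    choose c hc using h'
    refine mem_pPow.2 ⟨∑ i, c i • bas p k L i, ?_⟩
    refine (bas p k L).ext_elem fun i => ?_
    have h1 := hc i
    simp only [Module.Basis.coord_apply] at h1
    rw [map_sub, Finsupp.sub_apply, h1, map_smul, Finsupp.smul_apply,
      (bas p k L).repr_sum_self, smul_eq_mul]

variable (p k) in
/-- The lift of the class of `x` modulo `p ^ n` with vanishing higher Witt coordinates. -/
def trunc (n : ℕ) (x : L) : L :=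
  ofCoords p k fun i j => if j < n then ((bas p k L).coord i x).coeff j else 0

theorem coord_trunc (n : ℕ) (x : L) (i : Module.Free.ChooseBasisIndex (WittVector p k) L) (j : ℕ) :
    ((bas p k L).coord i (trunc p k n x)).coeff j =
      if j < n then ((bas p k L).coord i x).coeff j else 0 := by
  rw [trunc, coord_ofCoords, WittVector.coeff_mk]

theorem trunc_sub_mem [PerfectRing k p] (n : ℕ) (x : L) : trunc p k n x - x ∈ pPow p k L n :=
  sub_mem_pPow_iff.2 fun i j hj => by rw [coord_trunc, if_pos hj]

theorem trunc_congr [PerfectRing k p] {n : ℕ} {x y : L} (h : x - y ∈ pPow p k L n) :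
    trunc p k n x = trunc p k n y := by
  unfold trunc
  congr 1
  funext i j
  split_ifs with hj
  · exact sub_mem_pPow_iff.1 h i j hj
  · rfl

/-- Here `m` is arbitrary: the components of the truncation from `n` on vanish. Composition with
`trunc` therefore brings a function of any level down to level `n`. -/
theorem lreg_trunc (n m : ℕ) : LReg p (polyFun p k L n) m (trunc p k n : L → L) :=
  LReg.of_coord fun i j _ => by
    simp only [coord_trunc]
    split_ifs with hj
    · exact Algebra.subset_adjoin ⟨_, j, hj, rfl⟩
    · exact Subalgebra.zero_mem _

/-- A regular function which is invariant under `p ^ n L` has level `n`. -/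
theorem exists_pow_mem_polyFun [PerfectRing k p] {n : ℕ} {f : L → k}
    (hf : f ∈ regFun p k L) (h : ∀ x y, x - y ∈ pPow p k L n → f x = f y) :
    ∃ e, f ^ p ^ e ∈ polyFun p k L n := by
  obtain ⟨e, m, hm⟩ := mem_regular_iff.1 hf
  refine ⟨e, ?_⟩
  convert comp_mem_of_mem_polyFun (lreg_trunc n m) hm using 1
  funext x
  exact congrArg (· ^ p ^ e) (h _ _ (trunc_sub_mem n x)).symm

variable (p k) in
/-- Division by `p`. -/
def divP [IsAlgClosed k] (x : L) : L :=
  -- In characteristic `p`, multiplication by `p` is `(a₀, a₁, …) ↦ (0, a₀^p, a₁^p, …)`. Its inverse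
  -- shifts down and takes `p`-th roots; the component `0` is discarded, which makes the operation
  -- total.
  ofCoords p k fun i j => (frobeniusEquiv k p).symm (((bas p k L).coord i x).coeff (j + 1))

theorem coord_divP [IsAlgClosed k] (x : L) (i : Module.Free.ChooseBasisIndex (WittVector p k) L)
    (j : ℕ) : ((bas p k L).coord i (divP p k x)).coeff j =
      (frobeniusEquiv k p).symm (((bas p k L).coord i x).coeff (j + 1)) := by
  rw [divP, coord_ofCoords, WittVector.coeff_mk]

theorem divP_smul [IsAlgClosed k] (x : L) : divP p k ((p : WittVector p k) • x) = x := by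
  refine (bas p k L).ext_elem fun i => WittVector.ext fun j => ?_
  have h := coord_divP ((p : WittVector p k) • x) i j
  rw [Module.Basis.coord_apply] at h
  rw [h, map_smul, smul_eq_mul, mul_comm, WittVector.mul_charP_coeff_succ]
  exact (frobeniusEquiv k p).symm_apply_apply _

theorem divP_iterate_smul [IsAlgClosed k] (n : ℕ) (x : L) :
    (divP p k)^[n] ((p : WittVector p k) ^ n • x) = x := by
  induction n with
  | zero => simp
  | succ n ih => rw [Function.iterate_succ_apply, pow_succ', mul_smul, divP_smul, ih]

theorem divP_congr [IsAlgClosed k] {n : ℕ} {x y : L} (h : x - y ∈ pPow p k L (n + 1)) :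
    divP p k x - divP p k y ∈ pPow p k L n :=
  sub_mem_pPow_iff.2 fun i j hj => by
    rw [coord_divP, coord_divP, sub_mem_pPow_iff.1 h i (j + 1) (Nat.succ_lt_succ hj)]

theorem divP_iterate_congr [IsAlgClosed k] {n d : ℕ} {x y : L} (h : x - y ∈ pPow p k L (n + d)) :
    (divP p k)^[d] x - (divP p k)^[d] y ∈ pPow p k L n := by
  induction d generalizing x y with
  | zero => exact h
  | succ d ih =>
    rw [Function.iterate_succ_apply, Function.iterate_succ_apply]
    exact ih (divP_congr h)

theorem LReg.divP [IsAlgClosed k] {X : Type w} {S : Subalgebra k (X → k)} (hS : IsPerfectAlg p S)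
    {h : X → L} (H : ∀ m, LReg p S m h) (m : ℕ) : LReg p S m (fun x => divP p k (h x)) :=
  LReg.of_coord fun i j _ => hS _ (by
    convert H (j + 2) ((bas p k L).coord i) (j + 1) (Nat.lt_succ_self _) using 1
    funext x
    rw [Pi.pow_apply, coord_divP]
    exact (frobeniusEquiv k p).apply_symm_apply _)

theorem LReg.divP_iterate [IsAlgClosed k] {X : Type w} {S : Subalgebra k (X → k)}
    (hS : IsPerfectAlg p S) {h : X → L} (H : ∀ m, LReg p S m h) (d m : ℕ) :
    LReg p S m (fun x => (QuasiAlg.divP p k)^[d] (h x)) := by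
  induction d generalizing h with
  | zero => exact H m
  | succ d ih =>
    simp only [Function.iterate_succ_apply]
    exact ih (LReg.divP hS H)

end Trunc

end QuasiAlg
end

noncomputable section
namespace QuasiAlg

variable {p : ℕ} [Fact p.Prime] {k : Type u} [Field k] [CharP k p] [IsAlgClosed k]

/-! ### Frobenius-semilinear operators on the Witt vectors -/

section Operators

theorem p_dvd_iff_coeff_zero {a : WittVector p k} : (∃ c, a = p * c) ↔ a.coeff 0 = 0 := by
  rw [← WittVector.mem_span_p_iff_coeff_zero_eq_zero, Ideal.mem_span_singleton]
  rfl

theorem eq_zero_of_forall_pow_dvd {a : WittVector p k}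
    (h : ∀ n : ℕ, ∃ c, a = (p : WittVector p k) ^ n * c) : a = 0 := by
  refine WittVector.ext fun j => ?_
  obtain ⟨c, hc⟩ := h (j + 1)
  have h1 : a - 0 = (p : WittVector p k) ^ (j + 1) * c := by rw [sub_zero, hc]
  exact coeff_eq_iff_sub_mem.2 ⟨c, h1⟩ j (Nat.lt_succ_self j)

/-- An additive operator which is surjective modulo `p` is surjective. -/
theorem surjective_of_surjective_mod_p (T : WittVector p k →+ WittVector p k)
    (hT : ∀ x, T (p * x) = p * T x) (h : ∀ y : k, ∃ x, (T x).coeff 0 = y) :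
    Function.Surjective T := by
  have h1 : ∀ y : WittVector p k, ∃ q : WittVector p k × WittVector p k,
      y = T q.1 + p * q.2 := by
    intro y
    obtain ⟨x, hx⟩ := h (y.coeff 0)
    obtain ⟨c, hc⟩ := (coeff_eq_iff_sub_mem (n := 1) (a := y) (b := T x)).1 (fun j hj => by
      obtain rfl : j = 0 := by omega
      exact hx.symm)
    exact ⟨(x, c), by rw [← pow_one (p : WittVector p k), ← hc]; simp⟩
  choose q hq using h1
  intro y
  -- Successive approximation: `f n` is the partial sum and `r n` the remainder, with `T (f n) = y -
  -- p ^ n * r n`.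
  let r : ℕ → WittVector p k := fun n => (fun y => (q y).2)^[n] y
  have hr : ∀ n, r (n + 1) = (q (r n)).2 := fun n => Function.iterate_succ_apply' _ _ _
  let f : ℕ → WittVector p k := fun n =>
    ∑ i ∈ Finset.range n, (p : WittVector p k) ^ i * (q (r i)).1
  have hTp : ∀ n x, T ((p : WittVector p k) ^ n * x) = (p : WittVector p k) ^ n * T x := by
    intro n x
    induction n with
    | zero => simp
    | succ n ih => rw [pow_succ', mul_assoc, hT, ih, mul_assoc]
  have hTf : ∀ n, T (f n) = y - (p : WittVector p k) ^ n * r n := by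
    intro n
    induction n with
    | zero => simp [f, r]
    | succ n ih =>
      have h2 : f (n + 1) = f n + (p : WittVector p k) ^ n * (q (r n)).1 :=
        Finset.sum_range_succ _ _
      have h3 := hq (r n)
      rw [h2, map_add, ih, hTp, hr, pow_succ, mul_assoc, eq_sub_of_add_eq h3.symm]
      ring
  have hsmod : ∀ n : ℕ, ∀ a b : WittVector p k,
      a ≡ b [SMOD (Ideal.span {(p : WittVector p k)} ^ n • ⊤ : Submodule (WittVector p k) _)] ↔
      ∃ c, a - b = (p : WittVector p k) ^ n * c := by
    intro n a b
    rw [SModEq.sub_mem, smul_eq_mul, Ideal.mul_top, Ideal.span_singleton_pow,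
      Ideal.mem_span_singleton]
    rfl
  obtain ⟨l, hl⟩ := IsPrecomplete.prec' (I := Ideal.span {(p : WittVector p k)}) f (by
    intro m n hmn
    rw [hsmod]
    obtain ⟨d, rfl⟩ := Nat.exists_eq_add_of_le hmn
    refine ⟨-∑ i ∈ Finset.range d, (p : WittVector p k) ^ i * (q (r (m + i))).1, ?_⟩
    simp only [f, Finset.sum_range_add, mul_neg, Finset.mul_sum, pow_add, mul_assoc]
    ring)
  refine ⟨l, ?_⟩
  rw [← sub_eq_zero]
  refine eq_zero_of_forall_pow_dvd fun n => ?_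
  -- No continuity of `T` is needed: it commutes with `p`, so `l ≡ f n` modulo `p ^ n` gives the
  -- same congruence for the images.
  obtain ⟨c, hc⟩ := (hsmod n _ _).1 (hl n)
  refine ⟨-(r n) - T c, ?_⟩
  rw [show l = f n - (p : WittVector p k) ^ n * c by rw [← hc]; ring, map_sub, hTf, hTp]
  ring

theorem coeff_sigmaInv_iterate (i : ℕ) (d : WittVector p k) (j : ℕ) :
    ((sigmaInv p k)^[i] d).coeff j ^ p ^ i = d.coeff j := by
  induction i generalizing d with
  | zero => simp
  | succ i ih =>
    rw [Function.iterate_succ_apply, pow_succ, pow_mul, ih, ← WittVector.coeff_frobenius_charP]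
    exact congrArg (fun t : WittVector p k => t.coeff j) (sigma_sigmaInv d)

open Polynomial in
/-- The additive polynomial `∑ b i X ^ (p ^ (r - i))`. -/
def additivePoly (p : ℕ) {k : Type u} [Field k] (r : ℕ) (b : ℕ → k) : k[X] :=
  ∑ i ∈ Finset.range (r + 1), C (b i) * X ^ p ^ (r - i)

theorem additivePoly_coeff (r : ℕ) (b : ℕ → k) {i : ℕ} (hi : i ≤ r) :
    (additivePoly p r b).coeff (p ^ (r - i)) = b i := by
  rw [additivePoly, Polynomial.finsetSum_coeff, Finset.sum_eq_single i]
  · simp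
  · intro j hj hji
    rw [Polynomial.coeff_C_mul, Polynomial.coeff_X_pow, if_neg, mul_zero]
    intro h
    have := Nat.pow_right_injective (Fact.out : p.Prime).two_le h
    have := Finset.mem_range.1 hj
    omega
  · intro h
    exact absurd (Finset.mem_range.2 (Nat.lt_succ_of_le hi)) h

theorem exists_eval_additivePoly {r : ℕ} {b : ℕ → k} {i : ℕ} (hi : i ≤ r) (hb : b i ≠ 0) (y : k) :
    ∃ t, (additivePoly p r b).eval t = y := by
  obtain ⟨t, ht⟩ := IsAlgClosed.exists_root (additivePoly p r b - Polynomial.C y) (by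
    intro hdeg
    have h1 := Polynomial.eq_C_of_degree_eq_zero hdeg
    have h2 := congrArg (fun P => Polynomial.coeff P (p ^ (r - i))) h1
    have hpos : p ^ (r - i) ≠ 0 := pow_ne_zero _ (Fact.out : p.Prime).ne_zero
    simp only [Polynomial.coeff_sub, additivePoly_coeff r b hi, Polynomial.coeff_C,
      if_neg hpos, sub_zero] at h2
    exact hb h2)
  refine ⟨t, ?_⟩
  rw [Polynomial.IsRoot, Polynomial.eval_sub, Polynomial.eval_C, sub_eq_zero] at ht
  exact ht

/-- The operator `d ↦ ∑ a i σ⁻ⁱ(d)`. -/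
def sigmaOp (r : ℕ) (a : ℕ → WittVector p k) : WittVector p k →+ WittVector p k :=
  AddMonoidHom.mk' (fun d => ∑ i ∈ Finset.range (r + 1), a i * (sigmaInv p k)^[i] d)
    (fun d e => by simp only [iterate_map_add, mul_add, Finset.sum_add_distrib])

theorem sigmaOp_apply (r : ℕ) (a : ℕ → WittVector p k) (d : WittVector p k) :
    sigmaOp r a d = ∑ i ∈ Finset.range (r + 1), a i * (sigmaInv p k)^[i] d := rfl

theorem sigmaOp_p_mul (r : ℕ) (a : ℕ → WittVector p k) (x : WittVector p k) :
    sigmaOp r a (p * x) = p * sigmaOp r a x := by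
  rw [sigmaOp_apply, sigmaOp_apply, Finset.mul_sum]
  refine Finset.sum_congr rfl fun i _ => ?_
  rw [iterate_map_mul, Function.iterate_fixed (map_natCast _ _)]
  ring

/-- The `i`-th term takes a `p ^ i`-th root of the component `0`. Writing that component as `t ^ p ^
r` clears all the roots at once. -/
theorem sigmaOp_coeff_zero (r : ℕ) (a : ℕ → WittVector p k) (d : WittVector p k) {t : k}
    (ht : t ^ p ^ r = d.coeff 0) :
    (sigmaOp r a d).coeff 0 = (additivePoly p r (fun i => (a i).coeff 0)).eval t := by
  have h0 : ∀ x : WittVector p k, x.coeff 0 = WittVector.constantCoeff x := fun _ => rfl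
  rw [h0, sigmaOp_apply, map_sum, additivePoly, Polynomial.eval_finsetSum]
  refine Finset.sum_congr rfl fun i hi => ?_
  rw [map_mul, Polynomial.eval_mul, Polynomial.eval_C, Polynomial.eval_pow, Polynomial.eval_X]
  congr 1
  have h1 := coeff_sigmaInv_iterate i d 0
  have hir : r - i + i = r := Nat.sub_add_cancel (Nat.lt_succ_iff.1 (Finset.mem_range.1 hi))
  rw [← ht, ← hir, pow_add, pow_mul] at h1
  exact iterateFrobenius_inj k p i h1

/-- Divide by `p` as long as all coefficients allow it. This stops, since `0` is the only Witt
vector divisible by every power of `p`. -/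
theorem exists_pow_mul_of_ne_zero (r : ℕ) (a : ℕ → WittVector p k)
    (ha : ∃ i ≤ r, a i ≠ 0) : ∃ (v : ℕ) (b : ℕ → WittVector p k),
    (∀ i ≤ r, a i = (p : WittVector p k) ^ v * b i) ∧ ∃ i ≤ r, (b i).coeff 0 ≠ 0 := by
  by_contra hcon
  push Not at hcon
  have key : ∀ v : ℕ, ∃ b : ℕ → WittVector p k, ∀ i ≤ r, a i = (p : WittVector p k) ^ v * b i := by
    intro v
    induction v with
    | zero => exact ⟨a, fun i _ => by simp⟩
    | succ v ih =>
      obtain ⟨b, hb⟩ := ih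
      have h1 := hcon v b hb
      have h2 : ∀ i, ∃ c, i ≤ r → b i = p * c := by
        intro i
        by_cases hi : i ≤ r
        · obtain ⟨c, hc⟩ := p_dvd_iff_coeff_zero.2 (h1 i hi)
          exact ⟨c, fun _ => hc⟩
        · exact ⟨0, fun h => absurd h hi⟩
      choose c hc using h2
      exact ⟨c, fun i hi => by rw [hb i hi, hc i hi, pow_succ, mul_assoc]⟩
  obtain ⟨i, hi, hne⟩ := ha
  refine hne (eq_zero_of_forall_pow_dvd fun n => ?_)
  obtain ⟨b, hb⟩ := key n
  exact ⟨b i, hb i hi⟩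

theorem sigmaOp_eq_pow_mul {r : ℕ} {a b : ℕ → WittVector p k} {v : ℕ}
    (h : ∀ i ≤ r, a i = (p : WittVector p k) ^ v * b i) (d : WittVector p k) :
    sigmaOp r a d = (p : WittVector p k) ^ v * sigmaOp r b d := by
  rw [sigmaOp_apply, sigmaOp_apply, Finset.mul_sum]
  refine Finset.sum_congr rfl fun i hi => ?_
  rw [h i (Nat.lt_succ_iff.1 (Finset.mem_range.1 hi)), mul_assoc]

/-- The image of a nonzero operator contains a power of `p`. -/
theorem exists_sigmaOp_eq (r : ℕ) (a : ℕ → WittVector p k) (ha : ∃ i ≤ r, a i ≠ 0) :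
    ∃ v : ℕ, ∀ y, ∃ d, sigmaOp r a d = (p : WittVector p k) ^ v * y := by
  obtain ⟨v, b, hb, i, hi, hbi⟩ := exists_pow_mul_of_ne_zero r a ha
  refine ⟨v, fun y => ?_⟩
  obtain ⟨d, hd⟩ := surjective_of_surjective_mod_p (sigmaOp r b) (sigmaOp_p_mul r b) (fun y => by
    obtain ⟨t, ht⟩ := exists_eval_additivePoly (p := p) (b := fun i => (b i).coeff 0) hi hbi y
    refine ⟨WittVector.mk p fun _ => t ^ p ^ r, ?_⟩
    rw [sigmaOp_coeff_zero r b _ (t := t) (by rw [WittVector.coeff_mk]), ht]) y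
  exact ⟨d, by rw [sigmaOp_eq_pow_mul hb, hd]⟩

/-- The kernel of a nonzero operator is finite modulo `p ^ n`. -/
theorem finite_ker_sigmaOp (r : ℕ) (a : ℕ → WittVector p k) (ha : ∃ i ≤ r, a i ≠ 0) (n : ℕ) :
    ∃ E : Set (WittVector p k), E.Finite ∧ ∀ d, sigmaOp r a d = 0 →
      ∃ e ∈ E, ∃ c, d - e = (p : WittVector p k) ^ n * c := by
  classical
  obtain ⟨v, b, hb, i, hi, hbi⟩ := exists_pow_mul_of_ne_zero r a ha
  have hker : ∀ d, sigmaOp r a d = 0 → sigmaOp r b d = 0 := by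
    intro d hd
    rw [sigmaOp_eq_pow_mul hb] at hd
    exact (mul_eq_zero.1 hd).resolve_left (pow_ne_zero _ (WittVector.p_nonzero p k))
  suffices H : ∃ E : Set (WittVector p k), E.Finite ∧ ∀ d, sigmaOp r b d = 0 →
      ∃ e ∈ E, ∃ c, d - e = (p : WittVector p k) ^ n * c by
    obtain ⟨E, hE, h⟩ := H
    exact ⟨E, hE, fun d hd => h d (hker d hd)⟩
  have hne : additivePoly p r (fun i => (b i).coeff 0) ≠ 0 := by
    intro h0
    have h1 := additivePoly_coeff (p := p) r (fun i => (b i).coeff 0) hi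
    rw [h0, Polynomial.coeff_zero] at h1
    exact hbi h1.symm
  -- Modulo `p` the kernel consists of `p ^ r`-th powers of roots of a nonzero additive polynomial.
  -- For higher `n`, subtract a representative in the kernel and divide by `p`: the quotient is
  -- again in the kernel.
  have hfin : {y : k | ∃ d, sigmaOp r b d = 0 ∧ d.coeff 0 = y}.Finite := by
    refine ((additivePoly p r (fun i => (b i).coeff 0)).roots.toFinset.finite_toSet.image
      (fun t => t ^ p ^ r)).subset ?_
    rintro _ ⟨d, hd, rfl⟩
    obtain ⟨t, ht⟩ := (iterateFrobeniusEquiv k p r).surjective (d.coeff 0)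
    have ht' : t ^ p ^ r = d.coeff 0 := ht
    refine ⟨t, ?_, ht'⟩
    rw [Finset.mem_coe, Multiset.mem_toFinset, Polynomial.mem_roots hne, Polynomial.IsRoot,
      ← sigmaOp_coeff_zero r b d ht', hd, WittVector.zero_coeff]
  have hrep : ∀ y : {y : k | ∃ d, sigmaOp r b d = 0 ∧ d.coeff 0 = y},
    ∃ d, sigmaOp r b d = 0 ∧ d.coeff 0 = y := fun y => y.2
  choose rep hrep hrep' using hrep
  have := hfin.to_subtype
  induction n with
  | zero => exact ⟨{0}, Set.finite_singleton 0, fun d _ => ⟨0, rfl, d, by simp⟩⟩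
  | succ n ih =>
    obtain ⟨E, hE, h⟩ := ih
    refine ⟨Set.image2 (fun x e => x + p * e) (Set.range rep) E,
      (Set.finite_range rep).image2 _ hE, fun d hd => ?_⟩
    let y : {y : k | ∃ d, sigmaOp r b d = 0 ∧ d.coeff 0 = y} := ⟨d.coeff 0, d, hd, rfl⟩
    obtain ⟨c, hc⟩ := (coeff_eq_iff_sub_mem (n := 1) (a := d) (b := rep y)).1 (fun j hj => by
      obtain rfl : j = 0 := by omega
      exact (hrep' y).symm)
    rw [pow_one] at hc
    have hc0 : sigmaOp r b c = 0 := by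
      have h1 : (p : WittVector p k) * sigmaOp r b c = 0 := by
        rw [← sigmaOp_p_mul, ← hc, map_sub, hd, hrep, sub_zero]
      exact (mul_eq_zero.1 h1).resolve_left (WittVector.p_nonzero p k)
    obtain ⟨e, he, c', hc'⟩ := h c hc0
    refine ⟨rep y + p * e, ⟨rep y, ⟨y, rfl⟩, e, he, rfl⟩, c', ?_⟩
    rw [pow_succ', mul_assoc, ← hc', mul_sub, ← hc]
    ring

end Operators

/-! ### The operator `F - p` on a crystal -/

section Crystal

variable {L : Type v} [AddCommGroup L] [Module (WittVector p k) L]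
  [Module.Free (WittVector p k) L] [Module.Finite (WittVector p k) L]

/-- `F - p`. -/
def subP (F : L →ₛₗ[sigma p k] L) : L →+ L :=
  F.toAddMonoidHom - (LinearMap.lsmul (WittVector p k) L (p : WittVector p k)).toAddMonoidHom

theorem subP_apply (F : L →ₛₗ[sigma p k] L) (x : L) :
    subP F x = F x - (p : WittVector p k) • x := rfl

theorem subP_smul_natCast (F : L →ₛₗ[sigma p k] L) (m n : ℕ) (x : L) :
    subP F ((m : WittVector p k) ^ n • x) = (m : WittVector p k) ^ n • subP F x := by
  rw [subP_apply, subP_apply, map_smulₛₗ, map_pow, map_natCast, smul_sub, smul_comm]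

/-- Modulo the image of `F - p`, semilinearity gives `d • F y = F (σ⁻¹ d • y) ≡ p σ⁻¹ d • y`;
iterate. -/
theorem smul_iterate_sub_mem_range (F : L →ₛₗ[sigma p k] L) (e : L) (i : ℕ) (d : WittVector p k) :
    d • F^[i] e - ((p : WittVector p k) ^ i * (sigmaInv p k)^[i] d) • e ∈ (subP F).range := by
  induction i generalizing d with
  | zero => simp
  | succ i ih =>
    obtain ⟨x, hx⟩ := ih (sigmaInv p k d)
    refine ⟨sigmaInv p k d • F^[i] e + (p : WittVector p k) ^ 1 • x, ?_⟩
    rw [map_add, subP_smul_natCast, hx, subP_apply, map_smulₛₗ, sigma_sigmaInv, pow_one,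
      smul_sub, Function.iterate_succ_apply', Function.iterate_succ_apply, pow_succ',
      mul_assoc (p : WittVector p k), mul_smul (p : WittVector p k) _ e]
    abel

/-- The vectors `e, F e, …, F^r e`, with `r` the rank, are dependent. A relation `∑ g_i F^i e = 0`
multiplied by `d` becomes, modulo the image of `F - p`, a nonzero operator `sigmaOp` in `d` times
`e`, and the image of that operator contains all multiples of some `p ^ v`. -/
theorem exists_smul_mem_range_subP (F : L →ₛₗ[sigma p k] L) (e : L) :
    ∃ v : ℕ, ∀ c : WittVector p k, ((p : WittVector p k) ^ v * c) • e ∈ (subP F).range := by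
  let r := Module.finrank (WittVector p k) L
  have hdep : ¬ LinearIndependent (WittVector p k) (fun i : Fin (r + 1) => F^[i] e) := by
    intro h
    have := h.fintype_card_le_finrank
    rw [Fintype.card_fin] at this
    omega
  obtain ⟨g, hg, i, hi⟩ := Fintype.not_linearIndependent_iff.1 hdep
  let a : ℕ → WittVector p k := fun i =>
    if hi : i < r + 1 then (p : WittVector p k) ^ i * (sigmaInv p k)^[i] (g ⟨i, hi⟩) else 0
  have hinj : Function.Injective (sigmaInv p k) := (WittVector.frobeniusEquiv p k).symm.injective
  obtain ⟨v, hv⟩ := exists_sigmaOp_eq r a ⟨i, Nat.lt_succ_iff.1 i.2, by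
    simp only [a, i.2, dif_pos]
    refine mul_ne_zero (pow_ne_zero _ (WittVector.p_nonzero p k)) fun h0 => hi ?_
    exact hinj.iterate i (h0.trans (iterate_map_zero (sigmaInv p k) i).symm)⟩
  refine ⟨v, fun c => ?_⟩
  obtain ⟨d, hd⟩ := hv c
  have h1 : ∑ i : Fin (r + 1), ((d * g i) • F^[i] e -
      ((p : WittVector p k) ^ (i : ℕ) * (sigmaInv p k)^[i] (d * g i)) • e) ∈ (subP F).range :=
    sum_mem fun i _ => smul_iterate_sub_mem_range F e i _
  rw [Finset.sum_sub_distrib] at h1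
  simp only [mul_smul d, ← Finset.smul_sum] at h1
  rw [hg, smul_zero, zero_sub, neg_mem_iff, ← Finset.sum_smul] at h1
  rw [← hd, sigmaOp_apply, Finset.sum_range]
  convert h1 using 3 with j
  simp only [a, j.2, dif_pos, iterate_map_mul]
  ring

/-- The cokernel of `F - p` is killed by a power of `p`. -/
theorem exists_pow_smul_mem_range_subP (F : L →ₛₗ[sigma p k] L) :
    ∃ N : ℕ, ∀ n ≥ N, ∀ y : L, ∃ x, subP F x = (p : WittVector p k) ^ n • y := by
  choose v hv using fun i => exists_smul_mem_range_subP F (bas p k L i)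
  refine ⟨∑ i, v i, fun n hn y => ?_⟩
  have h1 : (p : WittVector p k) ^ n • y ∈ (subP F).range := by
    rw [← (bas p k L).sum_repr y, Finset.smul_sum]
    refine sum_mem fun i _ => ?_
    have h2 : v i ≤ n := (Finset.single_le_sum (fun _ _ => Nat.zero_le _) (Finset.mem_univ i)).trans hn
    obtain ⟨d, rfl⟩ := Nat.exists_eq_add_of_le h2
    rw [← mul_smul, pow_add, mul_assoc]
    exact hv i _
  exact h1

/-- The dual argument: the forms `l_i = σ⁻ⁱ ∘ l ∘ Fⁱ` are linear and satisfy a relation, and on a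
solution of `F x = p x` one has `l_i x = p^i σ⁻ⁱ (l x)`. -/
theorem exists_dual_relation (F : L →ₛₗ[sigma p k] L) (l : Module.Dual (WittVector p k) L) :
    ∃ (r : ℕ) (a : ℕ → WittVector p k), (∃ i ≤ r, a i ≠ 0) ∧
      ∀ x, F x = (p : WittVector p k) • x → sigmaOp r a (l x) = 0 := by
  let r := Module.finrank (WittVector p k) (Module.Dual (WittVector p k) L)
  let next : Module.Dual (WittVector p k) L → Module.Dual (WittVector p k) L := fun l =>
    { toFun := fun x => sigmaInv p k (l (F x))
      map_add' := fun x y => by simp only [map_add]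
      map_smul' := fun c x => by
        simp only [map_smulₛₗ, smul_eq_mul, map_mul, sigmaInv_sigma, RingHom.id_apply] }
  have hnext : ∀ l x, next l x = sigmaInv p k (l (F x)) := fun _ _ => rfl
  have hdep : ¬ LinearIndependent (WittVector p k) (fun i : Fin (r + 1) => next^[i] l) := by
    intro h
    have := h.fintype_card_le_finrank
    rw [Fintype.card_fin] at this
    omega
  obtain ⟨g, hg, i, hi⟩ := Fintype.not_linearIndependent_iff.1 hdep
  refine ⟨r, fun i => if hi : i < r + 1 then g ⟨i, hi⟩ * (p : WittVector p k) ^ i else 0,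
    ⟨i, Nat.lt_succ_iff.1 i.2, ?_⟩, fun x hx => ?_⟩
  · simp only [i.2, dif_pos]
    exact mul_ne_zero hi (pow_ne_zero _ (WittVector.p_nonzero p k))
  · have hval : ∀ i : ℕ, (next^[i] l) x = (p : WittVector p k) ^ i * (sigmaInv p k)^[i] (l x) := by
      intro i
      induction i with
      | zero => simp
      | succ i ih =>
        rw [Function.iterate_succ_apply', hnext, hx, map_smul, ih, smul_eq_mul, map_mul, map_mul,
          map_pow, map_natCast, Function.iterate_succ_apply', pow_succ', mul_assoc]
    have h1 := LinearMap.congr_fun hg x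
    rw [LinearMap.sum_apply] at h1
    rw [sigmaOp_apply, Finset.sum_range]
    refine Eq.trans (Finset.sum_congr rfl fun j _ => ?_) h1
    simp only [j.2, dif_pos]
    rw [LinearMap.smul_apply, hval, smul_eq_mul, mul_assoc]

/-- The solutions of `F x = p x` are finite in number modulo `p ^ n`. -/
theorem finite_trunc_image (F : L →ₛₗ[sigma p k] L) (n : ℕ) :
    (trunc p k n '' {x : L | F x = (p : WittVector p k) • x}).Finite := by
  have h : ∀ i, ∃ C : Set (ℕ → k), C.Finite ∧ ∀ x : L, F x = (p : WittVector p k) • x →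
      (fun j => if j < n then ((bas p k L).coord i x).coeff j else 0) ∈ C := by
    intro i
    obtain ⟨r, a, ha, h⟩ := exists_dual_relation F ((bas p k L).coord i)
    obtain ⟨E, hE, hE'⟩ := finite_ker_sigmaOp r a ha n
    refine ⟨(fun e j => if j < n then e.coeff j else 0) '' E, hE.image _, fun x hx => ?_⟩
    obtain ⟨e, he, hc⟩ := hE' _ (h x hx)
    refine ⟨e, he, funext fun j => ?_⟩
    dsimp only
    split_ifs with hj
    · exact (coeff_eq_iff_sub_mem.2 hc j hj).symm
    · rfl
  choose C hC hC' using h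
  refine ((Set.Finite.pi' hC).image (ofCoords p k)).subset ?_
  rintro _ ⟨x, hx, rfl⟩
  exact ⟨_, fun i => hC' i x hx, rfl⟩

end Crystal

end QuasiAlg
end

noncomputable section
namespace QuasiAlg

/-! ### Norms and interpolation -/

section Norm

variable {k : Type u} [Field k] {G : Type v}

theorem exists_interpolation (S : Subalgebra k (G → k)) (x : G) (E : Finset G)
    (h : ∀ y ∈ E, ∃ f ∈ S, f x ≠ f y) : ∃ e ∈ S, e x = 1 ∧ ∀ y ∈ E, e y = 0 := by
  classical
  induction E using Finset.induction_on with
  | empty => exact ⟨1, S.one_mem, rfl, by simp⟩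
  | insert y E _ ih =>
    obtain ⟨e, heS, hx, hE⟩ := ih fun z hz => h z (Finset.mem_insert_of_mem hz)
    obtain ⟨f, hfS, hf⟩ := h y (Finset.mem_insert_self y E)
    refine ⟨(f x - f y)⁻¹ • ((f - algebraMap k _ (f y)) * e),
      S.smul_mem (S.mul_mem (S.sub_mem hfS (S.algebraMap_mem _)) heS) _, ?_, ?_⟩
    · simp [hx, inv_mul_cancel₀ (sub_ne_zero.2 hf)]
    · intro z hz
      rcases Finset.mem_insert.1 hz with rfl | hz
      · simp
      · simp [hE z hz]

variable [AddCommGroup G]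

/-- A norm over `H` is then a product of `p ^ j` factors, which extraction of a `p ^ j`-th root can
undo. -/
theorem card_eq_pow_of_nsmul_eq_zero (p : ℕ) [Fact p.Prime] (H : AddSubgroup G) [Finite H] {n : ℕ}
    (h : ∀ x ∈ H, p ^ n • x = 0) : ∃ j, Nat.card H = p ^ j := by
  have hp : IsPGroup p (Multiplicative H) := fun x =>
    ⟨n, Multiplicative.toAdd.injective (Subtype.ext (h _ (Multiplicative.toAdd x).2))⟩
  have : Finite (Multiplicative H) := ‹Finite H›
  exact (IsPGroup.iff_card (G := Multiplicative H)).1 hp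

/-- An invariant function with a power equal to the norm of `h`. -/
theorem exists_invariant_root [IsAlgClosed k] (p : ℕ) [Fact p.Prime] [CharP k p]
    (H : AddSubgroup G) [Fintype H] {j : ℕ} (hj : Nat.card H = p ^ j) (h : G → k) :
    ∃ f : G → k, (f ^ p ^ j = fun x => ∏ t : H, h (x + t)) ∧ (∀ x, ∀ t ∈ H, f (x + t) = f x) ∧
      ∀ x c, (∀ t ∈ H, h (x + t) = c) → f x = c := by
  have hroot : ∀ y : k, ∃ z, z ^ p ^ j = y := fun y => (iterateFrobeniusEquiv k p j).surjective y
  choose r hr using hroot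
  have hinj : ∀ a b : k, a ^ p ^ j = b ^ p ^ j → a = b := fun a b h => iterateFrobenius_inj k p j h
  refine ⟨fun x => r (∏ t : H, h (x + t)), funext fun x => hr _, fun x t ht => ?_,
    fun x c hc => ?_⟩
  · dsimp only
    congr 1
    refine Fintype.prod_equiv (Equiv.addLeft (⟨t, ht⟩ : H)) _ _ fun s => ?_
    simp [add_assoc]
  · apply hinj
    dsimp only
    rw [hr, Finset.prod_congr rfl fun (t : H) _ => hc t t.2, Finset.prod_const, Finset.card_univ,
      ← Nat.card_eq_fintype_card, hj]

end Norm

variable {p : ℕ} [Fact p.Prime] {k : Type u} [Field k] [CharP k p] [IsAlgClosed k]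

/-- Elementary divisors of the range of `F`, which is a submodule because `τ` is surjective. -/
theorem exists_smith_basis {L : Type v} [AddCommGroup L] [Module (WittVector p k) L]
    {L' : Type w} [AddCommGroup L'] [Module (WittVector p k) L']
    [Module.Free (WittVector p k) L'] [Module.Finite (WittVector p k) L']
    {τ : WittVector p k →+* WittVector p k} [RingHomSurjective τ]
    (F : L →ₛₗ[τ] L') :
    ∃ (n : ℕ) (b : Module.Basis (Module.Free.ChooseBasisIndex (WittVector p k) L')
      (WittVector p k) L') (f : Fin n ↪ Module.Free.ChooseBasisIndex (WittVector p k) L')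
      (a : Fin n → WittVector p k) (x : Fin n → L), (∀ j, F (x j) = a j • b (f j)) ∧
      ∀ y, ∃ β : Fin n → WittVector p k, F y = ∑ j, β j • a j • b (f j) := by
  obtain ⟨n, bM, bN, f, a, snf⟩ := Submodule.smithNormalForm (bas p k L') (LinearMap.range F)
  have hx : ∀ j, ∃ x, F x = bN j := fun j => LinearMap.mem_range.1 (bN j).2
  choose x hx using hx
  refine ⟨n, bM, f, a, x, fun j => (hx j).trans (snf j), fun y => ?_⟩
  have hy : F y ∈ LinearMap.range F := LinearMap.mem_range_self F y
  refine ⟨fun j => bN.repr ⟨F y, hy⟩ j, ?_⟩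
  have h1 := congrArg Subtype.val (bN.sum_repr ⟨F y, hy⟩)
  refine h1.symm.trans ?_
  rw [Submodule.coe_sum]
  refine Finset.sum_congr rfl fun j _ => ?_
  rw [Submodule.coe_smul, snf]

/-- A semilinear map has a semilinear section modulo `p` over its image. -/
theorem exists_section_mod_p {L : Type v} [AddCommGroup L] [Module (WittVector p k) L]
    {L' : Type w} [AddCommGroup L'] [Module (WittVector p k) L']
    [Module.Free (WittVector p k) L'] [Module.Finite (WittVector p k) L']
    {τ τ' : WittVector p k →+* WittVector p k} (hτ : ∀ a, τ (τ' a) = a)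
    (F : L →ₛₗ[τ] L') :
    ∃ s : L' →ₛₗ[τ'] L, ∀ y, ∃ c, F (s (F y)) = F y + (p : WittVector p k) • c := by
  have : RingHomSurjective τ := ⟨fun a => ⟨_, hτ a⟩⟩
  obtain ⟨n, bM, f, a, x, hx, hβ⟩ := exists_smith_basis F
  -- `Ring.inverse` is `0` on non-units, so `s` inverts `F` only along basis vectors whose
  -- elementary divisor is a unit. The remaining part of the image of `F` is divisible by `p`.
  obtain ⟨s, hs⟩ : ∃ s : L' →ₛₗ[τ'] L,
      ∀ u, s u = ∑ j, τ' (bM.coord (f j) u * Ring.inverse (a j)) • x j :=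
    ⟨{ toFun := fun u => ∑ j, τ' (bM.coord (f j) u * Ring.inverse (a j)) • x j
       map_add' := fun u v => by
        simp only [map_add, add_mul, add_smul, Finset.sum_add_distrib]
       map_smul' := fun c u => by
        simp only [map_smul, smul_eq_mul, mul_assoc, map_mul, mul_smul, Finset.smul_sum] },
      fun _ => rfl⟩
  have hFs : ∀ u, F (s u) = ∑ j, (bM.coord (f j) u * (Ring.inverse (a j) * a j)) • bM (f j) := by
    intro u
    rw [hs, map_sum]
    refine Finset.sum_congr rfl fun j _ => ?_
    rw [map_smulₛₗ, hτ, hx, smul_smul, mul_assoc]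
  refine ⟨s, fun y => ?_⟩
  obtain ⟨β, hβ⟩ := hβ y
  have hdiv : ∀ j, ∃ c, a j * (Ring.inverse (a j) * a j) = a j + p * c := by
    intro j
    by_cases hu : IsUnit (a j)
    · exact ⟨0, by rw [Ring.inverse_mul_cancel _ hu]; simp⟩
    · have h0 : (a j).coeff 0 = 0 := by
        by_contra h0
        exact hu (WittVector.isUnit_of_coeff_zero_ne_zero _ h0)
      obtain ⟨c, hc⟩ := p_dvd_iff_coeff_zero.2 h0
      exact ⟨-c, by rw [Ring.inverse_non_unit _ hu, hc]; ring⟩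
  choose c hc using hdiv
  refine ⟨∑ j, (β j * c j) • bM (f j), ?_⟩
  classical
  rw [hFs, Finset.smul_sum, hβ, ← Finset.sum_add_distrib]
  refine Finset.sum_congr rfl fun j _ => ?_
  have h1 : bM.coord (f j) (∑ i, β i • a i • bM (f i)) = β j * a j := by
    rw [map_sum, Finset.sum_eq_single j]
    · simp
    · intro i _ hij
      simp [f.injective.ne hij]
    · simp
  rw [h1, smul_smul, smul_smul, ← add_smul, mul_assoc, hc, mul_add, mul_left_comm]

/-! ### Regular functions across the relation `F x - p x = p ^ (n + 1) z` -/

section Snake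

variable {L : Type v} [AddCommGroup L] [Module (WittVector p k) L]
  [Module.Free (WittVector p k) L] [Module.Finite (WittVector p k) L]
  (F : L →ₛₗ[sigma p k] L)

theorem pow_smul_cancel {n : ℕ} {x y : L}
    (h : (p : WittVector p k) ^ n • x = (p : WittVector p k) ^ n • y) : x = y :=
  smul_right_injective L (pow_ne_zero n (WittVector.p_nonzero p k)) h

theorem LReg.subP {X : Type w} {S : Subalgebra k (X → k)} {m : ℕ} {h : X → L}
    (H : LReg p S m h) : LReg p S m (fun x => QuasiAlg.subP F (h x)) := by
  simp only [subP_apply]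
  exact (H.semilinear F).sub (H.smul _)

/-- Invariance under the image of `F / p - 1`. -/
def IsSubPInvariant (φ : L → k) : Prop :=
  ∀ z y w : L, F y = (p : WittVector p k) • w → φ (z + (w - y)) = φ z

/-- The element `z` depends on `x` and not only on `x` modulo `p ^ n`, so a lift has to be chosen
regularly. The truncation is `x + p^n y` for some `y`, and `F - p` maps it only into `p^n L`.
Subtracting `p^n u`, with `u` the value at `p^(-n) (F - p) (x + p^n y)` of a section of `F` modulo
`p`, gains the missing factor `p`. The new quotient is `z + (F/p - 1) (y - u)`, which `φ` does not
distinguish from `z`. -/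
theorem exists_regular_of_isSubPInvariant (n : ℕ) {φ : L → k}
    (hφ : φ ∈ regFun p k L) (hB : IsSubPInvariant F φ) :
    ∃ g ∈ regFun p k L, (∀ x y, x - y ∈ pPow p k L n → g x = g y) ∧
      ∀ x z, subP F x = (p : WittVector p k) ^ (n + 1) • z → g x = φ z := by
  obtain ⟨s, hs⟩ := exists_section_mod_p (τ' := sigmaInv p k) sigma_sigmaInv F
  let uu : L → L := fun x => s ((divP p k)^[n] (subP F (trunc p k n x)))
  let xx : L → L := fun x => trunc p k n x - (p : WittVector p k) ^ n • uu x
  have hO : IsPerfectAlg p (regFun p k L) := regular_isPerfectAlg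
  have ht : ∀ m, LReg p (regFun p k L) m (trunc p k n : L → L) := fun m l i hi =>
    polyFun_le_regular n (lreg_trunc n m l i hi)
  have hu : ∀ m, LReg p (regFun p k L) m uu := fun m =>
    LReg.semilinearInv hO (LReg.divP_iterate hO (fun m => (ht m).subP F) n m) s
  refine ⟨fun x => φ ((divP p k)^[n + 1] (subP F (xx x))), ?_, ?_, ?_⟩
  · exact comp_mem_of_mem_regular hO (fun m => LReg.divP_iterate hO
      (fun m => LReg.subP F ((ht m).sub ((hu m).smul _))) (n + 1) m) hφ
  · intro x y hxy
    simp only [xx, uu, trunc_congr hxy]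
  · intro x z hxz
    obtain ⟨y, hy⟩ := mem_pPow.1 (trunc_sub_mem (p := p) (k := k) n x)
    have ht : trunc p k n x = x + (p : WittVector p k) ^ n • y := by rw [← hy]; abel
    have h1 : subP F (trunc p k n x) =
        (p : WittVector p k) ^ n • (F y + (p : WittVector p k) • (z - y)) := by
      rw [ht, map_add, subP_smul_natCast, hxz, subP_apply, pow_succ, mul_smul, ← smul_add, smul_sub]
      congr 1
      abel
    have h2 : uu x = s (F y + (p : WittVector p k) • (z - y)) := by
      simp only [uu, h1, divP_iterate_smul]
    obtain ⟨c, hc⟩ := hs y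
    have h3 : F (uu x) = F y + (p : WittVector p k) • (c + F (s (z - y))) := by
      rw [h2, map_add, map_add, hc, map_smulₛₗ, map_smulₛₗ, map_natCast, map_natCast, smul_add,
        add_assoc]
    have h4 : subP F (xx x) = (p : WittVector p k) ^ (n + 1) •
        (z - y + uu x - (c + F (s (z - y)))) := by
      change subP F (trunc p k n x - (p : WittVector p k) ^ n • uu x) = _
      rw [map_sub, h1, subP_smul_natCast, subP_apply, h3, pow_succ, mul_smul, ← smul_sub]
      congr 1
      simp only [smul_sub, smul_add]
      abel
    dsimp only
    rw [h4, divP_iterate_smul]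
    have h5 : F (y - uu x) = (p : WittVector p k) • (-(c + F (s (z - y)))) := by
      rw [map_sub, h3, smul_neg]
      abel
    rw [← hB z _ _ h5]
    congr 1
    abel

/-- The solutions of `F x = p x`. -/
abbrev kerP : AddSubgroup L := (subP F).ker

theorem finite_map_kerP (n : ℕ) :
    Finite ((kerP F).map (pPow p k L n).mkQ.toAddMonoidHom) := by
  have h := (finite_trunc_image F n).image (pPow p k L n).mkQ
  refine Set.Finite.to_subtype (h.subset ?_)
  rintro _ ⟨x, hx, rfl⟩
  refine ⟨trunc p k n x, ⟨x, sub_eq_zero.1 hx, rfl⟩, ?_⟩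
  exact (Submodule.Quotient.eq _).2 (trunc_sub_mem (p := p) (k := k) n x)

theorem mkQ_eq_iff {n : ℕ} {x y : L} :
    (pPow p k L n).mkQ x = (pPow p k L n).mkQ y ↔ x - y ∈ pPow p k L n :=
  Submodule.Quotient.eq _

/-- A regular function on `L / p ^ n` which is invariant under solutions of `F x = p x` on the
solutions of `F x = p x` modulo `p ^ (n + 1)` comes by multiplication by `p ^ d` from a regular
function on `L / p ^ (n + d)` which is invariant under solutions of `F x = p x`. -/
theorem exists_invariant_extension (n d : ℕ) {g : L → k} (hg : g ∈ regFun p k L)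
    (hgn : ∀ x y, x - y ∈ pPow p k L n → g x = g y)
    (hgK : ∀ x, subP F x ∈ pPow p k L (n + 1) → ∀ κ ∈ kerP F, g (x + κ) = g x) :
    ∃ f ∈ regFun p k L, (∀ x y, x - y ∈ pPow p k L (n + d) → f x = f y) ∧
      (∀ x, ∀ κ ∈ kerP F, f (x + κ) = f x) ∧
      ∀ x, subP F x ∈ pPow p k L (n + 1) → f ((p : WittVector p k) ^ d • x) = g x := by
  classical
  have hO : IsPerfectAlg p (regFun p k L) := regular_isPerfectAlg
  -- representatives of the solutions modulo `p ^ d`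
  have := finite_map_kerP F d
  have hrep : ∀ c : (kerP F).map (pPow p k L d).mkQ.toAddMonoidHom,
      ∃ κ ∈ kerP F, (pPow p k L d).mkQ κ = c := fun c => c.2
  choose rep hrepK hrep using hrep
  have := Fintype.ofFinite ((kerP F).map (pPow p k L d).mkQ.toAddMonoidHom)
  -- Functions of level `d` which are indicator functions on the finite set of solutions modulo `p ^
  -- d`.
  have hsep : ∀ c, ∃ e ∈ polyFun p k L d, e (rep c) = 1 ∧
      ∀ y ∈ (Finset.univ.erase c).image rep, e y = 0 := by
    intro c
    refine exists_interpolation _ _ _ fun y hy => ?_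
    obtain ⟨c', hc', rfl⟩ := Finset.mem_image.1 hy
    by_contra hcon
    push Not at hcon
    apply (Finset.mem_erase.1 hc').1
    apply Subtype.ext
    rw [← hrep, ← hrep, mkQ_eq_iff, sub_mem_pPow_iff]
    intro i j hj
    exact (hcon (fun x => ((bas p k L).coord i x).coeff j)
      (Algebra.subset_adjoin ⟨_, j, hj, rfl⟩)).symm
  choose e he he1 he0 using hsep
  -- At `p^d x + κ` with `κ` a solution, only the term of the class of `κ` survives, and division by
  -- `p ^ d` returns `x` up to a solution.
  let h : L → k := fun x => ∑ c, e c x * g ((divP p k)^[d] (x - rep c))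
  have hh : h ∈ regFun p k L := by
    have : h = ∑ c, e c * fun x => g ((divP p k)^[d] (x - rep c)) := by
      funext x
      simp [h]
    rw [this]
    exact sum_mem fun c _ => mul_mem (polyFun_le_regular d (he c)) (comp_mem_of_mem_regular hO
      (fun m => LReg.divP_iterate hO (fun m => (lreg_id_regular m).sub (LReg.const _)) d m) hg)
  have hhN : ∀ x y, x - y ∈ pPow p k L (n + d) → h x = h y := by
    intro x y hxy
    refine Finset.sum_congr rfl fun c _ => ?_
    rw [polyFun_congr (he c) (pPow_anti (Nat.le_add_left d n) hxy)]
    congr 1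
    refine hgn _ _ (divP_iterate_congr ?_)
    rwa [sub_sub_sub_cancel_right]
  have hhval : ∀ x, subP F x ∈ pPow p k L (n + 1) → ∀ κ ∈ kerP F,
      h ((p : WittVector p k) ^ d • x + κ) = g x := by
    intro x hx κ hκ
    let c : (kerP F).map (pPow p k L d).mkQ.toAddMonoidHom := ⟨_, κ, hκ, rfl⟩
    obtain ⟨κ', hκ'⟩ := mem_pPow.1 (mkQ_eq_iff.1 (hrep c).symm)
    have hK' : κ' ∈ kerP F := by
      refine pow_smul_cancel (p := p) (k := k) (n := d) ?_
      rw [← subP_smul_natCast, ← hκ', map_sub, smul_zero, sub_eq_zero]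
      exact (show subP F κ = 0 from hκ).trans (show subP F (rep c) = 0 from hrepK c).symm
    have hcong : ∀ c', e c' ((p : WittVector p k) ^ d • x + κ) = e c' (rep c) := by
      intro c'
      refine polyFun_congr (he c') (mem_pPow.2 ⟨x + κ', ?_⟩)
      rw [smul_add, ← hκ', add_sub_assoc]
    change ∑ c', e c' ((p : WittVector p k) ^ d • x + κ) * _ = g x
    rw [Finset.sum_eq_single c]
    · rw [hcong, he1, one_mul, add_sub_assoc, hκ', ← smul_add, divP_iterate_smul, hgK x hx κ' hK']
    · intro c' _ hc'
      rw [hcong, he0 c' (rep c) (Finset.mem_image_of_mem _ (Finset.mem_erase.2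
        ⟨hc'.symm, Finset.mem_univ _⟩)), zero_mul]
    · intro hc
      exact absurd (Finset.mem_univ c) hc
  -- the norm over the solutions modulo `p ^ (n + d)`
  let K := (kerP F).map (pPow p k L (n + d)).mkQ.toAddMonoidHom
  have hKfin : Finite K := finite_map_kerP F (n + d)
  have := Fintype.ofFinite K
  obtain ⟨j, hj⟩ := card_eq_pow_of_nsmul_eq_zero p K (n := n + d) (by
    rintro _ ⟨x, _, rfl⟩
    refine (Submodule.Quotient.mk_eq_zero _).2 (mem_pPow.2 ⟨x, ?_⟩)
    rw [← Nat.cast_pow, Nat.cast_smul_eq_nsmul])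
  let hbar : L ⧸ pPow p k L (n + d) → k := fun q => h q.out
  have hbar_mk : ∀ x, hbar ((pPow p k L (n + d)).mkQ x) = h x := fun x =>
    hhN _ _ (mkQ_eq_iff.1 (Quotient.out_eq' _))
  obtain ⟨f, hfpow, hfinv, hfval⟩ := exists_invariant_root p K hj hbar
  refine ⟨fun x => f ((pPow p k L (n + d)).mkQ x), ?_, ?_, ?_, ?_⟩
  · refine hO.mem_of_pow (m := j) ?_
    have hlift : ∀ t : K, ∃ y : L, (pPow p k L (n + d)).mkQ y = t := fun t =>
      Submodule.mkQ_surjective _ _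
    choose lift hlift using hlift
    have : (fun x => f ((pPow p k L (n + d)).mkQ x)) ^ p ^ j =
        ∏ t : K, fun x => h (x + lift t) := by
      funext x
      have h1 := congrFun hfpow ((pPow p k L (n + d)).mkQ x)
      rw [Pi.pow_apply] at h1 ⊢
      rw [h1, Finset.prod_apply]
      refine Finset.prod_congr rfl fun t _ => ?_
      rw [← hlift, ← map_add, hbar_mk]
    rw [this]
    exact prod_mem fun t _ => regular_translate hh _
  · intro x y hxy
    dsimp only
    rw [mkQ_eq_iff.2 hxy]
  · intro x κ hκ
    dsimp only
    rw [map_add]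
    exact hfinv _ _ ⟨κ, hκ, rfl⟩
  · intro x hx
    refine hfval _ _ ?_
    rintro _ ⟨κ, hκ, rfl⟩
    refine Eq.trans ?_ (hhval x hx κ hκ)
    rw [← hbar_mk, map_add]
    rfl

end Snake

end QuasiAlg
end

noncomputable section
namespace QuasiAlg

variable {p : ℕ} [Fact p.Prime] {k : Type u} [Field k] [CharP k p] [IsAlgClosed k]

/-! ### Descent along `F - p` -/

section Descent

variable {L : Type v} [AddCommGroup L] [Module (WittVector p k) L]
  [Module.Free (WittVector p k) L] [Module.Finite (WittVector p k) L]
  (F : L →ₛₗ[sigma p k] L)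

/-- The restriction of `polyFun p k L m` to a subgroup. -/
abbrev polyFunOn (m : ℕ) (H : AddSubgroup L) : Subalgebra k (H → k) :=
  (polyFun p k L m).map (pullback k (Subtype.val : H → L))

theorem polyFunOn_translate {m : ℕ} {H : AddSubgroup L} {a : H → k}
    (ha : a ∈ polyFunOn (p := p) (k := k) m H) (h : H) : (fun y => a (y + h)) ∈ polyFunOn (p := p) (k := k) m H := by
  obtain ⟨a, ha, rfl⟩ := ha
  exact ⟨_, polyFun_translate ha h.1, rfl⟩

theorem polyFunOn_exists_finiteDimensional {m : ℕ} {H : AddSubgroup L} {a : H → k}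
    (ha : a ∈ polyFunOn (p := p) (k := k) m H) : ∃ E : Submodule k (H → k), FiniteDimensional k E ∧
      E ≤ (polyFunOn (p := p) (k := k) m H).toSubmodule ∧ ∀ h : H, (fun x => a (x + h)) ∈ E := by
  obtain ⟨a, ha, rfl⟩ := ha
  obtain ⟨E, hE, hEle, hmem⟩ := exists_finiteDimensional_of_mem_sup (polyFun_add_mem ha)
  refine ⟨E.map (pullback k (Subtype.val : H → L)).toLinearMap, inferInstance, ?_, fun h => ?_⟩
  · rintro _ ⟨e, he, rfl⟩
    exact ⟨e, hEle he, rfl⟩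
  · exact ⟨_, hmem h.1, rfl⟩

theorem polyFunOn_pPow_hasPoints {m N : ℕ} (hN : N ≤ m) :
    HasPoints (polyFunOn (p := p) (k := k) m (pPow p k L N).toAddSubgroup) := by
  refine (polyFun_hasPoints (p := p) (k := k) (L := L) m).restrict _
    {f | ∃ i, ∃ j < N, f = fun x => ((bas p k L).coord i x).coeff j} ?_ ?_ ?_
  · rintro _ ⟨i, j, hj, rfl⟩
    exact Algebra.subset_adjoin ⟨_, j, hj.trans_le hN, rfl⟩
  · intro x hx
    change x ∈ pPow p k L N
    rw [← sub_zero x, sub_mem_pPow_iff]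
    intro i j hj
    rw [map_zero, WittVector.zero_coeff]
    exact hx _ ⟨i, j, hj, rfl⟩
  · rintro x hx _ ⟨i, j, hj, rfl⟩
    have hx' : x - 0 ∈ pPow p k L N := by rw [sub_zero]; exact hx
    have h1 := sub_mem_pPow_iff.1 hx' i j hj
    rwa [map_zero, WittVector.zero_coeff] at h1

theorem polyFunOn_comap_hasPoints {m N : ℕ} (hN : N ≤ m) :
    HasPoints (polyFunOn (p := p) (k := k) m ((pPow p k L N).toAddSubgroup.comap (subP F))) := by
  refine (polyFun_hasPoints (p := p) (k := k) (L := L) m).restrict _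
    {f | ∃ i, ∃ j < N, f = fun x => ((bas p k L).coord i (subP F x)).coeff j} ?_ ?_ ?_
  · rintro _ ⟨i, j, hj, rfl⟩
    exact (lreg_id m).subP F ((bas p k L).coord i) j (hj.trans_le hN)
  · intro x hx
    change subP F x ∈ pPow p k L N
    rw [← sub_zero (subP F x), sub_mem_pPow_iff]
    intro i j hj
    rw [map_zero, WittVector.zero_coeff]
    exact hx _ ⟨i, j, hj, rfl⟩
  · rintro x hx _ ⟨i, j, hj, rfl⟩
    have hx' : subP F x - 0 ∈ pPow p k L N := by rw [sub_zero]; exact hx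
    have h1 := sub_mem_pPow_iff.1 hx' i j hj
    rwa [map_zero, WittVector.zero_coeff] at h1

/-- Pull-back along `z ↦ p ^ N z` embeds these functions into the domain of functions on `L`. -/
theorem polyFunOn_pPow_isDomain (m N : ℕ) :
    IsDomain (polyFunOn (p := p) (k := k) m (pPow p k L N).toAddSubgroup) := by
  have : Infinite k := IsAlgClosed.instInfinite
  let μ : L → (pPow p k L N).toAddSubgroup := fun z => ⟨(p : WittVector p k) ^ N • z, z, rfl⟩
  have hμ : Function.Surjective μ := by
    rintro ⟨_, z, rfl⟩
    exact ⟨z, rfl⟩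
  let r : polyFunOn (p := p) (k := k) m (pPow p k L N).toAddSubgroup →ₐ[k] polyFun p k L m :=
    ((pullback k μ).comp (Subalgebra.val _)).codRestrict _ (by
      rintro ⟨_, a, ha, rfl⟩
      exact comp_mem_of_mem_polyFun ((lreg_id m).smul _) ha)
  refine Function.Injective.isDomain r.toRingHom ?_
  intro a b hab
  apply Subtype.ext
  funext y
  obtain ⟨z, rfl⟩ := hμ y
  exact congrFun (congrArg Subtype.val hab) z

/-- A function on the cokernel of `F - p` on which `p ^ (N + 1)` is zero is regular as soon as its
pull-back to the solutions of `F x = p x + p ^ (N + 1) z` is. -/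
theorem regular_of_comp_subP {N : ℕ}
    (hN : ∀ y : L, ∃ x, subP F x = (p : WittVector p k) ^ (N + 1) • y)
    {f : L → k} (hf : f ∈ regFun p k L)
    (hfN : ∀ x y, x - y ∈ pPow p k L N → f x = f y) {φ : L → k}
    (hφN : ∀ x y, x - y ∈ pPow p k L N → φ x = φ y)
    (hφ : ∀ x z, subP F x = (p : WittVector p k) ^ (N + 1) • z → φ z = f x) :
    φ ∈ regFun p k L := by
  obtain ⟨e, he⟩ := exists_pow_mem_polyFun hf hfN
  -- As `φ` is constant modulo `p ^ N`, its value at `z` is determined by `p ^ (N+1) z` modulo `p ^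
  -- (N+1+N)`; this level makes the functions on `Y` fine enough for the descent.
  let m := N + 1 + N
  let Y := (pPow p k L (N + 1)).toAddSubgroup
  let X := Y.comap (subP F)
  have hXf : ∀ y : Y, ∃ z, y.1 = (p : WittVector p k) ^ (N + 1) • z := fun y => mem_pPow.1 y.2
  have := polyFunOn_pPow_isDomain (p := p) (k := k) (L := L) m (N + 1)
  have hm : N + 1 ≤ m := Nat.le_add_right _ _
  let ψ : Y → k := fun y => φ ((divP p k)^[N + 1] y.1) ^ p ^ e
  have hψ : ∀ (y : Y) z, y.1 = (p : WittVector p k) ^ (N + 1) • z → ψ y = φ z ^ p ^ e := by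
    intro y z hz
    simp only [ψ, hz, divP_iterate_smul]
  obtain ⟨q, a, ha, hq⟩ := exists_pow_mem_of_comp_mem (k := k) p (polyFunOn (p := p) (k := k) m X)
    (polyFunOn (p := p) (k := k) m Y) ((polyFun_fg m).map _) (polyFunOn_comap_hasPoints F hm)
    ((polyFun_fg m).map _) (polyFunOn_pPow_hasPoints hm)
    (fun a ha h => polyFunOn_translate ha h)
    (fun a ha => polyFunOn_exists_finiteDimensional ha)
    ((subP F).addSubgroupComap Y) (by
      intro y
      obtain ⟨z, hz⟩ := hXf y
      obtain ⟨x, hx⟩ := hN z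
      refine ⟨⟨x, ?_⟩, Subtype.ext (hx.trans hz.symm)⟩
      change subP F x ∈ Y
      rw [hx, ← hz]
      exact y.2)
    (by
      rintro _ ⟨a, ha, rfl⟩
      exact ⟨_, comp_mem_of_mem_polyFun ((lreg_id m).subP F) ha, rfl⟩)
    ψ
    (by
      refine ⟨f ^ p ^ e, polyFun_mono (by omega) he, ?_⟩
      funext x
      obtain ⟨z, hz⟩ := hXf ((subP F).addSubgroupComap Y x)
      rw [hψ _ z hz, hφ x.1 z hz]
      rfl)
    (by
      intro y y' hyy
      obtain ⟨z, hz⟩ := hXf y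
      obtain ⟨z', hz'⟩ := hXf y'
      rw [hψ y z hz, hψ y' z' hz', hφN z z']
      have h1 : y.1 - y'.1 ∈ pPow p k L m := sub_mem_pPow_iff.2 fun i j hj =>
        hyy _ ⟨_, Algebra.subset_adjoin ⟨(bas p k L).coord i, j, hj, rfl⟩, rfl⟩
      rw [hz, hz'] at h1
      obtain ⟨c, hc⟩ := mem_pPow.1 h1
      have hc' : (p : WittVector p k) ^ (N + 1) • (z - z') =
          (p : WittVector p k) ^ (N + 1) • (p : WittVector p k) ^ N • c := by
        rw [smul_sub, hc, ← mul_smul, ← pow_add]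
      exact mem_pPow.2 ⟨c, pow_smul_cancel hc'⟩)
  refine (regular_isPerfectAlg (p := p) (k := k) (L := L)).mem_of_pow (m := e + q) ?_
  have h1 : φ ^ p ^ (e + q) = fun z => a ((p : WittVector p k) ^ (N + 1) • z) := by
    funext z
    have hz : (p : WittVector p k) ^ (N + 1) • z ∈ Y := mem_pPow.2 ⟨z, rfl⟩
    have h2 := congrFun hq ⟨_, hz⟩
    rw [Pi.pow_apply, hψ ⟨_, hz⟩ z rfl, ← pow_mul, ← pow_add] at h2
    exact h2.symm
  rw [h1]
  exact polyFun_le_regular m (comp_mem_of_mem_polyFun ((lreg_id m).smul _) ha)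

/-- Not every `z` satisfies `p^(n+1) z = (F - p) x` for some `x`, but with `p^d` killing the
cokernel, `p^(n+d+1) z` is always `(F - p) (sol z)`. Extend `g` to `f` of level `n + d` with `f (p^d
x) = g x`, and take `φ z = f (sol z)`. Invariance of `f` under `ker (F - p)` makes the choice of
`sol` immaterial. -/
theorem exists_isSubPInvariant_of_regular (n : ℕ) {g : L → k} (hg : g ∈ regFun p k L)
    (hgn : ∀ x y, x - y ∈ pPow p k L n → g x = g y)
    (hgK : ∀ x, subP F x ∈ pPow p k L (n + 1) → ∀ κ ∈ kerP F, g (x + κ) = g x) :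
    ∃ φ ∈ regFun p k L, IsSubPInvariant F φ ∧
      ∀ x z, subP F x = (p : WittVector p k) ^ (n + 1) • z → φ z = g x := by
  obtain ⟨d, hd⟩ := exists_pow_smul_mem_range_subP F
  have hN := hd (n + d + 1) (by omega)
  obtain ⟨f, hf, hfN, hfK, hfg⟩ := exists_invariant_extension F n d hg hgn hgK
  choose sol hsol using hN
  have hφ : ∀ x z, subP F x = (p : WittVector p k) ^ (n + d + 1) • z → f (sol z) = f x := by
    intro x z hxz
    have h1 : sol z - x ∈ kerP F := by
      change subP F (sol z - x) = 0
      rw [map_sub, hsol, hxz, sub_self]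
    rw [← hfK x _ h1, add_sub_cancel]
  have hinv : IsSubPInvariant F (fun z => f (sol z)) := by
    intro z y w hyw
    dsimp only
    have h1 : subP F (sol z + (p : WittVector p k) ^ (n + d) • y) =
        (p : WittVector p k) ^ (n + d + 1) • (z + (w - y)) := by
      rw [map_add, subP_smul_natCast, hsol, subP_apply, hyw, ← smul_sub, ← mul_smul, ← pow_succ,
        ← smul_add]
    rw [hφ _ _ h1]
    exact hfN _ _ (mem_pPow.2 ⟨y, by abel⟩)
  -- `p^(n+d) c` equals `(F/p - 1) (sol c)`, so invariance of `φ` already contains its level.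
  have hinvN : ∀ x y, x - y ∈ pPow p k L (n + d) → f (sol x) = f (sol y) := by
    intro x y hxy
    obtain ⟨c, hc⟩ := mem_pPow.1 hxy
    have h1 : F (sol c) = (p : WittVector p k) • (sol c + (p : WittVector p k) ^ (n + d) • c) := by
      have h2 := hsol c
      rw [subP_apply, pow_succ', mul_smul, sub_eq_iff_eq_add] at h2
      rw [h2, smul_add, add_comm]
    have h3 := hinv y _ _ h1
    rw [add_sub_cancel_left, ← hc, add_sub_cancel] at h3
    exact h3
  refine ⟨fun z => f (sol z), regular_of_comp_subP F (fun y => ⟨sol y, hsol y⟩) hf hfN hinvN hφ,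
    hinv, fun x z hxz => ?_⟩
  rw [← hfg x (mem_pPow.2 ⟨z, hxz⟩)]
  refine hφ _ _ ?_
  rw [subP_smul_natCast, hxz, ← mul_smul, ← pow_add]
  congr 2
  omega

end Descent

end QuasiAlg
end

noncomputable section
namespace QuasiAlg

variable {p : ℕ} [Fact p.Prime] {k : Type u} [Field k] [CharP k p] [IsAlgClosed k]

theorem exists_addEquiv_of_ker_eq {Z : Type*} {T : Type*} {Q : Type*} [AddCommGroup Z]
    [AddCommGroup T] [AddCommGroup Q] (b : Z →+ T) (a : Z →+ Q) (hb : Function.Surjective b)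
    (ha : Function.Surjective a) (h : b.ker = a.ker) : ∃ e : T ≃+ Q, ∀ w, e (b w) = a w := by
  refine ⟨(QuotientAddGroup.quotientKerEquivOfSurjective b hb).symm.trans
    ((QuotientAddGroup.quotientAddEquivOfEq h).trans
      (QuotientAddGroup.quotientKerEquivOfSurjective a ha)), fun w => ?_⟩
  have h1 : (QuotientAddGroup.quotientKerEquivOfSurjective b hb).symm (b w) =
      (w : Z ⧸ b.ker) := by
    rw [AddEquiv.symm_apply_eq]
    rfl
  rw [AddEquiv.trans_apply, h1]
  rfl

/-! ### The `p ^ n`-torsion of `U_L` as a subquotient of `L / p ^ n` -/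

namespace FCrystal

variable (L : FCrystal.{u, v} p k)

theorem mem_range_divF_sub {z : L.carrier} : z ∈ (L.divF - L.nygaard.subtype).range ↔
    ∃ y w, L.F y = (p : WittVector p k) • w ∧ z = w - y := by
  constructor
  · rintro ⟨y, rfl⟩
    exact ⟨y, L.divF y, (L.p_smul_divF y).symm, rfl⟩
  · rintro ⟨y, w, hy, rfl⟩
    refine ⟨⟨y, w, hy⟩, ?_⟩
    have : L.divF ⟨y, w, hy⟩ = w := p_smul_injective (p := p) (k := k)
      ((L.p_smul_divF ⟨y, w, hy⟩).trans hy)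
    rw [AddMonoidHom.sub_apply, this]
    rfl

/-- The class of `z` in `U_L`. -/
def mkU (z : L.carrier) : L.U.carrier :=
  (QuotientAddGroup.mk z : L.carrier ⧸ (L.divF - L.nygaard.subtype).range)

theorem mkU_eq_zero_iff {z : L.carrier} : L.mkU z = 0 ↔
    ∃ y w, L.F y = (p : WittVector p k) • w ∧ z = w - y :=
  (QuotientAddGroup.eq_zero_iff z).trans L.mem_range_divF_sub

theorem mkU_surjective : Function.Surjective L.mkU := QuotientAddGroup.mk_surjective

theorem mkU_add (x y : L.carrier) : L.mkU (x + y) = L.mkU x + L.mkU y := rfl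

theorem mkU_nsmul (m : ℕ) (x : L.carrier) : L.mkU (m • x) = m • L.mkU x := rfl

/-- The pairs `(x, z)` with `F x - p x = p ^ (n + 1) z`. -/
def snake (n : ℕ) : AddSubgroup (L.carrier × L.carrier) where
  carrier := {q | subP L.F q.1 = (p : WittVector p k) ^ (n + 1) • q.2}
  zero_mem' := by simp
  add_mem' {a b} ha hb := by
    change subP L.F (a.1 + b.1) = _ • (a.2 + b.2)
    rw [map_add, smul_add]
    exact congrArg₂ (· + ·) ha hb
  neg_mem' {a} ha := by
    change subP L.F (-a.1) = _ • (-a.2)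
    rw [map_neg, smul_neg]
    exact congrArg Neg.neg ha

theorem pow_smul_eq_nsmul (n : ℕ) (z : L.carrier) :
    (p : WittVector p k) ^ n • z = (p ^ n) • z := by
  rw [← Nat.cast_pow, Nat.cast_smul_eq_nsmul]

theorem mkU_mem_torsion {n : ℕ} {x z : L.carrier}
    (h : subP L.F x = (p : WittVector p k) ^ (n + 1) • z) :
    L.mkU z ∈ (nsmulAddMonoidHom (α := L.U.carrier) (p ^ n)).ker := by
  change (p ^ n) • L.mkU z = 0
  rw [← mkU_nsmul, ← pow_smul_eq_nsmul, mkU_eq_zero_iff]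
  refine ⟨x, x + (p : WittVector p k) ^ n • z, ?_, by abel⟩
  rw [smul_add, ← mul_smul, ← pow_succ', ← h, subP_apply]
  abel

theorem exists_of_mem_torsion {n : ℕ} {z : L.carrier}
    (h : L.mkU z ∈ (nsmulAddMonoidHom (α := L.U.carrier) (p ^ n)).ker) :
    ∃ x, subP L.F x = (p : WittVector p k) ^ (n + 1) • z := by
  have h' : (p ^ n) • L.mkU z = 0 := h
  rw [← mkU_nsmul, ← pow_smul_eq_nsmul, mkU_eq_zero_iff] at h'
  obtain ⟨y, w, hy, hz⟩ := h'
  refine ⟨y, ?_⟩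
  rw [pow_succ', mul_smul, hz, subP_apply, hy, smul_sub]

/-- The group `snake` of pairs surjects onto both sides, through `z` and through `x`. If `z = (F/p -
1) y`, then `x - p^n y` is killed by `F - p`, and conversely; hence the kernels agree. The group `Y`
only has to contain `L / p ^ n` in such a way that regular functions restrict to and extend from it,
which is what `hreg` and `hreg'` express. -/
theorem exists_snake_iso (n : ℕ) (Y : RegGroup.{u, w} k) (A H : AddSubgroup Y.carrier)
    (ρ : L.carrier →+ Y.carrier)
    (hker : ∀ x, ρ x = 0 ↔ x ∈ pPow p k L.carrier n)
    (hA : ∀ y, y ∈ A ↔ ∃ x, subP L.F x ∈ pPow p k L.carrier (n + 1) ∧ ρ x = y)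
    (hH : ∀ y, y ∈ H ↔ ∃ x ∈ kerP L.F, ρ x = y)
    (hreg : ∀ f ∈ Y.regular, (fun x => f (ρ x)) ∈ regFun p k L.carrier)
    (hreg' : ∀ g ∈ regFun p k L.carrier, (∀ x y, x - y ∈ pPow p k L.carrier n → g x = g y) →
      ∃ f ∈ Y.regular, ∀ x, f (ρ x) = g x) :
    ∃ e : RegGroup.Iso (L.U.torsion (p ^ n)) (Y.subquot A H),
      ∀ x z (hx : subP L.F x = (p : WittVector p k) ^ (n + 1) • z) (hxA : ρ x ∈ A),
        e.toAddEquiv ⟨L.mkU z, L.mkU_mem_torsion hx⟩ =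
          (QuotientAddGroup.mk (⟨ρ x, hxA⟩ : A) : A ⧸ H.addSubgroupOf A) := by
  have hmemA : ∀ q : L.snake n, ρ q.1.1 ∈ A := fun q =>
    (hA _).2 ⟨q.1.1, mem_pPow.2 ⟨q.1.2, q.2⟩, rfl⟩
  let a : L.snake n →+ A ⧸ H.addSubgroupOf A :=
    (QuotientAddGroup.mk' (H.addSubgroupOf A)).comp
      ((ρ.comp ((AddMonoidHom.fst _ _).comp (L.snake n).subtype)).codRestrict A hmemA)
  have ha_apply : ∀ q : L.snake n, a q = QuotientAddGroup.mk (⟨ρ q.1.1, hmemA q⟩ : A) :=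
    fun _ => rfl
  let b : L.snake n →+ (L.U.torsion (p ^ n)).carrier :=
    AddMonoidHom.mk' (fun q => ⟨L.mkU q.1.2, L.mkU_mem_torsion q.2⟩)
      (fun q q' => Subtype.ext (L.mkU_add _ _))
  have hb : Function.Surjective b := by
    rintro ⟨t, ht⟩
    obtain ⟨z, rfl⟩ := L.mkU_surjective t
    obtain ⟨x, hx⟩ := L.exists_of_mem_torsion ht
    exact ⟨⟨(x, z), hx⟩, rfl⟩
  have ha : Function.Surjective a := by
    intro t
    obtain ⟨⟨y, hy⟩, rfl⟩ := QuotientAddGroup.mk_surjective t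
    obtain ⟨x, hx, rfl⟩ := (hA y).1 hy
    obtain ⟨z, hz⟩ := mem_pPow.1 hx
    exact ⟨⟨(x, z), hz⟩, rfl⟩
  have hab : b.ker = a.ker := by
    ext ⟨⟨x, z⟩, hxz⟩
    have hxz' : subP L.F x = (p : WittVector p k) ^ (n + 1) • z := hxz
    rw [AddMonoidHom.mem_ker, AddMonoidHom.mem_ker, ha_apply, QuotientAddGroup.eq_zero_iff,
      AddSubgroup.mem_addSubgroupOf, hH]
    have h1 : b ⟨(x, z), hxz⟩ = 0 ↔ L.mkU z = 0 := Subtype.ext_iff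
    rw [h1, mkU_eq_zero_iff]
    constructor
    · rintro ⟨y, w, hy, rfl⟩
      refine ⟨x - (p : WittVector p k) ^ n • y, ?_, ?_⟩
      · change subP L.F _ = 0
        rw [map_sub, subP_smul_natCast, hxz', subP_apply, hy, ← smul_sub, pow_succ, mul_smul,
          sub_self]
      · rw [map_sub, (hker _).2 (mem_pPow.2 ⟨y, rfl⟩), sub_zero]
    · rintro ⟨κ, hκ, hκx⟩
      have h2 : x - κ ∈ pPow p k L.carrier n := by
        rw [← hker, map_sub, hκx, sub_self]
      obtain ⟨y, hy⟩ := mem_pPow.1 h2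
      refine ⟨y, z + y, ?_, by abel⟩
      have h3 : (p : WittVector p k) ^ n • subP L.F y =
          (p : WittVector p k) ^ n • (p : WittVector p k) • z := by
        rw [← subP_smul_natCast, ← hy, map_sub, hxz', show subP L.F κ = 0 from hκ, sub_zero,
          pow_succ, mul_smul]
      have h4 := pow_smul_cancel h3
      rw [subP_apply, sub_eq_iff_eq_add] at h4
      rw [h4, smul_add]
  obtain ⟨e, he⟩ := exists_addEquiv_of_ker_eq b a hb ha hab
  refine ⟨⟨e, fun f => ?_⟩, fun x z hx hxA => he ⟨(x, z), hx⟩⟩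
  have hval : ∀ x z (hx : subP L.F x = (p : WittVector p k) ^ (n + 1) • z),
      f (e ⟨L.mkU z, L.mkU_mem_torsion hx⟩) =
        f (QuotientAddGroup.mk (⟨ρ x, hmemA ⟨(x, z), hx⟩⟩ : A) : A ⧸ H.addSubgroupOf A) :=
    fun x z hx => congrArg f (he ⟨(x, z), hx⟩)
  constructor
  · rintro ⟨f', hf', hff'⟩
    have hf'val : ∀ x (hx : ρ x ∈ A), f' (ρ x) =
        f (QuotientAddGroup.mk (⟨ρ x, hx⟩ : A) : A ⧸ H.addSubgroupOf A) :=
      fun x hx => congrFun hff' ⟨ρ x, hx⟩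
    obtain ⟨φ, hφ, hφB, hφval⟩ := exists_isSubPInvariant_of_regular L.F n (hreg f' hf')
      (fun x y hxy => by
        rw [← sub_eq_zero.1 ((map_sub ρ x y).symm.trans ((hker _).2 hxy))])
      (fun x hx κ hκ => by
        have hxA : ρ x ∈ A := (hA _).2 ⟨x, hx, rfl⟩
        have hκx : ρ (x + κ) ∈ A := (hA _).2 ⟨x + κ, by
          rwa [map_add, show subP L.F κ = 0 from hκ, add_zero], rfl⟩
        change f' (ρ (x + κ)) = f' (ρ x)
        symm
        rw [hf'val x hxA, hf'val _ hκx]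
        refine congrArg f ?_
        refine QuotientAddGroup.eq.2 ?_
        rw [AddSubgroup.mem_addSubgroupOf, hH]
        refine ⟨κ, hκ, ?_⟩
        change ρ κ = -ρ x + ρ (x + κ)
        rw [map_add]
        abel)
    -- Since `φ` is invariant under the image of `F/p - 1`, the choice of representative is
    -- immaterial.
    refine ⟨fun t => φ t.out, ?_, ?_⟩
    · change (fun z => φ (QuotientAddGroup.mk z : L.carrier ⧸ _).out) ∈ regFun p k L.carrier
      convert hφ using 1
      funext z
      have h1 : -z + (QuotientAddGroup.mk z :
          L.carrier ⧸ (L.divF - L.nygaard.subtype).range).out ∈ _ :=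
        QuotientAddGroup.eq.1 (QuotientAddGroup.out_eq' _).symm
      obtain ⟨y, w, hy, hz⟩ := L.mem_range_divF_sub.1 h1
      rw [← hφB z y w hy, ← hz, add_neg_cancel_left]
    · funext ⟨t, ht⟩
      have hout : L.mkU t.out = t := QuotientAddGroup.out_eq' t
      obtain ⟨x, hx⟩ := L.exists_of_mem_torsion (z := t.out) (by rw [hout]; exact ht)
      have h2 := hval x _ hx
      have ht' : (⟨t, ht⟩ : (L.U.torsion (p ^ n)).carrier) =
          ⟨L.mkU t.out, L.mkU_mem_torsion hx⟩ := Subtype.ext hout.symm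
      change φ t.out = f (e ⟨t, ht⟩)
      rw [hφval x _ hx, ht', h2, ← hf'val x (hmemA ⟨(x, _), hx⟩)]
  · rintro ⟨φ, hφ, hφf⟩
    have hφ' : (fun z => φ (L.mkU z)) ∈ regFun p k L.carrier := hφ
    obtain ⟨g, hg, hgn, hgval⟩ := exists_regular_of_isSubPInvariant L.F n hφ' (by
      intro z y w hyw
      refine congrArg φ ?_
      rw [mkU_add, L.mkU_eq_zero_iff.2 ⟨y, w, hyw, rfl⟩, add_zero])
    obtain ⟨f', hf', hfg⟩ := hreg' g hg hgn
    refine ⟨f', hf', ?_⟩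
    funext ⟨y, hy⟩
    obtain ⟨x, hx, rfl⟩ := (hA y).1 hy
    obtain ⟨z, hz⟩ := mem_pPow.1 hx
    change f' (ρ x) = f _
    rw [hfg, hgval x z hz]
    exact (congrFun hφf ⟨L.mkU z, L.mkU_mem_torsion hz⟩).trans (hval x z hz)

end FCrystal

end QuasiAlg
end

noncomputable section
namespace QuasiAlg

/-! ### Construction of quasi-algebraic groups -/

section Sup

variable {k : Type u} [Field k] {X : Type v} {Y : Type w} {X' : Type v'} {Y' : Type w'}

theorem comp_prodMap_mem_sup {S : Subalgebra k (X → k)} {T : Subalgebra k (Y → k)}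
    {Φ : X × Y → k} (h : Φ ∈ S.map (pullback k Prod.fst) ⊔ T.map (pullback k Prod.snd))
    (φ : X' → X) (ψ : Y' → Y) :
    (fun z : X' × Y' => Φ (φ z.1, ψ z.2)) ∈
      (S.map (pullback k φ)).map (pullback k Prod.fst) ⊔
        (T.map (pullback k ψ)).map (pullback k Prod.snd) := by
  have h1 : S.map (pullback k Prod.fst) ⊔ T.map (pullback k Prod.snd) ≤
      ((S.map (pullback k φ)).map (pullback k Prod.fst) ⊔
        (T.map (pullback k ψ)).map (pullback k Prod.snd)).comap
        (pullback k (fun z : X' × Y' => (φ z.1, ψ z.2))) := by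
    refine sup_le ?_ ?_
    · rintro _ ⟨f, hf, rfl⟩
      exact (le_sup_left : (S.map (pullback k φ)).map (pullback k Prod.fst) ≤ _)
        ⟨_, ⟨f, hf, rfl⟩, rfl⟩
    · rintro _ ⟨f, hf, rfl⟩
      exact (le_sup_right : (T.map (pullback k ψ)).map (pullback k Prod.snd) ≤ _)
        ⟨_, ⟨f, hf, rfl⟩, rfl⟩
  exact h1 h

theorem IsPerfectAlg.exists_root [IsAlgClosed k] {p : ℕ} [Fact p.Prime] [CharP k p]
    {S : Subalgebra k (X → k)} (hS : IsPerfectAlg p S) {f : X → k} (hf : f ∈ S) :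
    ∃ g ∈ S, g ^ p = f := by
  have hg : (fun x => (frobeniusEquiv k p).symm (f x)) ^ p = f :=
    funext fun x => (frobeniusEquiv k p).apply_symm_apply _
  exact ⟨_, hS _ (by rwa [hg]), hg⟩

theorem IsPerfectAlg.map [IsAlgClosed k] {p : ℕ} [Fact p.Prime] [CharP k p]
    {S : Subalgebra k (X → k)} (hS : IsPerfectAlg p S) (φ : X' → X) :
    IsPerfectAlg p (S.map (pullback k φ)) := by
  rintro f ⟨g, hg, hgf⟩
  obtain ⟨g', hg', rfl⟩ := hS.exists_root hg
  refine ⟨g', hg', funext fun x => frobenius_inj k p ?_⟩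
  exact congrFun hgf x

/-- Every element of the join has a `p`-th root in it, generator by generator, because Frobenius
respects sums and products; in a field such roots are unique. -/
theorem IsPerfectAlg.sup [IsAlgClosed k] {p : ℕ} [Fact p.Prime] [CharP k p]
    {S T : Subalgebra k (X → k)} (hS : IsPerfectAlg p S) (hT : IsPerfectAlg p T) :
    IsPerfectAlg p (S ⊔ T) := by
  have hroot : ∀ f ∈ S ⊔ T, ∃ g ∈ S ⊔ T, g ^ p = f := by
    intro f hf
    induction hf using Algebra.adjoin_induction with
    | mem f hf =>
      rcases hf with hf | hf
      · obtain ⟨g, hg, h⟩ := hS.exists_root hf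
        exact ⟨g, le_sup_left (a := S) hg, h⟩
      · obtain ⟨g, hg, h⟩ := hT.exists_root hf
        exact ⟨g, le_sup_right (a := S) hg, h⟩
    | algebraMap c =>
      obtain ⟨g, hg, h⟩ := hS.exists_root (S.algebraMap_mem c)
      exact ⟨g, le_sup_left (a := S) hg, h⟩
    | add a b _ _ ha hb =>
      obtain ⟨a', ha', rfl⟩ := ha
      obtain ⟨b', hb', rfl⟩ := hb
      refine ⟨a' + b', add_mem ha' hb', funext fun x => ?_⟩
      exact add_pow_char ..
    | mul a b _ _ ha hb =>
      obtain ⟨a', ha', rfl⟩ := ha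
      obtain ⟨b', hb', rfl⟩ := hb
      exact ⟨a' * b', mul_mem ha' hb', mul_pow _ _ _⟩
  intro f hf
  obtain ⟨g, hg, h⟩ := hroot _ hf
  have : g = f := funext fun x => frobenius_inj k p (congrFun h x)
  rwa [← this]

end Sup

namespace RegGroup

variable {k : Type u} [Field k] [IsAlgClosed k] {p : ℕ} [Fact p.Prime] [CharP k p]

/-- A closed subgroup of a quasi-algebraic group. -/
theorem IsQuasiAlgebraic.of_closedEmbedding {G : RegGroup.{u, v} k} {G' : RegGroup.{u, w} k}
    (hG : G.IsQuasiAlgebraic p) (φ : G'.carrier →+ G.carrier) (hφ : Function.Injective φ)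
    (hreg : G'.regular = G.regular.map (pullback k φ)) (I : Set (G.carrier → k))
    (hI : I ⊆ G.regular) (hrange : ∀ y, (∃ x, φ x = y) ↔ ∀ f ∈ I, f y = 0) :
    G'.IsQuasiAlgebraic p where
  perfect := by
    rw [hreg]
    exact IsPerfectAlg.map hG.perfect φ
  finite_type := by
    classical
    obtain ⟨S, hS, hS'⟩ := hG.finite_type
    refine ⟨S.image (pullback k φ), ?_, ?_⟩
    · intro f hf
      obtain ⟨g, hg, rfl⟩ := Finset.mem_image.1 (Finset.mem_coe.1 hf)
      rw [hreg]
      exact ⟨g, hS hg, rfl⟩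
    · rw [hreg]
      rintro _ ⟨f, hf, rfl⟩
      obtain ⟨m, hm⟩ := hS' f hf
      refine ⟨m, ?_⟩
      rw [Finset.coe_image, ← AlgHom.map_adjoin]
      exact ⟨_, hm, map_pow (pullback k φ) _ _⟩
  points := by
    intro χ
    let r : G.regular →ₐ[k] G'.regular :=
      ((pullback k φ).comp G.regular.val).codRestrict _
        fun s => by rw [hreg]; exact ⟨s.1, s.2, rfl⟩
    obtain ⟨y, hy, huniq⟩ := hG.points (χ.comp r)
    obtain ⟨x, rfl⟩ := (hrange y).2 fun f hf => by
      have h1 := hy ⟨f, hI hf⟩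
      have h2 : r ⟨f, hI hf⟩ = 0 := Subtype.ext (funext fun x => (hrange _).1 ⟨x, rfl⟩ f hf)
      rw [AlgHom.comp_apply, h2, map_zero] at h1
      exact h1.symm
    refine ⟨x, ?_, fun x' hx' => hφ (huniq _ fun f => hx' (r f))⟩
    rintro ⟨f, hf⟩
    obtain ⟨g, hg, rfl⟩ := hreg ▸ hf
    exact hy ⟨g, hg⟩
  add_regular := by
    rw [hreg]
    rintro _ ⟨f, hf, rfl⟩
    have h := comp_prodMap_mem_sup (hG.add_regular f hf) φ φ
    convert h using 1
    funext z
    exact congrArg f (map_add φ _ _)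
  neg_regular := by
    rw [hreg]
    rintro _ ⟨f, hf, rfl⟩
    exact ⟨_, hG.neg_regular f hf, funext fun x => congrArg f (map_neg φ x).symm⟩

theorem IsQuasiAlgebraic.of_iso {G : RegGroup.{u, v} k} {G' : RegGroup.{u, w} k}
    (hG : G.IsQuasiAlgebraic p) (e : Iso G' G) : G'.IsQuasiAlgebraic p := by
  refine hG.of_closedEmbedding e.toAddEquiv.toAddMonoidHom e.toAddEquiv.injective ?_ ∅
    (Set.empty_subset _) fun y => ⟨fun _ f hf => hf.elim, fun _ => e.toAddEquiv.surjective y⟩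
  ext f
  constructor
  · intro hf
    have h : (fun x => (fun y => f (e.toAddEquiv.symm y)) (e.toAddEquiv x)) = f :=
      funext fun x => congrArg f (e.toAddEquiv.symm_apply_apply x)
    exact ⟨_, (e.regular_iff fun y => f (e.toAddEquiv.symm y)).2 (by rwa [h]), h⟩
  · rintro ⟨g, hg, rfl⟩
    exact (e.regular_iff g).1 hg

theorem IsQuasiAlgebraic.sub {G : RegGroup.{u, v} k} (hG : G.IsQuasiAlgebraic p)
    (A : AddSubgroup G.carrier) (I : Set (G.carrier → k)) (hI : I ⊆ G.regular)
    (hA : ∀ y, y ∈ A ↔ ∀ f ∈ I, f y = 0) : (G.sub A).IsQuasiAlgebraic p :=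
  hG.of_closedEmbedding A.subtype A.subtype_injective rfl I hI fun y =>
    ⟨by rintro ⟨x, rfl⟩; exact (hA _).1 x.2, fun h => ⟨⟨y, (hA y).2 h⟩, rfl⟩⟩

theorem IsQuasiAlgebraic.translate {G : RegGroup.{u, v} k} (hG : G.IsQuasiAlgebraic p)
    {f : G.carrier → k} (hf : f ∈ G.regular) (h : G.carrier) :
    (fun x => f (x + h)) ∈ G.regular := by
  obtain ⟨E, _, hE, hE'⟩ := exists_finiteDimensional_of_mem_sup (hG.add_regular f hf)
  exact hE (hE' h)

end RegGroup

/-! ### Quotients by finite subgroups -/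

section FiniteQuotient

variable {k : Type u} [Field k] {G : Type v} [AddCommGroup G] (H : AddSubgroup G)

/-- Invariant functions, as functions on the quotient. -/
abbrev invariants (S : Subalgebra k (G → k)) : Subalgebra k (G ⧸ H → k) :=
  S.comap (pullback k (fun g : G => (QuotientAddGroup.mk g : G ⧸ H)))

/-- The inclusion of the invariant functions. -/
def ofInvariants (S : Subalgebra k (G → k)) : invariants H S →ₐ[k] S :=
  ((pullback k (fun g : G => (QuotientAddGroup.mk g : G ⧸ H))).comp
    (invariants H S).val).codRestrict S fun f => f.2

theorem ofInvariants_injective (S : Subalgebra k (G → k)) :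
    Function.Injective (ofInvariants H S) := by
  intro a b h
  refine Subtype.ext (funext fun t => ?_)
  obtain ⟨x, rfl⟩ := QuotientAddGroup.mk_surjective t
  exact congrFun (congrArg Subtype.val h) x

/-- `H` acts on `S` by translations and the functions on the quotient are the fixed ring, over which
`S` is integral for a finite group. -/
theorem ofInvariants_isIntegral [Finite H] (S : Subalgebra k (G → k))
    (hS : ∀ f ∈ S, ∀ t ∈ H, (fun x => f (x + t)) ∈ S) :
    (ofInvariants H S).toRingHom.IsIntegral := by
  let _ : Algebra (invariants H S) S := (ofInvariants H S).toRingHom.toAlgebra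
  let _ : MulSemiringAction (Multiplicative H) S :=
    { smul := fun t f => ⟨fun x => f.1 (x + (t.toAdd : H).1), hS f.1 f.2 _ t.toAdd.2⟩
      one_smul := fun f => Subtype.ext (funext fun x => congrArg f.1 (add_zero x))
      mul_smul := fun s t f => Subtype.ext (funext fun x => congrArg f.1 (by
        change x + ((s.toAdd : H).1 + (t.toAdd : H).1) = x + (s.toAdd : H).1 + (t.toAdd : H).1
        rw [add_assoc]))
      smul_zero := fun _ => rfl
      smul_add := fun _ _ _ => rfl
      smul_one := fun _ => rfl
      smul_mul := fun _ _ _ => rfl }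
  have : Algebra.IsInvariant (invariants H S) S (Multiplicative H) := ⟨fun f hf => by
    have hf' : ∀ x, ∀ t ∈ H, f.1 (x + t) = f.1 x := fun x t ht =>
      congrFun (congrArg Subtype.val (hf (Multiplicative.ofAdd ⟨t, ht⟩))) x
    let g : G ⧸ H → k := fun y => f.1 y.out
    have hg : (fun x => g (QuotientAddGroup.mk x)) = f.1 := by
      funext x
      have h1 := QuotientAddGroup.eq.1
        (QuotientAddGroup.out_eq' (QuotientAddGroup.mk x : G ⧸ H)).symm
      have h2 := hf' x _ h1
      rwa [add_neg_cancel_left] at h2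
    exact ⟨⟨g, by change (fun x => g (QuotientAddGroup.mk x)) ∈ S; rw [hg]; exact f.2⟩,
      Subtype.ext hg⟩⟩
  exact (Algebra.IsInvariant.isIntegral (invariants H S) S (Multiplicative H)).isIntegral

/-- The Artin–Tate lemma: `S` is finitely generated over `k` and finite over the invariants. -/
theorem invariants_fg [Finite H] (S : Subalgebra k (G → k)) (hfg : S.FG)
    (hS : ∀ f ∈ S, ∀ t ∈ H, (fun x => f (x + t)) ∈ S) : (invariants H S).FG := by
  let _ : Algebra (invariants H S) S := (ofInvariants H S).toRingHom.toAlgebra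
  have : IsScalarTower k (invariants H S) S :=
    IsScalarTower.of_algebraMap_eq fun c => ((ofInvariants H S).commutes c).symm
  have h1 : Algebra.FiniteType k S := (Subalgebra.fg_iff_finiteType S).1 hfg
  have h2 : Algebra.FiniteType (invariants H S) S :=
    Algebra.FiniteType.of_restrictScalars_finiteType k _ _
  have h3 : Algebra.IsIntegral (invariants H S) S := ⟨ofInvariants_isIntegral H S hS⟩
  have h4 : Module.Finite (invariants H S) S := Algebra.IsIntegral.finite
  rw [Subalgebra.fg_iff_finiteType]
  exact ⟨fg_of_fg_of_fg k (invariants H S) S h1.out h4.fg_top (ofInvariants_injective H S)⟩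

theorem nonempty_algHom_of_isIntegral [IsAlgClosed k] (K : Type*) [Field K] [Algebra k K]
    [Algebra.IsIntegral k K] : Nonempty (K →ₐ[k] k) :=
  ⟨IsAlgClosed.lift⟩

/-- Lying over: the residue field at a prime above `ker χ` is integral over `k`, hence maps to `k`.
-/
theorem exists_algHom_extending_invariants [IsAlgClosed k] [Finite H] (S : Subalgebra k (G → k))
    (hS : ∀ f ∈ S, ∀ t ∈ H, (fun x => f (x + t)) ∈ S) (χ : invariants H S →ₐ[k] k) :
    ∃ χ' : S →ₐ[k] k, ∀ f, χ' (ofInvariants H S f) = χ f := by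
  let _ : Algebra (invariants H S) S := (ofInvariants H S).toRingHom.toAlgebra
  have h3 : Algebra.IsIntegral (invariants H S) S := ⟨ofInvariants_isIntegral H S hS⟩
  have hχ : Function.Surjective χ := fun c => ⟨algebraMap k _ c, χ.commutes c⟩
  have hmax : (RingHom.ker χ).IsMaximal := RingHom.ker_isMaximal_of_surjective χ hχ
  have hker : RingHom.ker (algebraMap (invariants H S) S) ≤ RingHom.ker χ := by
    rw [(RingHom.injective_iff_ker_eq_bot (algebraMap (invariants H S) S)).1
      (ofInvariants_injective H S)]
    exact bot_le
  obtain ⟨Q, hQ, hQχ⟩ := Ideal.exists_ideal_over_maximal_of_isIntegral (S := S) (RingHom.ker χ) hker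
  let _ := Ideal.Quotient.field Q
  have hmem : ∀ f : invariants H S, Ideal.Quotient.mk Q (ofInvariants H S f) =
      algebraMap k (S ⧸ Q) (χ f) := by
    intro f
    have h1 : f - algebraMap k _ (χ f) ∈ Q.comap (algebraMap (invariants H S) S) := by
      rw [hQχ, RingHom.mem_ker, map_sub, AlgHom.commutes]
      exact sub_self _
    have h2 : ofInvariants H S f - ofInvariants H S (algebraMap k _ (χ f)) ∈ Q := by
      rw [← map_sub]; exact h1
    rw [Ideal.Quotient.mk_eq_mk_iff_sub_mem _ _ |>.2 h2, AlgHom.commutes]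
    rfl
  have : Algebra.IsIntegral k (S ⧸ Q) := ⟨fun y => by
    obtain ⟨y, rfl⟩ := Ideal.Quotient.mk_surjective y
    obtain ⟨P, hP, hPy⟩ := h3.isIntegral y
    refine ⟨P.map (χ : invariants H S →+* k), hP.map _, ?_⟩
    have hcomp : (algebraMap k (S ⧸ Q)).comp (χ : invariants H S →+* k) =
        (Ideal.Quotient.mk Q).comp (algebraMap (invariants H S) S) :=
      RingHom.ext fun f => (hmem f).symm
    rw [Polynomial.eval₂_map, hcomp, ← Polynomial.hom_eval₂, hPy, map_zero]⟩
  obtain ⟨ψ⟩ := nonempty_algHom_of_isIntegral (k := k) (S ⧸ Q)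
  refine ⟨ψ.comp (Ideal.Quotient.mkₐ k Q), fun f => ?_⟩
  rw [AlgHom.comp_apply, Ideal.Quotient.mkₐ_eq_mk, hmem, AlgHom.commutes]
  rfl

/-- The space containing all translates of the pulled-back function is finite-dimensional, hence so
is its preimage on the quotient, and symmetry of addition handles the second variable. -/
theorem invariants_add_mem (S : Subalgebra k (G → k)) (f : G ⧸ H → k)
    (hf : (fun z : G × G => f (QuotientAddGroup.mk (z.1 + z.2))) ∈
      S.map (pullback k Prod.fst) ⊔ S.map (pullback k Prod.snd)) :
    (fun z : (G ⧸ H) × (G ⧸ H) => f (z.1 + z.2)) ∈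
      (invariants H S).map (pullback k Prod.fst) ⊔ (invariants H S).map (pullback k Prod.snd) := by
  let P : (G ⧸ H → k) →ₗ[k] (G → k) :=
    (pullback k (fun g : G => (QuotientAddGroup.mk g : G ⧸ H))).toLinearMap
  have hP : Function.Injective P := by
    intro a b hab
    funext t
    obtain ⟨x, rfl⟩ := QuotientAddGroup.mk_surjective t
    exact congrFun hab x
  obtain ⟨E, hEfin, hE, hE'⟩ := exists_finiteDimensional_of_mem_sup hf
  have : FiniteDimensional k (E.comap P) := by
    have h1 : FiniteDimensional k ((E.comap P).map P) :=
      Submodule.finiteDimensional_of_le (Submodule.map_comap_le P E)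
    exact Module.Finite.equiv (Submodule.equivMapOfInjective P hP _).symm
  have hmem : ∀ y, (fun x => f (x + y)) ∈ E.comap P := by
    intro y
    obtain ⟨y, rfl⟩ := QuotientAddGroup.mk_surjective y
    exact hE' y
  have hle : E.comap P ≤ (invariants H S).toSubmodule := fun g hg => hE hg
  refine mem_sup_of_finiteDimensional (E.comap P) hle hmem fun x => ?_
  have h1 : (fun y => f (y + x)) ∈ invariants H S := hle (hmem x)
  simpa only [add_comm x] using h1

theorem RegGroup.IsQuasiAlgebraic.quot [IsAlgClosed k] {p : ℕ} [Fact p.Prime] [CharP k p]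
    {G : RegGroup.{u, v} k} (hG : G.IsQuasiAlgebraic p) (H : AddSubgroup G.carrier) [Finite H] :
    (G.quot H).IsQuasiAlgebraic p where
  perfect := IsPerfectAlg.comap hG.perfect _
  finite_type := by
    classical
    obtain ⟨S, hS, hS'⟩ := hG.finite_type
    have := Fintype.ofFinite H
    -- The regular functions need not be finitely generated. Adding the `H`-translates of the
    -- generators up to roots gives a finitely generated `H`-stable algebra `B`, to which Artin–Tate
    -- applies.
    let T : Finset (G.carrier → k) :=
      (S ×ˢ (Finset.univ : Finset H)).image fun q x => q.1 (x + q.2)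
    let B := Algebra.adjoin k (T : Set (G.carrier → k))
    have hST : (S : Set (G.carrier → k)) ⊆ T := fun f hf =>
      Finset.mem_coe.2 (Finset.mem_image.2 ⟨(f, 0), Finset.mem_product.2 ⟨hf, Finset.mem_univ _⟩,
        funext fun x => congrArg f (add_zero x)⟩)
    have hBG : B ≤ G.regular := by
      refine Algebra.adjoin_le fun f hf => ?_
      obtain ⟨⟨g, t⟩, hg, rfl⟩ := Finset.mem_image.1 (Finset.mem_coe.1 hf)
      exact hG.translate (hS (Finset.mem_product.1 hg).1) _
    have hB : ∀ f ∈ B, ∀ t ∈ H, (fun x => f (x + t)) ∈ B := by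
      intro f hf t ht
      have h1 : B ≤ B.comap (pullback k fun x => x + t) := by
        refine Algebra.adjoin_le fun f hf => ?_
        obtain ⟨⟨g, s⟩, hg, rfl⟩ := Finset.mem_image.1 (Finset.mem_coe.1 hf)
        refine Algebra.subset_adjoin (Finset.mem_coe.2 (Finset.mem_image.2
          ⟨(g, ⟨t, ht⟩ + s), Finset.mem_product.2 ⟨(Finset.mem_product.1 hg).1,
            Finset.mem_univ _⟩, funext fun x => congrArg g (add_assoc _ _ _).symm⟩))
      exact h1 hf
    obtain ⟨R, hR⟩ := invariants_fg H B ⟨T, rfl⟩ hB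
    refine ⟨R, ?_, fun f hf => ?_⟩
    · intro f hf
      have h1 : f ∈ invariants H B := hR ▸ Algebra.subset_adjoin hf
      exact hBG h1
    · obtain ⟨m, hm⟩ := hS' _ hf
      refine ⟨m, ?_⟩
      have h1 : f ^ p ^ m ∈ invariants H B := Algebra.adjoin_mono hST hm
      exact hR.symm ▸ h1
  points := by
    intro χ
    obtain ⟨χ', hχ'⟩ := exists_algHom_extending_invariants H G.regular
      (fun f hf t _ => hG.translate hf t) χ
    obtain ⟨x, hx, huniq⟩ := hG.points χ'
    refine ⟨QuotientAddGroup.mk x, fun f => ?_, fun y hy => ?_⟩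
    · exact (hχ' f).symm.trans (hx _)
    · obtain ⟨y, rfl⟩ := QuotientAddGroup.mk_surjective y
      classical
      by_contra hne
      have := Fintype.ofFinite H
      have hsep : ∀ z ∈ (Finset.univ : Finset H).image (fun t => y + t.1),
          ∃ f ∈ G.regular, f x ≠ f z := by
        intro z hz
        obtain ⟨t, -, rfl⟩ := Finset.mem_image.1 hz
        by_contra hcon
        push Not at hcon
        have h1 : y + t.1 = x := huniq _ fun f => (hx f).trans (hcon f.1 f.2)
        refine hne (QuotientAddGroup.eq.2 ?_)
        rw [← h1, neg_add_cancel_left]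
        exact t.2
      obtain ⟨e, he, hex, hey⟩ := exists_interpolation G.regular x _ hsep
      -- The norm of `1 - e` is an invariant function separating the cosets: it is `0` at `x`, where
      -- `e = 1`, and `1` at `y`, since `e` vanishes on `y + H`.
      let N : G.carrier → k := ∏ t : H, fun z => 1 - e (z + t)
      have hN : N ∈ G.regular := prod_mem fun t _ =>
        sub_mem (one_mem _) (hG.translate he t.1)
      have hNapp : ∀ z, N z = ∏ t : H, (1 - e (z + t)) := fun z => Finset.prod_apply _ _ _
      have hNinv : ∀ z, ∀ s ∈ H, N (z + s) = N z := by
        intro z s hs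
        rw [hNapp, hNapp]
        refine Fintype.prod_equiv (Equiv.addLeft (⟨s, hs⟩ : H)) _ _ fun t => ?_
        simp [add_assoc]
      let N' : G.carrier ⧸ H → k := fun t => N t.out
      have hN' : ∀ z : G.carrier, N' (QuotientAddGroup.mk z) = N z := by
        intro z
        have h1 := QuotientAddGroup.eq.1
          (QuotientAddGroup.out_eq' (QuotientAddGroup.mk z : G.carrier ⧸ H)).symm
        have h2 := hNinv z _ h1
        rwa [add_neg_cancel_left] at h2
      have hN'reg : N' ∈ invariants H G.regular := by
        change (fun z => N' (QuotientAddGroup.mk z)) ∈ G.regular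
        rw [show (fun z => N' (QuotientAddGroup.mk z)) = N from funext hN']
        exact hN
      have h1 := hy ⟨N', hN'reg⟩
      have h2 : χ ⟨N', hN'reg⟩ = N' (QuotientAddGroup.mk x) :=
        (hχ' ⟨N', hN'reg⟩).symm.trans (hx _)
      have h3 : N x = N y := by
        rw [← hN', ← hN']
        exact h2.symm.trans h1
      rw [hNapp, hNapp, Finset.prod_eq_zero (Finset.mem_univ (0 : H)) (by simp [hex]),
        Finset.prod_eq_one fun t _ => by
          rw [hey _ (Finset.mem_image_of_mem _ (Finset.mem_univ t)), sub_zero]] at h3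
      exact zero_ne_one h3
  add_regular := fun f hf => invariants_add_mem H G.regular f (hG.add_regular _ hf)
  neg_regular := fun f hf => hG.neg_regular _ hf

end FiniteQuotient

/-! ### The quasi-algebraic group `L / p ^ n` -/

section Reduction

variable {p : ℕ} [Fact p.Prime] {k : Type u} [Field k] [CharP k p] [IsAlgClosed k]
  {L : Type v} [AddCommGroup L] [Module (WittVector p k) L]
  [Module.Free (WittVector p k) L] [Module.Finite (WittVector p k) L]

/-- `L / p ^ n` is quasi-algebraic. -/
theorem RegGroup.isQuasiAlgebraic_of_reduction (n : ℕ) (Y : RegGroup.{u, w} k) (ρ : L →+ Y.carrier)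
    (hρ : Function.Surjective ρ) (hker : ∀ x, ρ x = 0 ↔ x ∈ pPow p k L n)
    (hreg : Y.regular = (regFun p k L).comap (pullback k ρ)) : Y.IsQuasiAlgebraic p := by
  choose sec hsec using hρ
  have hρeq : ∀ x y, ρ x = ρ y ↔ x - y ∈ pPow p k L n := fun x y => by
    rw [← hker, map_sub, sub_eq_zero]
  have hsec' : ∀ x, sec (ρ x) - x ∈ pPow p k L n := fun x => (hρeq _ _).1 (hsec _)
  have hdesc : ∀ a ∈ polyFun p k L n, (fun y => a (sec y)) ∈ Y.regular := by
    intro a ha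
    rw [hreg]
    change (fun x => a (sec (ρ x))) ∈ regFun p k L
    rw [show (fun x => a (sec (ρ x))) = a from funext fun x => polyFun_congr ha (hsec' x)]
    exact polyFun_le_regular n ha
  -- Up to `p`-power roots the regular functions on `Y` are those of level `n` on `L`, transported
  -- along an arbitrary section; their constancy modulo `p ^ n` makes this choice harmless.
  have hpow : ∀ f ∈ Y.regular, ∃ e, ∃ a ∈ polyFun p k L n,
      (∀ x, a x = f (ρ x) ^ p ^ e) ∧ ∀ y, f y ^ p ^ e = a (sec y) := by
    intro f hf
    rw [hreg] at hf
    have hf' : (fun x => f (ρ x)) ∈ regFun p k L := hf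
    obtain ⟨e, he⟩ := exists_pow_mem_polyFun (n := n) hf'
      (fun x y h => congrArg f ((hρeq x y).2 h))
    refine ⟨e, _, he, fun x => rfl, fun y => ?_⟩
    change f y ^ p ^ e = f (ρ (sec y)) ^ p ^ e
    rw [hsec]
  have hperf : IsPerfectAlg p Y.regular := by
    rw [hreg]
    exact IsPerfectAlg.comap regular_isPerfectAlg _
  refine ⟨hperf, ?_, ?_, ?_, ?_⟩
  · obtain ⟨S, hS⟩ := (polyFun_fg (p := p) (k := k) (L := L) n).map (pullback k sec)
    refine ⟨S, fun f hf => ?_, fun f hf => ?_⟩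
    · have h1 : f ∈ (polyFun p k L n).map (pullback k sec) := hS ▸ Algebra.subset_adjoin hf
      obtain ⟨a, ha, rfl⟩ := h1
      exact hdesc a ha
    · obtain ⟨e, a, ha, -, hae⟩ := hpow f hf
      refine ⟨e, ?_⟩
      rw [hS]
      exact ⟨a, ha, funext fun y => (hae y).symm⟩
  · intro χ
    let r : polyFun p k L n →ₐ[k] Y.regular :=
      ((pullback k sec).comp (polyFun p k L n).val).codRestrict _ fun s => hdesc s.1 s.2
    obtain ⟨x, hx⟩ := polyFun_hasPoints n (χ.comp r)
    refine ⟨ρ x, ?_, fun y hy => ?_⟩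
    · rintro ⟨f, hf⟩
      obtain ⟨e, a, ha, hax, hae⟩ := hpow f hf
      have h1 := hx ⟨a, ha⟩
      have h2 : r ⟨a, ha⟩ = (⟨f, hf⟩ : Y.regular) ^ p ^ e :=
        Subtype.ext (funext fun y => (hae y).symm)
      rw [AlgHom.comp_apply, h2, map_pow] at h1
      exact iterateFrobenius_inj k p e (h1.trans (hax x))
    · rw [← hsec y, hρeq, sub_mem_pPow_iff]
      intro i j hj
      have hmem : (fun x : L => ((bas p k L).coord i x).coeff j) ∈ polyFun p k L n :=
        Algebra.subset_adjoin ⟨_, j, hj, rfl⟩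
      have h1 := hx ⟨_, hmem⟩
      rw [AlgHom.comp_apply, hy] at h1
      exact h1
  · intro f hf
    obtain ⟨e, a, ha, hax, hae⟩ := hpow f hf
    have h1 := comp_prodMap_mem_sup (polyFun_add_mem ha) sec sec
    have hle : (polyFun p k L n).map (pullback k sec) ≤ Y.regular := by
      rintro _ ⟨b, hb, rfl⟩
      exact hdesc b hb
    have h2 := sup_le_sup (Subalgebra.map_mono (f := pullback k Prod.fst) hle)
      (Subalgebra.map_mono (f := pullback k Prod.snd) hle) h1
    refine IsPerfectAlg.mem_of_pow (f := fun z : Y.carrier × Y.carrier => f (z.1 + z.2)) (m := e)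
      (IsPerfectAlg.sup (IsPerfectAlg.map hperf _) (IsPerfectAlg.map hperf _)) ?_
    convert h2 using 1
    funext z
    change f (z.1 + z.2) ^ p ^ e = a (sec z.1 + sec z.2)
    rw [hax, map_add, hsec, hsec]
  · intro f hf
    rw [hreg] at hf ⊢
    change (fun x => f (-ρ x)) ∈ regFun p k L
    have hf' : (fun x => f (ρ x)) ∈ regFun p k L := hf
    have h1 := comp_mem_of_mem_regular regular_isPerfectAlg
      (fun m => (lreg_id_regular (p := p) (k := k) (L := L) m).neg) hf'
    convert h1 using 1
    funext x
    rw [map_neg]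

end Reduction

end QuasiAlg
end

noncomputable section
namespace QuasiAlg

variable {p : ℕ} [Fact p.Prime] {k : Type u} [Field k] [CharP k p] [IsAlgClosed k]

/-! ### Closed subgroups and quotients in terms of reductions -/

namespace RegGroup

/-- `A` is the zero locus of regular functions. -/
def IsClosedIn (G : RegGroup.{u, v} k) (A : AddSubgroup G.carrier) : Prop :=
  ∀ y, (∀ f ∈ G.regular, (∀ a ∈ A, f a = 0) → f y = 0) → y ∈ A

theorem IsClosedIn.inf {G : RegGroup.{u, v} k} {A B : AddSubgroup G.carrier}
    (hA : G.IsClosedIn A) (hB : G.IsClosedIn B) : G.IsClosedIn (A ⊓ B) := fun y hy =>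
  ⟨hA y fun f hf h => hy f hf fun a ha => h a ha.1,
    hB y fun f hf h => hy f hf fun a ha => h a ha.2⟩

theorem IsQuasiAlgebraic.subquot {G : RegGroup.{u, v} k} (hG : G.IsQuasiAlgebraic p)
    {A : AddSubgroup G.carrier} (hA : G.IsClosedIn A) (H : AddSubgroup G.carrier) [Finite H] :
    (G.subquot A H).IsQuasiAlgebraic p := by
  have hsub : (G.sub A).IsQuasiAlgebraic p :=
    hG.sub A {f | f ∈ G.regular ∧ ∀ a ∈ A, f a = 0} (fun f hf => hf.1)
      fun y => ⟨fun hy f hf => hf.2 y hy, fun h => hA y fun f hf hfA => h f ⟨hf, hfA⟩⟩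
  have hinj : Function.Injective (fun x : H.addSubgroupOf A => (⟨x.1.1, x.2⟩ : H)) :=
    fun x y h => by
      have h' : x.1.1 = y.1.1 := congrArg (fun t : H => t.1) h
      exact Subtype.ext (Subtype.ext h')
  have : Finite (H.addSubgroupOf A) := Finite.of_injective _ hinj
  let H' : AddSubgroup (G.sub A).carrier := H.addSubgroupOf A
  have : Finite H' := this
  exact hsub.quot H'

variable {L : Type v} [AddCommGroup L] [Module (WittVector p k) L]
  {Z : Type v'} [AddCommGroup Z] [Module (WittVector p k) Z]
  [Module.Free (WittVector p k) Z] [Module.Finite (WittVector p k) Z]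

/-- A subgroup of `L / p ^ n` given by congruences between regular maps is closed. -/
theorem isClosedIn_of_reduction (n : ℕ) (Y : RegGroup.{u, w} k) (ρ : L →+ Y.carrier)
    (hρ : Function.Surjective ρ) (hker : ∀ x, ρ x = 0 ↔ x ∈ pPow p k L n)
    (hreg : Y.regular = (regFun p k L).comap (pullback k ρ)) (A : AddSubgroup Y.carrier)
    {ι : Type*} (D : ι → L →+ Z) (hD : ∀ i m, LReg p (regFun p k L) m (D i))
    (hDp : ∀ i x, D i ((p : WittVector p k) ^ n • x) ∈ pPow p k Z n)
    (hA : ∀ x, ρ x ∈ A ↔ ∀ i, D i x ∈ pPow p k Z n) : Y.IsClosedIn A := by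
  intro y hy
  obtain ⟨x, rfl⟩ := hρ y
  have hcoord : ∀ z : Z, z ∈ pPow p k Z n ↔
      ∀ i, ∀ j < n, ((bas p k Z).coord i z).coeff j = 0 := fun z => by
    have h := sub_mem_pPow_iff (p := p) (k := k) (n := n) (x := z) (y := 0)
    simpa using h
  rw [hA]
  intro i
  rw [hcoord]
  intro i' j hj
  choose sec hsec using hρ
  have hD' : ∀ x x', ρ x = ρ x' → D i x - D i x' ∈ pPow p k Z n := by
    intro x x' h
    obtain ⟨c, hc⟩ := mem_pPow.1 ((hker (x - x')).1 (by rw [map_sub, h, sub_self]))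
    rw [← map_sub, hc]
    exact hDp i c
  have key : ∀ x, ((bas p k Z).coord i' (D i (sec (ρ x)))).coeff j =
      ((bas p k Z).coord i' (D i x)).coeff j := fun x =>
    sub_mem_pPow_iff.1 (hD' _ _ (hsec (ρ x))) i' j hj
  have h1 := hy (fun y => ((bas p k Z).coord i' (D i (sec y))).coeff j) (by
    rw [hreg]
    change (fun x => ((bas p k Z).coord i' (D i (sec (ρ x)))).coeff j) ∈ regFun p k L
    simp only [key]
    exact hD i n _ j hj) (by
    intro a ha
    have h2 := (hA (sec a)).1 (by rwa [hsec])
    exact (hcoord _).1 (h2 i) i' j hj)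
  rw [← key]
  exact h1

end RegGroup

theorem FCrystal.finite_of_kerP (L : FCrystal.{u, v} p k) (n : ℕ) {Y : Type w} [AddCommGroup Y]
    (ρ : L.carrier →+ Y) (hker : ∀ x, ρ x = 0 ↔ x ∈ pPow p k L.carrier n) (H : AddSubgroup Y)
    (hH : ∀ y, y ∈ H ↔ ∃ x ∈ kerP L.F, ρ x = y) : Finite H := by
  refine Set.Finite.to_subtype (((finite_trunc_image L.F n).image ρ).subset ?_)
  intro y hy
  obtain ⟨x, hx, rfl⟩ := (hH y).1 hy
  refine ⟨trunc p k n x, ⟨x, sub_eq_zero.1 hx, rfl⟩, ?_⟩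
  rw [← sub_eq_zero, ← map_sub, hker]
  exact trunc_sub_mem n x

/-- The isomorphisms are determined by `[z] ↦ [ρ x]` on pairs `(x, z)`, and a morphism of crystals
carries pairs to pairs. -/
theorem FCrystal.snake_natural {L : FCrystal.{u, v} p k} {L' : FCrystal.{u, v'} p k}
    (φ : L.Hom L') (n : ℕ) {Y : RegGroup.{u, w} k} {Y' : RegGroup.{u, w'} k}
    {A H : AddSubgroup Y.carrier} {A' H' : AddSubgroup Y'.carrier}
    (ρ : L.carrier →+ Y.carrier) (ρ' : L'.carrier →+ Y'.carrier)
    (hA : ∀ y, y ∈ A ↔ ∃ x, subP L.F x ∈ pPow p k L.carrier (n + 1) ∧ ρ x = y)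
    (ψ : Y.carrier →+ Y'.carrier) (hψA : ∀ y ∈ A, ψ y ∈ A') (hψH : ∀ y ∈ H, ψ y ∈ H')
    (hψ : ∀ x, ρ' (φ.toLinearMap x) = ψ (ρ x))
    (e : RegGroup.Iso (L.U.torsion (p ^ n)) (Y.subquot A H))
    (he : ∀ x z (hx : subP L.F x = (p : WittVector p k) ^ (n + 1) • z) (hxA : ρ x ∈ A),
        e.toAddEquiv ⟨L.mkU z, L.mkU_mem_torsion hx⟩ =
          (QuotientAddGroup.mk (⟨ρ x, hxA⟩ : A) : A ⧸ H.addSubgroupOf A))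
    (e' : RegGroup.Iso (L'.U.torsion (p ^ n)) (Y'.subquot A' H'))
    (he' : ∀ x z (hx : subP L'.F x = (p : WittVector p k) ^ (n + 1) • z) (hxA : ρ' x ∈ A'),
        e'.toAddEquiv ⟨L'.mkU z, L'.mkU_mem_torsion hx⟩ =
          (QuotientAddGroup.mk (⟨ρ' x, hxA⟩ : A') : A' ⧸ H'.addSubgroupOf A'))
    (t : (L.U.torsion (p ^ n)).carrier) :
    e'.toAddEquiv (RegGroup.torsionMap φ.mapU (p ^ n) t) =
      RegGroup.subquotMap ψ hψA hψH (e.toAddEquiv t) := by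
  obtain ⟨t, ht⟩ := t
  obtain ⟨z, rfl⟩ := L.mkU_surjective t
  obtain ⟨x, hx⟩ := L.exists_of_mem_torsion ht
  have hxA : ρ x ∈ A := (hA _).2 ⟨x, mem_pPow.2 ⟨z, hx⟩, rfl⟩
  have hx' : subP L'.F (φ.toLinearMap x) = (p : WittVector p k) ^ (n + 1) • φ.toLinearMap z := by
    rw [← map_smul, ← hx, subP_apply, subP_apply, map_sub, φ.map_F, map_smul]
  have hxA' : ρ' (φ.toLinearMap x) ∈ A' := by rw [hψ]; exact hψA _ hxA
  have h1 := he x z hx hxA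
  have h2 := he' _ _ hx' hxA'
  refine Eq.trans h2 ?_
  rw [h1]
  refine congrArg QuotientAddGroup.mk (Subtype.ext ?_)
  exact hψ x

/-! ### Homomorphisms modulo powers of `p` -/

section Hom

variable {X : Type v} {Y : Type w} [AddCommGroup X] [Module (WittVector p k) X]
  [AddCommGroup Y] [Module (WittVector p k) Y]

theorem mem_pPow_map {τ : WittVector p k →+* WittVector p k} (f : X →ₛₗ[τ] Y) {n : ℕ} {x : X}
    (hx : x ∈ pPow p k X n) : f x ∈ pPow p k Y n := by
  obtain ⟨c, rfl⟩ := mem_pPow.1 hx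
  exact mem_pPow.2 ⟨f c, by rw [map_smulₛₗ, map_pow, map_natCast]⟩

theorem exists_smul_eq_of_forall_mem_pPow [Module.Free (WittVector p k) Y]
    {τ : WittVector p k →+* WittVector p k} (f : X →ₛₗ[τ] Y) {n : ℕ}
    (hf : ∀ x, f x ∈ pPow p k Y n) :
    ∃ g : X →ₛₗ[τ] Y, ∀ x, f x = (p : WittVector p k) ^ n • g x := by
  choose g hg using fun x => mem_pPow.1 (hf x)
  have hinj := smul_right_injective Y (pow_ne_zero n (WittVector.p_nonzero p k))
  refine ⟨{ toFun := g, map_add' := fun x y => hinj ?_, map_smul' := fun c x => hinj ?_ }, hg⟩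
  · dsimp only
    rw [smul_add, ← hg, ← hg, ← hg, map_add]
  · dsimp only
    rw [smul_comm, ← hg, ← hg, map_smulₛₗ]

theorem mem_pPow_linearMap [Module.Free (WittVector p k) Y] {n : ℕ}
    {f : X →ₗ[WittVector p k] Y} :
    f ∈ pPow p k (X →ₗ[WittVector p k] Y) n ↔ ∀ x, f x ∈ pPow p k Y n := by
  constructor
  · intro h x
    obtain ⟨c, rfl⟩ := mem_pPow.1 h
    exact mem_pPow.2 ⟨c x, rfl⟩
  · intro h
    obtain ⟨g, hg⟩ := exists_smul_eq_of_forall_mem_pPow f h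
    exact mem_pPow.2 ⟨g, LinearMap.ext hg⟩

theorem redHom_eq_zero_iff [Module.Free (WittVector p k) Y] {n : ℕ}
    {f : X →ₗ[WittVector p k] Y} :
    redHom n f = 0 ↔ f ∈ pPow p k (X →ₗ[WittVector p k] Y) n := by
  rw [mem_pPow_linearMap]
  constructor
  · intro h x
    exact (Submodule.Quotient.mk_eq_zero _).1 (LinearMap.congr_fun h (Submodule.Quotient.mk x))
  · intro h
    refine LinearMap.ext fun x => ?_
    obtain ⟨x, rfl⟩ := Submodule.Quotient.mk_surjective _ x
    exact (Submodule.Quotient.mk_eq_zero _).2 (h x)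

theorem redHom_surjective [Module.Free (WittVector p k) X] (n : ℕ) :
    Function.Surjective (redHom n : (X →ₗ[WittVector p k] Y) →+ _) := by
  intro f
  obtain ⟨g, hg⟩ := Module.projective_lifting_property (pPow p k Y n).mkQ
    (f.comp (pPow p k X n).mkQ) (Submodule.mkQ_surjective _)
  refine ⟨g, LinearMap.ext fun x => ?_⟩
  obtain ⟨x, rfl⟩ := Submodule.Quotient.mk_surjective _ x
  exact LinearMap.congr_fun hg x

end Hom

/-! ### Homomorphisms of Dieudonné modules as solutions of `F f V = p f` -/

namespace DieudonneModule

variable (M : DieudonneModule.{u, v} p k) (N : DieudonneModule.{u, w} p k)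

/-- The `σ`-linear endomorphism `f ↦ F f V` of `Hom_W(M, N)`. -/
def frobHom : (M.carrier →ₗ[WittVector p k] N.carrier) →ₛₗ[sigma p k]
    (M.carrier →ₗ[WittVector p k] N.carrier) where
  toFun f :=
    { toFun := fun x => N.F (f (M.V x))
      map_add' := fun x y => by simp only [map_add]
      map_smul' := fun c x => by
        simp only [map_smulₛₗ, sigma_sigmaInv, RingHom.id_apply] }
  map_add' f g := LinearMap.ext fun x => map_add N.F _ _
  map_smul' c f := LinearMap.ext fun x => map_smulₛₗ N.F _ _

theorem frobHom_apply (f : M.carrier →ₗ[WittVector p k] N.carrier) (x : M.carrier) :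
    frobHom M N f x = N.F (f (M.V x)) := rfl

variable {M N}

theorem V_injective : Function.Injective N.V := fun x y h => by
  have h1 := congrArg N.F h
  rw [N.F_V, N.F_V] at h1
  exact p_smul_injective (p := p) (k := k) h1

/-- Evaluate `F f V = p f` at `F x`, respectively apply `V` to it, and cancel `p`. -/
theorem frobHom_eq_iff {f : M.carrier →ₗ[WittVector p k] N.carrier} :
    subP (frobHom M N) f = 0 ↔ f ∈ homE M N := by
  rw [subP_apply, sub_eq_zero]
  constructor
  · intro h
    have h' : ∀ x, N.F (f (M.V x)) = (p : WittVector p k) • f x := fun x => LinearMap.congr_fun h x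
    refine ⟨fun x => ?_, fun x => ?_⟩
    · have h1 := h' (M.F x)
      rw [M.V_F, map_smul, map_smulₛₗ, map_natCast] at h1
      exact (p_smul_injective (p := p) (k := k) h1).symm
    · have h1 := congrArg N.V (h' x)
      rw [N.V_F, map_smulₛₗ, map_natCast] at h1
      exact p_smul_injective (p := p) (k := k) h1
  · rintro ⟨hF, hV⟩
    refine LinearMap.ext fun x => ?_
    rw [frobHom_apply, ← hF, M.F_V, map_smul]
    rfl

theorem redHom_mem_homEMod_iff {n : ℕ} {f : M.carrier →ₗ[WittVector p k] N.carrier} :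
    redHom n f ∈ homEMod M N n ↔ (∀ x, f (M.F x) - N.F (f x) ∈ pPow p k N.carrier n) ∧
      ∀ x, f (M.V x) - N.V (f x) ∈ pPow p k N.carrier n := by
  constructor
  · rintro ⟨hF, hV⟩
    exact ⟨fun x => (Submodule.Quotient.eq _).1 (hF (Submodule.Quotient.mk x)),
      fun x => (Submodule.Quotient.eq _).1 (hV (Submodule.Quotient.mk x))⟩
  · rintro ⟨hF, hV⟩
    refine ⟨fun x => ?_, fun x => ?_⟩
    · obtain ⟨x, rfl⟩ := Submodule.Quotient.mk_surjective _ x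
      exact (Submodule.Quotient.eq _).2 (hF x)
    · obtain ⟨x, rfl⟩ := Submodule.Quotient.mk_surjective _ x
      exact (Submodule.Quotient.eq _).2 (hV x)

/-- As for exact solutions; cancelling `p` costs one power, whence `n + 1` against `n`. -/
theorem redHom_mem_homEMod_of_subP {n : ℕ} {f : M.carrier →ₗ[WittVector p k] N.carrier}
    (h : subP (frobHom M N) f ∈ pPow p k (M.carrier →ₗ[WittVector p k] N.carrier) (n + 1)) :
    redHom n f ∈ homEMod M N n := by
  obtain ⟨g, hg⟩ := mem_pPow.1 h
  rw [subP_apply, sub_eq_iff_eq_add] at hg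
  have h' : ∀ x, N.F (f (M.V x)) =
      (p : WittVector p k) ^ (n + 1) • g x + (p : WittVector p k) • f x :=
    fun x => LinearMap.congr_fun hg x
  refine redHom_mem_homEMod_iff.2 ⟨fun x => mem_pPow.2 ⟨-g (M.F x), ?_⟩,
    fun x => mem_pPow.2 ⟨N.V (g x), ?_⟩⟩
  · have h1 := h' (M.F x)
    rw [M.V_F, map_smul, map_smulₛₗ, map_natCast, pow_succ', mul_smul, ← smul_add] at h1
    rw [p_smul_injective (p := p) (k := k) h1, smul_neg]
    abel
  · have h1 := congrArg N.V (h' x)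
    rw [N.V_F, map_add, map_smulₛₗ, map_smulₛₗ, map_pow, map_natCast, pow_succ', mul_smul,
      ← smul_add] at h1
    rw [p_smul_injective (p := p) (k := k) h1]
    abel

/-- Write `f V - V f = p^n b`. Then `F f V - p f = p^n F b`, which lacks a factor `p` unless `b`
takes values in `V N`. Replacing `f` by `f - p^n c` changes `b` by `c V` modulo `V N`, so `c V ≡ b`
is wanted. If `s` is a section of `V` modulo `p`, then `s (V x) - x` lies in the image of `F`, and
`b` maps this image into `V N` because `f` commutes with `F` modulo `p^n`. Hence `c = b ∘ s` works.
-/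
theorem exists_subP_of_redHom_mem_homEMod {n : ℕ} {f : M.carrier →ₗ[WittVector p k] N.carrier}
    (hf : redHom n f ∈ homEMod M N n) :
    ∃ f', redHom n f' = redHom n f ∧
      subP (frobHom M N) f' ∈ pPow p k (M.carrier →ₗ[WittVector p k] N.carrier) (n + 1) := by
  obtain ⟨hF, hV⟩ := redHom_mem_homEMod_iff.1 hf
  obtain ⟨b, hb⟩ : ∃ b : M.carrier →ₛₗ[sigmaInv p k] N.carrier,
      ∀ x, f (M.V x) - N.V (f x) = (p : WittVector p k) ^ n • b x := by
    refine exists_smul_eq_of_forall_mem_pPow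
      ({ toFun := fun x => f (M.V x) - N.V (f x), map_add' := fun x y => ?_,
         map_smul' := fun c x => ?_ } : M.carrier →ₛₗ[sigmaInv p k] N.carrier) hV
    · simp only [map_add]
      abel
    · simp only [map_smulₛₗ, smul_sub, RingHom.id_apply]
  have hbF : ∀ x, ∃ a, b (M.F x) = N.V a := by
    intro x
    obtain ⟨a, ha⟩ := mem_pPow.1 (hF x)
    refine ⟨-a, pow_smul_cancel (p := p) (k := k) (n := n) ?_⟩
    rw [← hb, M.V_F, map_smul, ← N.V_F, ← map_sub, ← neg_sub, ha, ← smul_neg, map_smulₛₗ, map_pow,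
      map_natCast]
  obtain ⟨s, hs⟩ := exists_section_mod_p (τ := sigmaInv p k) (τ' := sigma p k) sigmaInv_sigma M.V
  let c : M.carrier →ₗ[WittVector p k] N.carrier :=
    { toFun := fun x => b (s x)
      map_add' := fun x y => by simp only [map_add]
      map_smul' := fun r x => by simp only [map_smulₛₗ, sigmaInv_sigma, RingHom.id_apply] }
  have hc : ∀ x, ∃ a, c (M.V x) - b x = N.V a := by
    intro x
    obtain ⟨y, hy⟩ := hs x
    obtain ⟨a, ha⟩ := hbF y
    refine ⟨a, ?_⟩
    rw [← M.V_F, ← map_add] at hy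
    change b (s (M.V x)) - b x = _
    rw [V_injective hy, map_add, ha]
    abel
  refine ⟨f - (p : WittVector p k) ^ n • c, ?_, mem_pPow_linearMap.2 fun x => ?_⟩
  · rw [← sub_eq_zero, ← map_sub, redHom_eq_zero_iff]
    exact mem_pPow.2 ⟨-c, by rw [smul_neg]; abel⟩
  · obtain ⟨a, ha⟩ := hc x
    refine mem_pPow.2 ⟨c x - a, ?_⟩
    have h1 : (f - (p : WittVector p k) ^ n • c) (M.V x) =
        N.V (f x - (p : WittVector p k) ^ n • a) := by
      rw [map_sub, map_smulₛₗ, map_pow, map_natCast, ← ha, LinearMap.sub_apply,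
        LinearMap.smul_apply, smul_sub, ← hb]
      abel
    rw [subP_apply, LinearMap.sub_apply, frobHom_apply, h1, N.F_V, LinearMap.smul_apply,
      LinearMap.sub_apply, LinearMap.smul_apply, ← smul_sub, pow_succ', mul_smul, smul_sub _ (c x)]
    congr 1
    abel

variable (M N)

theorem homMod_isQuasiAlgebraic (n : ℕ) : (homMod M N n).IsQuasiAlgebraic p :=
  RegGroup.isQuasiAlgebraic_of_reduction n (homMod M N n) (redHom n) (redHom_surjective n)
    (fun _ => redHom_eq_zero_iff) rfl

theorem homEMod_isClosedIn (n : ℕ) : (homMod M N n).IsClosedIn (homEMod M N n) := by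
  let D : M.carrier ⊕ M.carrier → (M.carrier →ₗ[WittVector p k] N.carrier) →+ N.carrier :=
    Sum.elim
      (fun x => AddMonoidHom.mk' (fun f => f (M.F x) - N.F (f x)) fun f g => by
        simp only [LinearMap.add_apply, map_add]; abel)
      (fun x => AddMonoidHom.mk' (fun f => f (M.V x) - N.V (f x)) fun f g => by
        simp only [LinearMap.add_apply, map_add]; abel)
  have hev : ∀ (x : M.carrier) (m : ℕ),
      LReg p (regFun p k (M.carrier →ₗ[WittVector p k] N.carrier)) m
        (fun f : M.carrier →ₗ[WittVector p k] N.carrier => f x) := fun x m =>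
    (lreg_id_regular m).linear (LinearMap.applyₗ x)
  refine RegGroup.isClosedIn_of_reduction n (homMod M N n) (redHom n) (redHom_surjective n)
    (fun _ => redHom_eq_zero_iff) rfl (homEMod M N n) D ?_ ?_ ?_
  · rintro (x | x) m
    · exact (hev _ m).sub ((hev x m).semilinear N.F)
    · exact (hev _ m).sub ((hev x m).semilinearInv regular_isPerfectAlg N.V)
  · rintro (x | x) f
    · refine mem_pPow.2 ⟨f (M.F x) - N.F (f x), ?_⟩
      change (p : WittVector p k) ^ n • f (M.F x) - N.F ((p : WittVector p k) ^ n • f x) = _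
      rw [map_smulₛₗ, map_pow, map_natCast, smul_sub]
    · refine mem_pPow.2 ⟨f (M.V x) - N.V (f x), ?_⟩
      change (p : WittVector p k) ^ n • f (M.V x) - N.V ((p : WittVector p k) ^ n • f x) = _
      rw [map_smulₛₗ, map_pow, map_natCast, smul_sub]
  · intro f
    rw [redHom_mem_homEMod_iff]
    exact ⟨fun h i => i.casesOn h.1 h.2, fun h => ⟨fun x => h (Sum.inl x), fun x => h (Sum.inr x)⟩⟩

theorem redHom_mem_skewMod_iff {n : ℕ} {f : N.dual.carrier →ₗ[WittVector p k] N.carrier} :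
    redHom n f ∈ N.skewMod n ↔ ∀ a b : Module.Dual (WittVector p k) N.carrier,
      b (f a) + a (f b) ∈ pPow p k (WittVector p k) n := by
  refine forall₂_congr fun a b => ?_
  rw [← sub_neg_eq_add]
  exact Submodule.Quotient.eq _

theorem skewMod_isClosedIn (n : ℕ) : (homMod N.dual N n).IsClosedIn (N.skewMod n) := by
  let D : Module.Dual (WittVector p k) N.carrier × Module.Dual (WittVector p k) N.carrier →
      (N.dual.carrier →ₗ[WittVector p k] N.carrier) →ₗ[WittVector p k] WittVector p k := fun q =>
    q.2.comp (LinearMap.applyₗ (R := WittVector p k) (M := N.dual.carrier) q.1) +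
      q.1.comp (LinearMap.applyₗ (R := WittVector p k) (M := N.dual.carrier) q.2)
  refine RegGroup.isClosedIn_of_reduction n (homMod N.dual N n) (redHom n) (redHom_surjective n)
    (fun _ => redHom_eq_zero_iff) rfl (N.skewMod n) (fun q => (D q).toAddMonoidHom) ?_ ?_ ?_
  · exact fun q m => (lreg_id_regular m).linear (D q)
  · exact fun q x => mem_pPow.2 ⟨D q x, map_smul (D q) _ _⟩
  · intro f
    rw [redHom_mem_skewMod_iff]
    exact ⟨fun h q => h q.1 q.2, fun h a b => h (a, b)⟩

variable {M N}

/-- The isomorphism for an F-crystal which is a direct summand of `Hom_W(M, N)`. -/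
theorem exists_iso_of_retract (L : FCrystal.{u, v'} p k) (n : ℕ)
    (i : L.carrier →ₗ[WittVector p k] (M.carrier →ₗ[WittVector p k] N.carrier))
    (r : (M.carrier →ₗ[WittVector p k] N.carrier) →ₗ[WittVector p k] L.carrier)
    (hri : ∀ z, r (i z) = z)
    (A H : AddSubgroup (homMod M N n).carrier) (hAc : (homMod M N n).IsClosedIn A)
    (hA : ∀ y, y ∈ A ↔ ∃ x, subP L.F x ∈ pPow p k L.carrier (n + 1) ∧ redHom n (i x) = y)
    (hH : ∀ y, y ∈ H ↔ ∃ x ∈ kerP L.F, redHom n (i x) = y) :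
    ((homMod M N n).subquot A H).IsQuasiAlgebraic p ∧
    ∃ e : RegGroup.Iso (L.U.torsion (p ^ n)) ((homMod M N n).subquot A H),
      ∀ x z (hx : subP L.F x = (p : WittVector p k) ^ (n + 1) • z)
        (hxA : ((redHom n).comp i.toAddMonoidHom) x ∈ A),
        e.toAddEquiv ⟨L.mkU z, L.mkU_mem_torsion hx⟩ =
          (QuotientAddGroup.mk (⟨_, hxA⟩ : A) : A ⧸ H.addSubgroupOf A) := by
  have hker : ∀ x, (redHom n).comp i.toAddMonoidHom x = 0 ↔ x ∈ pPow p k L.carrier n := by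
    intro x
    refine redHom_eq_zero_iff.trans ⟨fun h => ?_, fun h => mem_pPow_map i h⟩
    rw [← hri x]
    exact mem_pPow_map r h
  have hfin : Finite H := L.finite_of_kerP n _ hker H hH
  refine ⟨(homMod_isQuasiAlgebraic M N n).subquot hAc H,
    L.exists_snake_iso n (homMod M N n) A H ((redHom n).comp i.toAddMonoidHom) hker hA hH ?_ ?_⟩
  · intro f hf
    have hf' : (fun x => f (redHom n x)) ∈
      regFun p k (M.carrier →ₗ[WittVector p k] N.carrier) := hf
    exact comp_mem_of_mem_regular regular_isPerfectAlg
      (fun m => (lreg_id_regular (p := p) (k := k) m).linear i) hf'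
  · intro g hg hgn
    -- Regular functions on `L / p ^ n` extend to `Hom_W(M / p ^ n, N / p ^ n)` by composition with
    -- the retraction.
    choose sec hsec using redHom_surjective (p := p) (k := k) (X := M.carrier) (Y := N.carrier) n
    have hr : ∀ f, g (r (sec (redHom n f))) = g (r f) := fun f => hgn _ _ (by
      rw [← map_sub]
      refine mem_pPow_map r (redHom_eq_zero_iff.1 ?_)
      rw [map_sub, hsec, sub_self])
    refine ⟨fun y => g (r (sec y)), ?_, fun x => ?_⟩
    · change (fun f => g (r (sec (redHom n f)))) ∈
        regFun p k (M.carrier →ₗ[WittVector p k] N.carrier)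
      simp only [hr]
      exact comp_mem_of_mem_regular regular_isPerfectAlg
        (fun m => (lreg_id_regular (p := p) (k := k) m).linear r) hg
    · exact (hr (i x)).trans (congrArg g (hri x))

end DieudonneModule

end QuasiAlg
end

noncomputable section
namespace QuasiAlg

variable {p : ℕ} [Fact p.Prime] {k : Type u} [Field k] [CharP k p] [IsAlgClosed k]

namespace DieudonneModule

/-! ### The crystal `M^∨ ⊗ N` -/

section Tensor

variable (M : DieudonneModule.{u, v} p k) (N : DieudonneModule.{u, w} p k)

/-- The canonical isomorphism `M^∨ ⊗ N ≃ Hom_W(M, N)`. -/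
def tensorEquiv : (M.dual.tensor N).carrier ≃ₗ[WittVector p k]
    (M.carrier →ₗ[WittVector p k] N.carrier) :=
  dualTensorHomEquiv (WittVector p k) M.carrier N.carrier

variable {M N}

theorem tensorEquiv_tmul (f : Module.Dual (WittVector p k) M.carrier) (y : N.carrier)
    (x : M.carrier) : tensorEquiv M N (f ⊗ₜ y) x = f x • y := by
  simp [tensorEquiv]

theorem tensorEquiv_F (z : (M.dual.tensor N).carrier) :
    tensorEquiv M N ((M.dual.tensor N).F z) = frobHom M N (tensorEquiv M N z) := by
  induction z using TensorProduct.induction_on with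
  | zero => simp only [map_zero]
  | tmul f y =>
    refine LinearMap.ext fun x => ?_
    have h : (M.dual.tensor N).F (f ⊗ₜ y) = M.dual.F f ⊗ₜ N.F y := TensorProduct.map_tmul _ _ _ _
    rw [h, frobHom_apply, tensorEquiv_tmul, tensorEquiv_tmul, map_smulₛₗ]
    rfl
  | add a b ha hb => simp only [map_add, ha, hb]

theorem tensorEquiv_subP (z : (M.dual.tensor N).carrier) :
    tensorEquiv M N (subP (M.dual.tensor N).F z) = subP (frobHom M N) (tensorEquiv M N z) := by
  rw [subP_apply, subP_apply, map_sub, map_smul, tensorEquiv_F]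

theorem tensorEquiv_tensorHom {M' : DieudonneModule.{u, v'} p k}
    {N' : DieudonneModule.{u, w'} p k} (α : homE M' M) (β : homE N N')
    (z : (M.dual.tensor N).carrier) :
    tensorEquiv M' N' ((tensorHom α β).toLinearMap z) =
      β.1.comp ((tensorEquiv M N z).comp α.1) := by
  induction z using TensorProduct.induction_on with
  | zero => simp only [map_zero, LinearMap.zero_comp, LinearMap.comp_zero]
  | tmul f y =>
    refine LinearMap.ext fun x => ?_
    have h : (tensorHom α β).toLinearMap (f ⊗ₜ y) = LinearMap.dualMap α.1 f ⊗ₜ β.1 y :=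
      TensorProduct.map_tmul _ _ _ _
    rw [h, tensorEquiv_tmul, LinearMap.comp_apply, LinearMap.comp_apply, tensorEquiv_tmul,
      map_smul]
    rfl
  | add a b ha hb => simp only [map_add, ha, hb, LinearMap.add_comp, LinearMap.comp_add]

theorem mem_homEMod_iff_exists {n : ℕ} {y : (homMod M N n).carrier} :
    y ∈ homEMod M N n ↔ ∃ z, subP (M.dual.tensor N).F z ∈
      pPow p k (M.dual.tensor N).carrier (n + 1) ∧ redHom n (tensorEquiv M N z) = y := by
  constructor
  · intro hy
    obtain ⟨f, rfl⟩ := redHom_surjective n y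
    obtain ⟨f', hf', h⟩ := exists_subP_of_redHom_mem_homEMod hy
    obtain ⟨z, rfl⟩ := (tensorEquiv M N).surjective f'
    refine ⟨z, ?_, hf'⟩
    rw [← tensorEquiv_subP] at h
    have h1 := mem_pPow_map (tensorEquiv M N).symm.toLinearMap h
    rwa [LinearEquiv.coe_toLinearMap, LinearEquiv.symm_apply_apply] at h1
  · rintro ⟨z, hz, rfl⟩
    refine redHom_mem_homEMod_of_subP ?_
    rw [← tensorEquiv_subP]
    exact mem_pPow_map (tensorEquiv M N).toLinearMap hz

theorem mem_homERed_iff_exists {n : ℕ} {y : (homMod M N n).carrier} :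
    y ∈ homERed M N n ↔ ∃ z ∈ kerP (M.dual.tensor N).F, redHom n (tensorEquiv M N z) = y := by
  have h : ∀ z, z ∈ kerP (M.dual.tensor N).F ↔ tensorEquiv M N z ∈ homE M N := fun z => by
    rw [← frobHom_eq_iff, ← tensorEquiv_subP, LinearEquiv.map_eq_zero_iff]
    rfl
  constructor
  · rintro ⟨f, hf, rfl⟩
    obtain ⟨z, rfl⟩ := (tensorEquiv M N).surjective f
    exact ⟨z, (h z).2 hf, rfl⟩
  · rintro ⟨z, hz, rfl⟩
    exact ⟨_, (h z).1 hz, rfl⟩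

variable (M N)

theorem exists_tensor_iso (n : ℕ) : (M.homQuot N n).IsQuasiAlgebraic p ∧
    ∃ e : RegGroup.Iso ((M.dual.tensor N).U.torsion (p ^ n)) (M.homQuot N n),
      ∀ x z (hx : subP (M.dual.tensor N).F x = (p : WittVector p k) ^ (n + 1) • z)
        (hxA : ((redHom n).comp (tensorEquiv M N).toLinearMap.toAddMonoidHom) x ∈ homEMod M N n),
        e.toAddEquiv ⟨(M.dual.tensor N).mkU z, (M.dual.tensor N).mkU_mem_torsion hx⟩ =
          (QuotientAddGroup.mk (⟨_, hxA⟩ : homEMod M N n) :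
            homEMod M N n ⧸ (homERed M N n).addSubgroupOf (homEMod M N n)) :=
  exists_iso_of_retract (M.dual.tensor N) n (tensorEquiv M N).toLinearMap
    (tensorEquiv M N).symm.toLinearMap (tensorEquiv M N).symm_apply_apply _ _
    (homEMod_isClosedIn M N n) (fun _ => mem_homEMod_iff_exists) (fun _ => mem_homERed_iff_exists)

end Tensor

/-! ### The crystal `⋀² N` -/

section Wedge

variable (N : DieudonneModule.{u, v} p k)

/-- The homomorphism `a ↦ a v • w` from `N^∨` to `N`. -/
def rankOne : N.carrier →ₗ[WittVector p k] N.carrier →ₗ[WittVector p k]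
    (N.dual.carrier →ₗ[WittVector p k] N.carrier) :=
  LinearMap.mk₂ (WittVector p k)
    (fun v w => (Module.Dual.eval (WittVector p k) N.carrier v).smulRight w)
    (fun v v' w => LinearMap.ext fun a => by
      change a (v + v') • w = a v • w + a v' • w
      rw [map_add, add_smul])
    (fun c v w => LinearMap.ext fun a => by
      change a (c • v) • w = c • a v • w
      rw [map_smul, smul_assoc])
    (fun v w w' => LinearMap.ext fun a => by
      change a v • (w + w') = a v • w + a v • w'
      rw [smul_add])
    (fun c v w => LinearMap.ext fun a => by
      change a v • c • w = c • a v • w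
      rw [smul_comm])

variable {N}

theorem rankOne_apply (v w : N.carrier) (a : Module.Dual (WittVector p k) N.carrier) :
    rankOne N v w a = a v • w := rfl

/-- The wedge product. -/
def wedge₂ (v w : N.carrier) : N.wedge.carrier := exteriorPower.ιMulti (WittVector p k) 2 ![v, w]

theorem update_pair_zero (v w x : N.carrier) : Function.update ![v, w] 0 x = ![x, w] := by
  funext i
  fin_cases i <;> simp

theorem wedge₂_add_left (v v' w : N.carrier) : wedge₂ (v + v') w = wedge₂ v w + wedge₂ v' w := by
  have h := (exteriorPower.ιMulti (WittVector p k) 2 (M := N.carrier)).map_update_add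
    ![v, w] 0 v v'
  rw [update_pair_zero, update_pair_zero, update_pair_zero] at h
  exact h

theorem wedge₂_smul_left (c : WittVector p k) (v w : N.carrier) :
    wedge₂ (c • v) w = c • wedge₂ v w := by
  have h := (exteriorPower.ιMulti (WittVector p k) 2 (M := N.carrier)).map_update_smul
    ![v, w] 0 c v
  rw [update_pair_zero, update_pair_zero] at h
  exact h

theorem wedge₂_swap (v w : N.carrier) : wedge₂ w v = -wedge₂ v w := by
  have h := (exteriorPower.ιMulti (WittVector p k) 2 (M := N.carrier)).map_swap
    ![v, w] (show (0 : Fin 2) ≠ 1 by decide)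
  have h2 : (![v, w] : Fin 2 → N.carrier) ∘ Equiv.swap 0 1 = ![w, v] := by
    funext i
    fin_cases i <;> simp
  rw [h2] at h
  exact h

variable (N) in
/-- The wedge product as a bilinear map. -/
def wedgeBilin : N.carrier →ₗ[WittVector p k] N.carrier →ₗ[WittVector p k] N.wedge.carrier :=
  LinearMap.mk₂ (WittVector p k) wedge₂ wedge₂_add_left wedge₂_smul_left
    (fun v w w' => by
      rw [wedge₂_swap (w + w') v, wedge₂_add_left, wedge₂_swap v w, wedge₂_swap v w']
      abel)
    (fun c v w => by
      rw [wedge₂_swap (c • w) v, wedge₂_smul_left, wedge₂_swap v w]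
      rw [smul_neg, neg_neg])

theorem wedge_induction {P : N.wedge.carrier → Prop} (h0 : P 0)
    (h : ∀ v w : N.carrier, P (wedge₂ v w)) (hadd : ∀ x y, P x → P y → P (x + y)) (z) : P z := by
  have hz : z ∈ Submodule.span (WittVector p k)
      (Set.range (exteriorPower.ιMulti (WittVector p k) 2 (M := N.carrier))) := by
    rw [exteriorPower.ιMulti_span]; trivial
  suffices hs : ∀ c : WittVector p k, P (c • z) by simpa using hs 1
  induction hz using Submodule.span_induction with
  | mem x hx =>
    obtain ⟨v, rfl⟩ := hx
    intro c
    have h1 : c • exteriorPower.ιMulti (WittVector p k) 2 v = wedge₂ (c • v 0) (v 1) := by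
      rw [wedge₂_smul_left, wedge₂]
      congr 2
      funext i
      fin_cases i <;> rfl
    rw [h1]
    exact h _ _
  | zero => intro c; rwa [smul_zero]
  | add a b _ _ ha hb => intro c; rw [smul_add]; exact hadd _ _ (ha c) (hb c)
  | smul d a _ ha => intro c; rw [← mul_smul]; exact ha _

variable (N) in
/-- The homomorphism `⋀² N → Hom_W(N^∨, N)` which maps `v ∧ w` to `a ↦ a v • w - a w • v`. -/
def wedgeToHom : N.wedge.carrier →ₗ[WittVector p k]
    (N.dual.carrier →ₗ[WittVector p k] N.carrier) :=
  exteriorPower.alternatingMapLinearEquiv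
    { toFun := fun v => rankOne N (v 0) (v 1) - rankOne N (v 1) (v 0)
      map_update_add' := by
        intro _ v i x y
        fin_cases i <;> simp <;> abel
      map_update_smul' := by
        intro _ v i c x
        fin_cases i <;> simp [smul_sub]
      map_eq_zero_of_eq' := by
        intro v i j hij hne
        have h : v 0 = v 1 := by
          fin_cases i <;> fin_cases j <;> first | exact absurd rfl hne | exact hij | exact hij.symm
        rw [h, sub_self] }

theorem wedgeToHom_wedge₂ (v w : N.carrier) :
    wedgeToHom N (wedge₂ v w) = rankOne N v w - rankOne N w v :=
  exteriorPower.alternatingMapLinearEquiv_apply_ιMulti _ _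

theorem wedge_F_wedge₂ (v w : N.carrier) : N.wedge.F (wedge₂ v w) = wedge₂ (N.F v) (N.F w) := by
  refine (wedgeMap_apply_ιMulti N.F _).trans ?_
  rw [wedge₂]
  congr 1
  funext i
  fin_cases i <;> rfl

theorem frobHom_rankOne (v w : N.carrier) :
    frobHom N.dual N (rankOne N v w) = rankOne N (N.F v) (N.F w) := by
  refine LinearMap.ext fun a => ?_
  rw [frobHom_apply]
  refine (map_smulₛₗ N.F _ _).trans ?_
  exact congrArg (· • N.F w) (sigma_sigmaInv (a (N.F v)))

theorem wedgeToHom_F (z : N.wedge.carrier) :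
    wedgeToHom N (N.wedge.F z) = frobHom N.dual N (wedgeToHom N z) := by
  induction z using wedge_induction with
  | h0 => simp only [map_zero]
  | h v w =>
    rw [wedge_F_wedge₂, wedgeToHom_wedge₂, wedgeToHom_wedge₂, map_sub, frobHom_rankOne,
      frobHom_rankOne]
  | hadd x y hx hy => simp only [map_add, hx, hy]

theorem wedgeToHom_subP (z : N.wedge.carrier) :
    wedgeToHom N (subP N.wedge.F z) = subP (frobHom N.dual N) (wedgeToHom N z) := by
  rw [subP_apply, subP_apply, map_sub, map_smul, wedgeToHom_F]

theorem wedgeToHom_mem_skew (z : N.wedge.carrier) : wedgeToHom N z ∈ N.skew := by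
  induction z using wedge_induction with
  | h0 => rw [map_zero]; exact zero_mem _
  | h v w =>
    intro a b
    rw [wedgeToHom_wedge₂]
    change b (a v • w - a w • v) = -a (b v • w - b w • v)
    simp only [map_sub, map_smul, smul_eq_mul]
    ring
  | hadd x y hx hy => rw [map_add]; exact add_mem hx hy

variable (N) in
/-- The homomorphism `Hom_W(N^∨, N) → ⋀² N` which maps `a ↦ a v • w` to `v ∧ w`. -/
def homToWedge : (N.dual.carrier →ₗ[WittVector p k] N.carrier) →ₗ[WittVector p k]
    N.wedge.carrier :=
  ∑ i, (wedgeBilin N (bas p k N.carrier i)).comp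
    (LinearMap.applyₗ (R := WittVector p k) (M := N.dual.carrier) ((bas p k N.carrier).coord i))

theorem homToWedge_apply (f : N.dual.carrier →ₗ[WittVector p k] N.carrier) :
    homToWedge N f = ∑ i, wedgeBilin N (bas p k N.carrier i) (f ((bas p k N.carrier).coord i)) := by
  rw [homToWedge, LinearMap.sum_apply]
  rfl

theorem homToWedge_rankOne (v w : N.carrier) : homToWedge N (rankOne N v w) = wedge₂ v w := by
  have h : ∑ i, (bas p k N.carrier).coord i v • bas p k N.carrier i = v :=
    (bas p k N.carrier).sum_repr v
  have h2 : wedgeBilin N v w = wedge₂ v w := rfl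
  rw [homToWedge_apply, ← h2]
  conv_rhs => rw [← h]
  rw [map_sum, LinearMap.sum_apply]
  refine Finset.sum_congr rfl fun i _ => ?_
  rw [rankOne_apply, map_smul, map_smul]
  rfl

theorem eq_sum_coord (a : Module.Dual (WittVector p k) N.carrier) :
    a = ∑ i, a (bas p k N.carrier i) • (bas p k N.carrier).coord i := by
  refine (bas p k N.carrier).ext fun j => ?_
  classical
  simp

theorem eq_sum_rankOne (f : N.dual.carrier →ₗ[WittVector p k] N.carrier) :
    f = ∑ i, rankOne N (bas p k N.carrier i) (f ((bas p k N.carrier).coord i)) := by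
  refine LinearMap.ext fun a => ?_
  conv_lhs => rw [eq_sum_coord a]
  rw [map_sum, LinearMap.sum_apply]
  exact Finset.sum_congr rfl fun i _ => map_smul f _ _

theorem homToWedge_wedgeToHom (z : N.wedge.carrier) :
    homToWedge N (wedgeToHom N z) = (2 : WittVector p k) • z := by
  induction z using wedge_induction with
  | h0 => simp only [map_zero, smul_zero]
  | h v w =>
    rw [wedgeToHom_wedge₂, map_sub, homToWedge_rankOne, homToWedge_rankOne, wedge₂_swap v w,
      two_smul, sub_neg_eq_add]
  | hadd x y hx hy => rw [map_add, map_add, hx, hy, smul_add]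

theorem homToWedge_frobHom (f : N.dual.carrier →ₗ[WittVector p k] N.carrier) :
    homToWedge N (frobHom N.dual N f) = N.wedge.F (homToWedge N f) := by
  rw [eq_sum_rankOne f, map_sum, map_sum, map_sum, map_sum]
  refine Finset.sum_congr rfl fun i _ => ?_
  rw [frobHom_rankOne, homToWedge_rankOne, homToWedge_rankOne, wedge_F_wedge₂]

theorem homToWedge_subP (f : N.dual.carrier →ₗ[WittVector p k] N.carrier) :
    homToWedge N (subP (frobHom N.dual N) f) = subP N.wedge.F (homToWedge N f) := by
  rw [subP_apply, subP_apply, map_sub, map_smul, homToWedge_frobHom]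

/-- The composite is `f - f^∨`. Written as `2 f - (f + f^∨)` it displays the failure of skewness as
an error term, so the formula serves both exactly and modulo `p ^ n`. -/
theorem wedgeToHom_homToWedge (f : N.dual.carrier →ₗ[WittVector p k] N.carrier)
    (a : Module.Dual (WittVector p k) N.carrier) :
    wedgeToHom N (homToWedge N f) a = (2 : WittVector p k) • f a -
      ∑ i, ((bas p k N.carrier).coord i (f a) + a (f ((bas p k N.carrier).coord i))) •
        bas p k N.carrier i := by
  have h1 : ∑ i, (bas p k N.carrier).coord i (f a) • bas p k N.carrier i = f a :=
    (bas p k N.carrier).sum_repr (f a)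
  have h2 : wedgeToHom N (homToWedge N f) = f -
      ∑ i, rankOne N (f ((bas p k N.carrier).coord i)) (bas p k N.carrier i) := by
    conv_lhs => rw [eq_sum_rankOne f, map_sum, map_sum]
    conv_rhs => rw [eq_sum_rankOne f, ← Finset.sum_sub_distrib]
    refine Finset.sum_congr rfl fun i _ => ?_
    rw [homToWedge_rankOne, wedgeToHom_wedge₂, ← eq_sum_rankOne f]
  have h3 : (∑ i, rankOne N (f ((bas p k N.carrier).coord i)) (bas p k N.carrier i)) a =
      ∑ i, a (f ((bas p k N.carrier).coord i)) • bas p k N.carrier i := LinearMap.sum_apply _ _ _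
  simp only [add_smul, Finset.sum_add_distrib]
  rw [h1, h2, LinearMap.sub_apply, h3, two_smul]
  abel

/-- Uniqueness of inverses makes `1/2` fixed by `σ`, so the projector built from it commutes with
`F`. -/
theorem exists_half (hp : p ≠ 2) : ∃ h : WittVector p k, h * 2 = 1 ∧ sigma p k h = h := by
  have h2 : ((2 : WittVector p k)).coeff 0 ≠ 0 := by
    have h3 : WittVector.constantCoeff (2 : WittVector p k) = (2 : k) := map_ofNat _ 2
    change WittVector.constantCoeff (2 : WittVector p k) ≠ 0
    rw [h3]
    intro h0
    have h4 : ((2 : ℕ) : k) = 0 := by exact_mod_cast h0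
    rw [CharP.cast_eq_zero_iff k p] at h4
    exact hp ((Nat.prime_dvd_prime_iff_eq Fact.out Nat.prime_two).1 h4)
  obtain ⟨h, hh⟩ := (WittVector.isUnit_of_coeff_zero_ne_zero (2 : WittVector p k) h2).exists_left_inv
  refine ⟨h, hh, ?_⟩
  have h5 : sigma p k h * 2 = 1 := by
    rw [← map_ofNat (sigma p k) 2, ← map_mul, hh, map_one]
  exact left_inv_eq_right_inv h5 (by rw [mul_comm, hh])


end Wedge

end DieudonneModule

end QuasiAlg
end

noncomputable section
namespace QuasiAlg

variable {p : ℕ} [Fact p.Prime] {k : Type u} [Field k] [CharP k p] [IsAlgClosed k]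

namespace DieudonneModule

/-! ### The isomorphism for `⋀² N` when `2` is invertible -/

section Skew

variable {N : DieudonneModule.{u, v} p k}

theorem smul_homToWedge_wedgeToHom {h : WittVector p k} (hh : h * 2 = 1) (z : N.wedge.carrier) :
    (h • homToWedge N) (wedgeToHom N z) = z := by
  rw [LinearMap.smul_apply, homToWedge_wedgeToHom, ← mul_smul, hh, one_smul]

theorem smul_homToWedge_subP {h : WittVector p k} (hσ : sigma p k h = h)
    (f : N.dual.carrier →ₗ[WittVector p k] N.carrier) :
    subP N.wedge.F ((h • homToWedge N) f) =
      (h • homToWedge N) (subP (frobHom N.dual N) f) := by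
  rw [LinearMap.smul_apply, LinearMap.smul_apply, homToWedge_subP, subP_apply, subP_apply,
    map_smulₛₗ, hσ, smul_sub, smul_comm h]

theorem sub_mem_pPow_of_skew {h : WittVector p k} (hh : h * 2 = 1) {n : ℕ}
    {f : N.dual.carrier →ₗ[WittVector p k] N.carrier}
    (hf : ∀ a b : Module.Dual (WittVector p k) N.carrier,
      b (f a) + a (f b) ∈ pPow p k (WittVector p k) n) :
    wedgeToHom N ((h • homToWedge N) f) - f ∈
      pPow p k (N.dual.carrier →ₗ[WittVector p k] N.carrier) n := by
  rw [mem_pPow_linearMap]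
  intro a
  rw [LinearMap.sub_apply, LinearMap.smul_apply, map_smul, LinearMap.smul_apply,
    wedgeToHom_homToWedge, smul_sub, ← mul_smul, hh, one_smul, sub_sub_cancel_left]
  refine neg_mem (Submodule.smul_mem _ _ (Submodule.sum_mem _ fun i _ => ?_))
  obtain ⟨c, hc⟩ := mem_pPow.1 (hf a ((bas p k N.carrier).coord i))
  exact mem_pPow.2 ⟨c • bas p k N.carrier i, by rw [hc, smul_assoc]⟩

theorem wedgeToHom_smul_homToWedge {h : WittVector p k} (hh : h * 2 = 1)
    {f : N.dual.carrier →ₗ[WittVector p k] N.carrier} (hf : f ∈ N.skew) :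
    wedgeToHom N ((h • homToWedge N) f) = f := by
  refine LinearMap.ext fun a => ?_
  rw [LinearMap.smul_apply, map_smul, LinearMap.smul_apply, wedgeToHom_homToWedge,
    Finset.sum_eq_zero fun i _ => ?_, sub_zero, ← mul_smul, hh, one_smul]
  rw [hf a, neg_add_cancel, zero_smul]

/-- The corrected lift from the case of all homomorphisms is skew only modulo `p ^ n`. Projecting it
to `⋀² N` changes nothing modulo `p ^ n` and commutes with `F - p`, so divisibility by `p ^ (n+1)`
survives. -/
theorem mem_skewEMod_iff_exists (hp : p ≠ 2) {n : ℕ} {y : (homMod N.dual N n).carrier} :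
    y ∈ homEMod N.dual N n ⊓ N.skewMod n ↔ ∃ z, subP N.wedge.F z ∈
      pPow p k N.wedge.carrier (n + 1) ∧ redHom n (wedgeToHom N z) = y := by
  constructor
  · rintro ⟨hy, hys⟩
    obtain ⟨h, hh, hσ⟩ := exists_half (p := p) (k := k) hp
    obtain ⟨f, rfl⟩ := redHom_surjective n y
    obtain ⟨f', hf', hfA⟩ := exists_subP_of_redHom_mem_homEMod hy
    rw [← hf'] at hys ⊢
    refine ⟨(h • homToWedge N) f', ?_, ?_⟩
    · rw [smul_homToWedge_subP hσ]
      exact mem_pPow_map _ hfA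
    · rw [← sub_eq_zero, ← map_sub, redHom_eq_zero_iff]
      exact sub_mem_pPow_of_skew hh ((redHom_mem_skewMod_iff N).1 hys)
  · rintro ⟨z, hz, rfl⟩
    refine ⟨redHom_mem_homEMod_of_subP ?_, ?_⟩
    · rw [← wedgeToHom_subP]
      exact mem_pPow_map (wedgeToHom N) hz
    · refine (redHom_mem_skewMod_iff N).2 fun a b => ?_
      rw [wedgeToHom_mem_skew z a b, neg_add_cancel]
      exact zero_mem _

theorem mem_skewERed_iff_exists (hp : p ≠ 2) {n : ℕ} {y : (homMod N.dual N n).carrier} :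
    y ∈ skewERed N n ↔ ∃ z ∈ kerP N.wedge.F, redHom n (wedgeToHom N z) = y := by
  constructor
  · rintro ⟨f, ⟨hf, hfs⟩, rfl⟩
    obtain ⟨h, hh, hσ⟩ := exists_half (p := p) (k := k) hp
    refine ⟨(h • homToWedge N) f, ?_, ?_⟩
    · change subP N.wedge.F _ = 0
      rw [smul_homToWedge_subP hσ, frobHom_eq_iff.2 hf, map_zero]
    · rw [wedgeToHom_smul_homToWedge hh hfs]
  · rintro ⟨z, hz, rfl⟩
    refine ⟨_, ⟨frobHom_eq_iff.1 ?_, wedgeToHom_mem_skew z⟩, rfl⟩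
    rw [← wedgeToHom_subP, show subP N.wedge.F z = 0 from hz, map_zero]

theorem wedgeToHom_wedgeHom {N' : DieudonneModule.{u, w} p k} (φ : homE N N')
    (z : N.wedge.carrier) :
    wedgeToHom N' ((wedgeHom φ).toLinearMap z) =
      φ.1.comp ((wedgeToHom N z).comp (dualHom φ).1) := by
  induction z using wedge_induction with
  | h0 => simp only [map_zero, LinearMap.zero_comp, LinearMap.comp_zero]
  | h v w =>
    have h : (wedgeHom φ).toLinearMap (wedge₂ v w) = wedge₂ (φ.1 v) (φ.1 w) := by
      refine (exteriorPower.map_apply_ιMulti _ _).trans ?_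
      rw [wedge₂]
      congr 1
      funext i
      fin_cases i <;> rfl
    rw [h, wedgeToHom_wedge₂, wedgeToHom_wedge₂]
    refine LinearMap.ext fun a => ?_
    change a (φ.1 v) • φ.1 w - a (φ.1 w) • φ.1 v = φ.1 (a (φ.1 v) • w - a (φ.1 w) • v)
    rw [map_sub, map_smul, map_smul]
  | hadd x y hx hy => simp only [map_add, hx, hy, LinearMap.add_comp, LinearMap.comp_add]

variable (N) in
theorem exists_wedge_iso (hp : p ≠ 2) (n : ℕ) : (N.skewQuot n).IsQuasiAlgebraic p ∧
    ∃ e : RegGroup.Iso (N.wedge.U.torsion (p ^ n)) (N.skewQuot n),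
      ∀ x z (hx : subP N.wedge.F x = (p : WittVector p k) ^ (n + 1) • z)
        (hxA : ((redHom n).comp (wedgeToHom N).toAddMonoidHom) x ∈
          homEMod N.dual N n ⊓ N.skewMod n),
        e.toAddEquiv ⟨N.wedge.mkU z, N.wedge.mkU_mem_torsion hx⟩ =
          (QuotientAddGroup.mk (⟨_, hxA⟩ : ↥(homEMod N.dual N n ⊓ N.skewMod n)) :
            ↥(homEMod N.dual N n ⊓ N.skewMod n) ⧸
              (skewERed N n).addSubgroupOf (homEMod N.dual N n ⊓ N.skewMod n)) := by
  obtain ⟨h, hh, -⟩ := exists_half (p := p) (k := k) hp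
  exact exists_iso_of_retract N.wedge n (wedgeToHom N) (h • homToWedge N)
    (smul_homToWedge_wedgeToHom hh) _ _
    (RegGroup.IsClosedIn.inf (homEMod_isClosedIn N.dual N n) (skewMod_isClosedIn N n))
    (fun _ => mem_skewEMod_iff_exists hp) (fun _ => mem_skewERed_iff_exists hp)

end Skew

end DieudonneModule

end QuasiAlg
end

theorem corollary2p14 (p : ℕ) [Fact p.Prime] (k : Type u) [Field k] [CharP k p] [IsAlgClosed k]
    (n : ℕ) (hn : 1 ≤ n) :
    -- `U_{M^∨ ⊗ N}[p ^ n] ≅ Hom_𝔼(M / p ^ n, N / p ^ n) / (Hom_𝔼(M, N) / p ^ n)`, naturally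
    (∃ e : ∀ (M : QuasiAlg.DieudonneModule.{u, v} p k) (N : QuasiAlg.DieudonneModule.{u, w} p k),
        QuasiAlg.RegGroup.Iso ((M.dual.tensor N).U.torsion (p ^ n)) (M.homQuot N n),
      (∀ (M : QuasiAlg.DieudonneModule.{u, v} p k) (N : QuasiAlg.DieudonneModule.{u, w} p k),
        ((M.dual.tensor N).U.torsion (p ^ n)).IsQuasiAlgebraic p ∧
        (M.homQuot N n).IsQuasiAlgebraic p) ∧
      ∀ (M M' : QuasiAlg.DieudonneModule.{u, v} p k) (N N' : QuasiAlg.DieudonneModule.{u, w} p k)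
        (α : M'.homE M) (β : N.homE N')
        (z : ((M.dual.tensor N).U.torsion (p ^ n)).carrier),
        (e M' N').toAddEquiv (QuasiAlg.RegGroup.torsionMap
            (QuasiAlg.DieudonneModule.tensorHom α β).mapU (p ^ n) z) =
          QuasiAlg.DieudonneModule.homQuotMap n α β ((e M N).toAddEquiv z)) ∧
    -- for `p ≠ 2`, naturally,
    -- `U_{⋀² N}[p ^ n] ≅ Hom_𝔼(N^∨ / p ^ n, N / p ^ n)^skew / (Hom_𝔼(N^∨, N)^skew / p ^ n)`
    (p ≠ 2 → ∃ e : ∀ N : QuasiAlg.DieudonneModule.{u, v} p k,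
        QuasiAlg.RegGroup.Iso (N.wedge.U.torsion (p ^ n)) (N.skewQuot n),
      (∀ N : QuasiAlg.DieudonneModule.{u, v} p k,
        (N.wedge.U.torsion (p ^ n)).IsQuasiAlgebraic p ∧ (N.skewQuot n).IsQuasiAlgebraic p) ∧
      ∀ (N N' : QuasiAlg.DieudonneModule.{u, v} p k) (φ : N.homE N')
        (z : (N.wedge.U.torsion (p ^ n)).carrier),
        (e N').toAddEquiv (QuasiAlg.RegGroup.torsionMap
            (QuasiAlg.DieudonneModule.wedgeHom φ).mapU (p ^ n) z) =
          QuasiAlg.DieudonneModule.skewQuotMap n φ ((e N).toAddEquiv z)) := by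
  open QuasiAlg QuasiAlg.DieudonneModule in
  constructor
  · choose e he using fun (M : DieudonneModule.{u, v} p k) (N : DieudonneModule.{u, w} p k) =>
      (exists_tensor_iso M N n).2
    refine ⟨e, fun M N => ?_, fun M M' N N' α β z => ?_⟩
    · have h := (exists_tensor_iso M N n).1
      -- Quasi-algebraicity of the torsion of `U` is transported from the right-hand side.
      exact ⟨h.of_iso (e M N), h⟩
    · exact FCrystal.snake_natural (tensorHom α β) n _ _ (fun _ => mem_homEMod_iff_exists)
        (conj n α β) _ _ (fun x => (congrArg (redHom n) (tensorEquiv_tensorHom α β x)).trans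
          (conj_redHom n α β _).symm) (e M N) (he M N) (e M' N') (he M' N') z
  · intro hp
    choose e he using fun N : DieudonneModule.{u, v} p k => (exists_wedge_iso N hp n).2
    refine ⟨e, fun N => ?_, fun N N' φ z => ?_⟩
    · have h := (exists_wedge_iso N hp n).1
      exact ⟨h.of_iso (e N), h⟩
    · exact FCrystal.snake_natural (wedgeHom φ) n _ _ (fun _ => mem_skewEMod_iff_exists hp)
        (conj n (dualHom φ) φ) _ _ (fun x => (congrArg (redHom n) (wedgeToHom_wedgeHom φ x)).trans
          (conj_redHom n (dualHom φ) φ _).symm) (e N) (he N) (e N') (he N') z
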